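/- **Conventions.** A scheme in a relational language $L$ is an $L$-sentence in which schematic predicate letters $P$ (not in $L$) may occur. We consider second-order structures $(\mathcal M,\mathcal X)$, where $\mathcal X$ is a collection of relations of all finite arities on $\mathcal M$ (the classes). For a set $S$ of schemes, $(\mathcal M,\mathcal X)\models \mathrm{PC}(S)$ means that $\mathcal X$ contains every relation that is definable by a formula quantifying over elements of $\mathcal M$ only, with parameters from $\mathcal M$ and $\mathcal X$, and that every $\sigma\in S$ holds for all classes in place of its letters; $(\mathcal M,\mathcal X)\models \mathrm{sPC}(S)$ is defined in the same way, but with parameters from $\mathcal X$ only in comprehension. An inner $L$-structure $\mathcal N\in\mathcal X$ consists of classes: a non-empty domain contained in $\mathcal M$, an equivalence relation on it that interprets equality, and relations on the domain that interpret $L$ and respect this equality. It is an $\mathcal X$-strong model of $\sigma$ if it satisfies $\sigma(P)$ for all classes $P\in\mathcal X$ (restricted to the domain and taken modulo the equality of $\mathcal N$). For a scheme $\sigma$ in $L$ and a set $S$ of schemes (possibly in another language): * $\sigma$ is *standalone complete in $S$* if, whenever $(\mathcal M,\mathcal X)\models\mathrm{sPC}(S)$, any two $\mathcal X$-strong models $\mathcal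 N_0,\mathcal N_1\in\mathcal X$ of $\sigma$ are elementarily equivalent; * $\sigma$ is *complete-in-every-cardinality in $S$* if, whenever $(\mathcal M,\mathcal X)\models\mathrm{PC}(S)$, any two $\mathcal X$-strong models $\mathcal N_0,\mathcal N_1\in\mathcal X$ of $\sigma$ between which there is a bijection in $\mathcal X$ are elementarily equivalent; * $\sigma$ is *(non-complete-in-every-cardinality) in $S$* if every $(\mathcal M,\mathcal X)\models\mathrm{PC}(S)$ has two $\mathcal X$-strong models $\mathcal N_0,\mathcal N_1\in\mathcal X$ of $\sigma$ with a bijection between them in $\mathcal X$ that are not elementarily equivalent. $\mathsf{AS}$ is the theory in the language $\{\in\}$ that says that an empty set exists and that, for all $x,y$, a set with the elements of $x$ together with $y$ exists. $\mathrm{ZF}$ is the usual axiomatization, with separation and replacement as schemes (for classes). $\mathsf{HF}(\mathrm{DLO})$ is the scheme in the language $\{<,\in,A\}$ that is the conjunction of: replacement (with parameters) and $\in$-induction, as schemes; for every $x$ there is $y$ whose elements are exactly the non-atoms $z$ all of whose elements are in $x$ (an atom is an $x$ with $A(x)$); for every $x$ there is a non-atom $y$ whose elements are exactly the elements of elements of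 $x$; every non-atom is in bijection with a natural number (by a bijection that is an element of the model); extensionality for non-atoms; atoms have no elements; the relation $<$ holds between atoms only, there is at least one atom, and $<$ is a dense linear order without endpoints on the atoms. $\mathrm{Com}$ is full comprehension for an added sort: for a scheme $\tau$ in $L$, $\tau\wedge\mathrm{Com}$ is the scheme in the two-sorted language $L^{+1}$, with a sort of objects and a sort of sets of objects, saying that the objects satisfy $\tau$, that sets with the same elements are equal, and that for every $P$ there is a set of exactly those objects that satisfy $P$. Two-sorted structures are treated as one-sorted structures whose domain is partitioned into objects and sets, with the symbols of $L$ holding of objects only. **Theorem** (completeness is not preserved by $\mathrm{Com}$). The scheme $\tau=\mathsf{HF}(\mathrm{DLO})$ is standalone complete in $\mathsf{AS}$, while $\tau\wedge\mathrm{Com}$ is (non-complete-in-every-cardinality) in $\mathrm{ZF}$; in particular, $\tau\wedge\mathrm{Com}$ is not complete-in-every-cardinality in $\mathrm{ZF}$. Moreover, every $(\mathcal M,\mathcal X)\models\mathrm{PC}(\mathrm{ZF})$ has $\mathcal X$-strong models $\mathcal N_0,\mathcal N_1\in\mathcal X$ of $\tau\wedge\mathrm{Com}$ that differ only in that the order $<$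 of $\mathcal N_1$ is the inverse of that of $\mathcal N_0$, such that the sentence about gaps $$\forall x\in A\;\exists Y\subseteq A\;\bigl(Y\neq\emptyset\wedge Y<x\wedge\forall z\in A\,(Y\le z\rightarrow\exists y\in A\,(Y\le y<z))\bigr)$$ (where $Y$ ranges over the set sort, and $Y<x$, $Y\le z$ mean that all elements of $Y$ are $<x$, respectively $\le z$) fails in $\mathcal N_0$ and holds in $\mathcal N_1$. -/

import Mathlib

universe u

namespace Definiteness

open FirstOrder FirstOrder.Language

/-! ### Schemes -/

/-- The language of schematic predicate letters: exactly one letter `P n` of each arity `n`. -/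
def letters : FirstOrder.Language.{0, 0} := ⟨fun _ => Empty, fun _ => Unit⟩

instance : letters.IsRelational := fun _ => inferInstanceAs (IsEmpty Empty)

/-- An `L`-scheme is a sentence of `L` augmented with schematic predicate letters. Only finitely
many letters occur in it; a sentence of `L` is a scheme in which no letter occurs. -/
abbrev Scheme (L : FirstOrder.Language.{0, 0}) := (L.sum letters).Sentence

/-- The interpretation of the letters by given relations. -/
abbrev lettersStructure {K : Type u} (P : ∀ n, Set (Fin n → K)) : letters.Structure K where
  funMap := fun f => isEmptyElim f
  RelMap := fun {n} _ v => v ∈ P n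

/-- The structure `K` satisfies the scheme `σ` when the letters are read as the relations `P`. -/
def Scheme.HoldsAt {L : FirstOrder.Language.{0, 0}} (σ : Scheme L) (K : Type u) [L.Structure K]
    (P : ∀ n, Set (Fin n → K)) : Prop :=
  letI := lettersStructure P
  K ⊨ σ

/-! ### Predicative comprehension -/

/-- The classes of a second-order structure on `M`: for each `n`, a family of `n`-ary relations. -/
abbrev Classes (M : Type u) := ∀ n, Set (Set (Fin n → M))

/-- The language with a relation symbol for each class, used for second-order parameters. -/
def classLang {M : Type u} (X : Classes M) : FirstOrder.Language.{0, u} := ⟨fun _ => Empty, fun n => X n⟩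

instance {M : Type u} (X : Classes M) : (classLang X).Structure M where
  funMap := fun f => Empty.elim f
  RelMap := fun R v => v ∈ R.1

/-- `(M, X)` satisfies the schemes in `S`, read with classes substituted for the letters. -/
def Satisfies {L : FirstOrder.Language.{0, 0}} (S : Set (Scheme L)) (M : Type u) [L.Structure M]
    (X : Classes M) : Prop :=
  ∀ σ ∈ S, ∀ P : ∀ n, Set (Fin n → M), (∀ n, P n ∈ X n) → σ.HoldsAt M P

/-- `(M, X) ⊨ PC(S)`: predicative comprehension with first- and second-order parameters
(the comprehension formulas quantify over elements of `M` only), together with `S`. -/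
def ModelsPC {L : FirstOrder.Language.{0, 0}} (S : Set (Scheme L)) (M : Type u) [L.Structure M]
    (X : Classes M) : Prop :=
  (∀ (n : ℕ) (s : Set (Fin n → M)),
    (Set.univ : Set M).Definable (L.sum (classLang X)) s → s ∈ X n) ∧ Satisfies S M X

/-- `(M, X) ⊨ sPC(S)`: standalone predicative comprehension, without first-order parameters
(classes are still allowed as parameters), together with `S`. -/
def ModelsSPC {L : FirstOrder.Language.{0, 0}} (S : Set (Scheme L)) (M : Type u) [L.Structure M]
    (X : Classes M) : Prop :=
  (∀ (n : ℕ) (s : Set (Fin n → M)),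
    (∅ : Set M).Definable (L.sum (classLang X)) s → s ∈ X n) ∧ Satisfies S M X

/-! ### Strong models -/

/-- A structure for the relational language `L`, with its own equality relation, whose elements
are elements of `M`. -/
structure InnerModel (L : FirstOrder.Language.{0, 0}) (M : Type u) where
  dom : Set M
  eq : Set (Fin 2 → M)
  rel : ∀ {n : ℕ}, L.Relations n → Set (Fin n → M)
  dom_nonempty : dom.Nonempty
  eq_dom : ∀ x y, ![x, y] ∈ eq → x ∈ dom ∧ y ∈ dom
  eq_refl : ∀ x ∈ dom, ![x, x] ∈ eq
  eq_symm : ∀ x y, ![x, y] ∈ eq → ![y, x] ∈ eq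
  eq_trans : ∀ x y z, ![x, y] ∈ eq → ![y, z] ∈ eq → ![x, z] ∈ eq
  rel_dom : ∀ {n : ℕ} (r : L.Relations n) (v : Fin n → M), v ∈ rel r → ∀ i, v i ∈ dom
  rel_congr : ∀ {n : ℕ} (r : L.Relations n) (v w : Fin n → M),
    (∀ i, ![v i, w i] ∈ eq) → v ∈ rel r → w ∈ rel r

namespace InnerModel

variable {L : FirstOrder.Language.{0, 0}} {M : Type u}

/-- The equality of the inner model, as an equivalence relation on its domain. -/
def setoid (N : InnerModel L M) : Setoid N.dom where
  r x y := ![(x : M), (y : M)] ∈ N.eq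
  iseqv :=
    { refl := fun x => N.eq_refl x x.2
      symm := fun {x y} h => N.eq_symm x y h
      trans := fun {x y z} h k => N.eq_trans x y z h k }

/-- The elements of the inner model modulo its equality; first-order truth in the inner model,
with `=` read as its own equality, is first-order truth in this quotient. -/
def Carrier (N : InnerModel L M) : Type u := Quotient N.setoid

/-- The relation on the quotient that is induced by a relation on `M`. -/
def trace (N : InnerModel L M) {n : ℕ} (s : Set (Fin n → M)) : Set (Fin n → N.Carrier) :=
  {v | ∃ w : Fin n → N.dom, (fun i => (w i : M)) ∈ s ∧ ∀ i, Quotient.mk N.setoid (w i) = v i}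

instance [L.IsRelational] (N : InnerModel L M) : L.Structure N.Carrier where
  funMap := fun f => isEmptyElim f
  RelMap := fun r v => v ∈ N.trace (N.rel r)

/-- `N ∈ X`: the domain, the equality and all relations of `N` are classes. -/
def IsIn (N : InnerModel L M) (X : Classes M) : Prop :=
  {v : Fin 1 → M | v 0 ∈ N.dom} ∈ X 1 ∧ N.eq ∈ X 2 ∧
    ∀ (n : ℕ) (r : L.Relations n), N.rel r ∈ X n

/-- `N` is an `X`-strong model of `σ`: it satisfies `σ(P)` for all classes `P`, where a class
enters `N` through the relation that it induces modulo the equality of `N`. -/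
def IsStrongModel [L.IsRelational] (N : InnerModel L M) (X : Classes M) (σ : Scheme L) : Prop :=
  ∀ P : ∀ n, Set (Fin n → M), (∀ n, P n ∈ X n) → σ.HoldsAt N.Carrier (fun n => N.trace (P n))

/-- Some class is a bijection between the two inner models, modulo their equalities. -/
def Equinumerous (N₀ N₁ : InnerModel L M) (X : Classes M) : Prop :=
  ∃ F ∈ X 2, (∀ x ∈ N₀.dom, ∃ y ∈ N₁.dom, ![x, y] ∈ F) ∧
    (∀ y ∈ N₁.dom, ∃ x ∈ N₀.dom, ![x, y] ∈ F) ∧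
    ∀ x ∈ N₀.dom, ∀ x' ∈ N₀.dom, ∀ y ∈ N₁.dom, ∀ y' ∈ N₁.dom,
      ![x, y] ∈ F → ![x', y'] ∈ F → (![x, x'] ∈ N₀.eq ↔ ![y, y'] ∈ N₁.eq)

end InnerModel

/-! ### Completeness of schemes -/

section

variable {L L' : FirstOrder.Language.{0, 0}} [L.IsRelational]

/-- `σ` is standalone complete in `S`. -/
def StandaloneCompleteIn (σ : Scheme L) (S : Set (Scheme L')) : Prop :=
  ∀ (M : Type u) [L'.Structure M] (X : Classes M), ModelsSPC S M X →
    ∀ N₀ N₁ : InnerModel L M, N₀.IsIn X → N₁.IsIn X → N₀.IsStrongModel X σ →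
      N₁.IsStrongModel X σ → N₀.Carrier ≅[L] N₁.Carrier

/-- `σ` is complete-in-every-cardinality in `S`. -/
def CompleteInEveryCardinalityIn (σ : Scheme L) (S : Set (Scheme L')) : Prop :=
  ∀ (M : Type u) [L'.Structure M] (X : Classes M), ModelsPC S M X →
    ∀ N₀ N₁ : InnerModel L M, N₀.IsIn X → N₁.IsIn X → N₀.IsStrongModel X σ →
      N₁.IsStrongModel X σ → N₀.Equinumerous N₁ X → N₀.Carrier ≅[L] N₁.Carrier

/-- `σ` is (non-complete-in-every-cardinality) in `S`: the completeness of `σ` in every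
cardinality fails in each model of `PC(S)`. -/
def NonCompleteInEveryCardinalityIn (σ : Scheme L) (S : Set (Scheme L')) : Prop :=
  ∀ (M : Type u) [L'.Structure M] (X : Classes M), ModelsPC S M X →
    ∃ N₀ N₁ : InnerModel L M, N₀.IsIn X ∧ N₁.IsIn X ∧ N₀.IsStrongModel X σ ∧
      N₁.IsStrongModel X σ ∧ N₀.Equinumerous N₁ X ∧ ¬ (N₀.Carrier ≅[L] N₁.Carrier)

end

/-! ### Formulas of set theory

Bound variables are numbered from the outermost quantifier inwards: the variable bound at depth
`n` is `Fin.last n` there, and `Fin.castSucc` keeps the number of a variable when passing under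
a further quantifier. -/

section

variable {L : FirstOrder.Language.{0, 0}} {n : ℕ}

/-- `x = y` -/
def eqF (x y : Fin n) : L.BoundedFormula Empty n := (&x) =' (&y)

/-- `a(x)` -/
def unF (a : L.Relations 1) (x : Fin n) : L.BoundedFormula Empty n := a.boundedFormula₁ (&x)

/-- `x e y` -/
def binF (e : L.Relations 2) (x y : Fin n) : L.BoundedFormula Empty n :=
  e.boundedFormula₂ (&x) (&y)

variable (e : L.Relations 2)

/-- `x` has no elements. -/
def isEmptyF (x : Fin n) : L.BoundedFormula Empty n :=
  ∀' ∼(binF e (Fin.last n) x.castSucc)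

/-- `x ⊆ y` -/
def subsetF (x y : Fin n) : L.BoundedFormula Empty n :=
  ∀' (binF e (Fin.last n) x.castSucc ⟹ binF e (Fin.last n) y.castSucc)

/-- The elements of `z` are exactly `x` and `y`. -/
def isPairF (z x y : Fin n) : L.BoundedFormula Empty n :=
  ∀' (binF e (Fin.last n) z.castSucc ⇔
    (eqF (Fin.last n) x.castSucc ⊔ eqF (Fin.last n) y.castSucc))

/-- `z` is the Kuratowski pair `{{x}, {x, y}}`. -/
def isOrderedPairF (z x y : Fin n) : L.BoundedFormula Empty n :=
  ∀' (binF e (Fin.last n) z.castSucc ⇔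
    (isPairF e (Fin.last n) x.castSucc x.castSucc ⊔ isPairF e (Fin.last n) x.castSucc y.castSucc))

/-- `⟨x, y⟩ ∈ f` -/
def orderedPairMemF (x y f : Fin n) : L.BoundedFormula Empty n :=
  ∃' (isOrderedPairF e (Fin.last n) x.castSucc y.castSucc ⊓ binF e (Fin.last n) f.castSucc)

/-- The elements of `z` are those of `x` together with `y`: `z = x ∪ {y}`. -/
def isAdjunctionF (z x y : Fin n) : L.BoundedFormula Empty n :=
  ∀' (binF e (Fin.last n) z.castSucc ⇔
    (binF e (Fin.last n) x.castSucc ⊔ eqF (Fin.last n) y.castSucc))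

/-- `x` is a transitive set. -/
def isTransitiveF (x : Fin n) : L.BoundedFormula Empty n :=
  ∀' (binF e (Fin.last n) x.castSucc ⟹ subsetF e (Fin.last n) x.castSucc)

/-- `f` is a bijection from `x` onto `y`. -/
def isBijectionF (f x y : Fin n) : L.BoundedFormula Empty n :=
  (∀' (binF e (Fin.last n) f.castSucc ⟹
    ∃' ∃' (binF e (Fin.last n).succ.castSucc x.castSucc.castSucc.castSucc ⊓
      binF e (Fin.last (n + 2)) y.castSucc.castSucc.castSucc ⊓
      isOrderedPairF e (Fin.last n).castSucc.castSucc (Fin.last n).succ.castSucc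
        (Fin.last (n + 2))))) ⊓
  -- every element of `x` has exactly one value
  (∀' (binF e (Fin.last n) x.castSucc ⟹
    ∃' ∀' (binF e (Fin.last (n + 1)).castSucc y.castSucc.castSucc.castSucc ⊓
      (orderedPairMemF e (Fin.last n).castSucc.castSucc (Fin.last (n + 2))
          f.castSucc.castSucc.castSucc ⇔
        eqF (Fin.last (n + 2)) (Fin.last (n + 1)).castSucc)))) ⊓
  -- every element of `y` is the value of exactly one argument
  (∀' (binF e (Fin.last n) y.castSucc ⟹
    ∃' ∀' (binF e (Fin.last (n + 1)).castSucc x.castSucc.castSucc.castSucc ⊓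
      (orderedPairMemF e (Fin.last (n + 2)) (Fin.last n).castSucc.castSucc
          f.castSucc.castSucc.castSucc ⇔
        eqF (Fin.last (n + 2)) (Fin.last (n + 1)).castSucc))))

/-- `x` is a natural number, that is a finite von Neumann ordinal, in a universe with atoms `a`
and a well-founded membership: a transitive set of transitive sets, such that `x` and all its
elements are empty or successors. -/
def isNatF (a : L.Relations 1) (x : Fin n) : L.BoundedFormula Empty n :=
  isTransitiveF e x ⊓
  (∀' ((binF e (Fin.last n) x.castSucc ⊔ eqF (Fin.last n) x.castSucc) ⟹
    (∼(unF a (Fin.last n)) ⊓ isTransitiveF e (Fin.last n) ⊓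
      (isEmptyF e (Fin.last n) ⊔
        ∃' isAdjunctionF e (Fin.last n).castSucc (Fin.last (n + 1)) (Fin.last (n + 1))))))

/-- The replacement scheme, with a first-order parameter `p`:
`∀ p x, (∀ z ∈ x, ∃! y, P(p, z, y)) → ∃ u, ∀ y, y ∈ u ↔ ∃ z ∈ x, P(p, z, y)`. -/
def replF (P : L.Relations 3) : L.Sentence :=
  ∀' ∀' ((∀' (binF e 2 1 ⟹ ∃' ∀' (P.boundedFormula ![&0, &2, &4] ⇔ eqF 4 3))) ⟹
    ∃' ∀' (binF e 3 2 ⇔ ∃' (binF e 4 1 ⊓ P.boundedFormula ![&0, &4, &3])))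

end

/-! ### The metatheories -/

/-- The language of set theory. -/
inductive SetRel : ℕ → Type
  | mem : SetRel 2

/-- The language of set theory. -/
def setLang : FirstOrder.Language.{0, 0} := ⟨fun _ => Empty, SetRel⟩

instance : setLang.IsRelational := fun _ => inferInstanceAs (IsEmpty Empty)

/-- The membership symbol. -/
def elt : (setLang.sum letters).Relations 2 := Sum.inl SetRel.mem

/-- The schematic letter of arity `n`. -/
def letter (L : FirstOrder.Language.{0, 0}) (n : ℕ) : (L.sum letters).Relations n := Sum.inr ()

/-- Adjunctive set theory: the empty set and `x ∪ {y}` exist. -/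
def AS : Set (Scheme setLang) :=
  { ∃' isEmptyF elt 0,
    ∀' ∀' ∃' isAdjunctionF elt 2 0 1 }

/-- Zermelo-Fraenkel set theory, with schematic separation and replacement. -/
def ZF : Set (Scheme setLang) :=
  { -- extensionality
    ∀' ∀' ((∀' (binF elt 2 0 ⇔ binF elt 2 1)) ⟹ eqF 0 1),
    -- foundation
    ∀' (∼(isEmptyF elt 0) ⟹ ∃' (binF elt 1 0 ⊓ ∀' (binF elt 2 1 ⟹ ∼(binF elt 2 0)))),
    -- pairing
    ∀' ∀' ∃' isPairF elt 2 0 1,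
    -- union
    ∀' ∃' ∀' (binF elt 2 1 ⇔ ∃' (binF elt 3 0 ⊓ binF elt 2 3)),
    -- power set
    ∀' ∃' ∀' (binF elt 2 1 ⇔ subsetF elt 2 0),
    -- infinity
    ∃' ((∃' (isEmptyF elt 1 ⊓ binF elt 1 0)) ⊓
      ∀' (binF elt 1 0 ⟹ ∃' (isAdjunctionF elt 2 1 1 ⊓ binF elt 2 0))),
    -- separation
    ∀' ∀' ∃' ∀' (binF elt 3 2 ⇔ (binF elt 3 1 ⊓ binF (letter setLang 2) 0 3)),
    -- replacement
    replF elt (letter setLang 3) }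

/-! ### Hereditarily finite sets over a dense linear order -/

/-- The symbols `<`, `∈` and `A` (being an atom). -/
inductive HFRel : ℕ → Type
  | lt : HFRel 2
  | mem : HFRel 2
  | atom : HFRel 1

/-- The language with the symbols `<`, `∈` and `A`. -/
def hfLang : FirstOrder.Language.{0, 0} := ⟨fun _ => Empty, HFRel⟩

instance : hfLang.IsRelational := fun _ => inferInstanceAs (IsEmpty Empty)

namespace HF

/-- The symbol `<`. -/
def lt : (hfLang.sum letters).Relations 2 := Sum.inl HFRel.lt

/-- The symbol `∈`. -/
def mem : (hfLang.sum letters).Relations 2 := Sum.inl HFRel.mem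

/-- The symbol `A`. -/
def atom : (hfLang.sum letters).Relations 1 := Sum.inl HFRel.atom

/-- `∈`-induction. -/
def induction : Scheme hfLang :=
  (∀' ((∀' (binF mem 1 0 ⟹ unF (letter hfLang 1) 1)) ⟹ unF (letter hfLang 1) 0)) ⟹
    ∀' unF (letter hfLang 1) 0

/-- Power set: `∀ x ∃ y ∀ z, z ∈ y ↔ ¬ A(z) ∧ z ⊆ x`. -/
def powerset : Scheme hfLang :=
  ∀' ∃' ∀' (binF mem 2 1 ⇔ (∼(unF atom 2) ⊓ subsetF mem 2 0))

/-- Union: `∀ x ∃ y, ¬ A(y) ∧ ∀ z, z ∈ y ↔ ∃ w ∈ x, z ∈ w`. -/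
def union : Scheme hfLang :=
  ∀' ∃' (∼(unF atom 1) ⊓ ∀' (binF mem 2 1 ⇔ ∃' (binF mem 3 0 ⊓ binF mem 2 3)))

/-- Every set is the image of a natural number under a bijection. -/
def finiteness : Scheme hfLang :=
  ∀' (∼(unF atom 0) ⟹ ∃' ∃' (isNatF mem atom 1 ⊓ isBijectionF mem 2 1 0))

/-- Extensionality for non-atoms. -/
def extensionality : Scheme hfLang :=
  ∀' ∀' ((∼(unF atom 0) ⊓ ∼(unF atom 1)) ⟹
    (∀' (binF mem 2 0 ⇔ binF mem 2 1)) ⟹ eqF 0 1)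

/-- Atoms have no elements. -/
def atomsEmpty : Scheme hfLang :=
  ∀' (unF atom 0 ⟹ isEmptyF mem 0)

/-- The atoms are a (non-empty) dense linear order without endpoints under `<`, and `<` relates
atoms only. -/
def atomsDLO : Scheme hfLang :=
  (∃' unF atom 0) ⊓
  (∀' ∀' (binF lt 0 1 ⟹ (unF atom 0 ⊓ unF atom 1))) ⊓
  (∀' (unF atom 0 ⟹ ∼(binF lt 0 0))) ⊓
  (∀' ∀' ∀' ((unF atom 0 ⊓ unF atom 1 ⊓ unF atom 2) ⟹
    (binF lt 0 1 ⊓ binF lt 1 2) ⟹ binF lt 0 2)) ⊓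
  (∀' ∀' ((unF atom 0 ⊓ unF atom 1) ⟹ (binF lt 0 1 ⊔ eqF 0 1 ⊔ binF lt 1 0))) ⊓
  (∀' ∀' ((unF atom 0 ⊓ unF atom 1) ⟹ binF lt 0 1 ⟹
    ∃' (unF atom 2 ⊓ binF lt 0 2 ⊓ binF lt 2 1))) ⊓
  (∀' (unF atom 0 ⟹ ∃' (unF atom 1 ⊓ binF lt 1 0))) ⊓
  (∀' (unF atom 0 ⟹ ∃' (unF atom 1 ⊓ binF lt 0 1)))

end HF

/-- The scheme `HF(DLO)`. -/
def HFDLO : Scheme hfLang :=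
  replF HF.mem (letter hfLang 3) ⊓ HF.induction ⊓ HF.powerset ⊓ HF.union ⊓ HF.finiteness ⊓
    HF.extensionality ⊓ HF.atomsEmpty ⊓ HF.atomsDLO

/-! ### Adding a sort of sets of objects, with full comprehension -/

/-- The symbols for being of the object sort, and for the membership of objects in elements of
the set sort. -/
inductive SortRel : ℕ → Type
  | obj : SortRel 1
  | isIn : SortRel 2

/-- The language of the sorts. -/
def sortLang : FirstOrder.Language.{0, 0} := ⟨fun _ => Empty, SortRel⟩

instance : sortLang.IsRelational := fun _ => inferInstanceAs (IsEmpty Empty)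

/-- The language `L⁺¹`: the two-sorted language obtained from `L` by adding a sort for sets of
objects. A two-sorted structure is a one-sorted one whose domain is partitioned into objects and
sets. -/
abbrev plusOne (L : FirstOrder.Language.{0, 0}) : FirstOrder.Language.{0, 0} := L.sum sortLang

/-- Translation of formulas along a map of languages, with quantifiers relativised to `U`. -/
def relativize {L L' : FirstOrder.Language.{0, 0}} (f : L →ᴸ L') (U : L'.Relations 1) :
    ∀ {n : ℕ}, L.BoundedFormula Empty n → L'.BoundedFormula Empty n
  | _, .falsum => .falsum
  | _, .equal t s => .equal (f.onTerm t) (f.onTerm s)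
  | _, .rel R ts => .rel (f.onRelation R) fun i => f.onTerm (ts i)
  | _, .imp φ ψ => .imp (relativize f U φ) (relativize f U ψ)
  | n, .all φ => .all ((unF U (Fin.last n)).imp (relativize f U φ))

/-- An `L`-scheme read in `L⁺¹`, about the object sort. -/
def Scheme.onObjects {L : FirstOrder.Language.{0, 0}} (σ : Scheme L) : Scheme (plusOne L) :=
  relativize (LHom.sumMap LHom.sumInl (LHom.id letters)) (Sum.inl (Sum.inr SortRel.obj)) σ

namespace Com

/-- The symbol `<`. -/
def lt : (plusOne hfLang).Relations 2 := Sum.inl HFRel.lt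

/-- The symbol `∈`. -/
def mem : (plusOne hfLang).Relations 2 := Sum.inl HFRel.mem

/-- The symbol `A`. -/
def atom : (plusOne hfLang).Relations 1 := Sum.inl HFRel.atom

/-- The symbol for being an object. -/
def obj : (plusOne hfLang).Relations 1 := Sum.inr SortRel.obj

/-- The symbol for the membership of objects in elements of the set sort. -/
def isIn : (plusOne hfLang).Relations 2 := Sum.inr SortRel.isIn

/-- The structure is two-sorted: the symbols `<`, `∈`, `A` concern objects only, and the membership
of the set sort relates objects to sets. -/
def sorts : (plusOne hfLang).Sentence :=
  (∀' ∀' (binF lt 0 1 ⟹ (unF obj 0 ⊓ unF obj 1))) ⊓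
  (∀' ∀' (binF mem 0 1 ⟹ (unF obj 0 ⊓ unF obj 1))) ⊓
  (∀' (unF atom 0 ⟹ unF obj 0)) ⊓
  (∀' ∀' (binF isIn 0 1 ⟹ (unF obj 0 ⊓ ∼(unF obj 1))))

/-- Sets with the same elements are equal. -/
def setExtensionality : (plusOne hfLang).Sentence :=
  ∀' ∀' ((∼(unF obj 0) ⊓ ∼(unF obj 1)) ⟹
    (∀' (binF isIn 2 0 ⇔ binF isIn 2 1)) ⟹ eqF 0 1)

/-- Full comprehension: there is a set of the objects that satisfy `P`. -/
def comprehension : Scheme (plusOne hfLang) :=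
  ∃' (∼(unF (Sum.inl obj) 0) ⊓
    ∀' (unF (Sum.inl obj) 1 ⟹
      (binF (Sum.inl isIn) 1 0 ⇔ unF (letter (plusOne hfLang) 1) 1)))

/-- Some non-empty set of atoms that lies below any given atom has no supremum:
`∀ x ∈ A, ∃ Y ⊆ A, Y ≠ ∅ ∧ Y < x ∧ ∀ z ∈ A, Y ≤ z → ∃ y ∈ A, Y ≤ y ∧ y < z`. -/
def gap : (plusOne hfLang).Sentence :=
  ∀' (unF atom 0 ⟹ ∃' (∼(unF obj 1) ⊓ (∃' binF isIn 2 1) ⊓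
    (∀' (binF isIn 2 1 ⟹ (unF atom 2 ⊓ binF lt 2 0))) ⊓
    ∀' ((unF atom 2 ⊓ ∀' (binF isIn 3 1 ⟹ (binF lt 3 2 ⊔ eqF 3 2))) ⟹
      ∃' (unF atom 3 ⊓ (∀' (binF isIn 4 1 ⟹ (binF lt 4 3 ⊔ eqF 4 3))) ⊓ binF lt 3 2))))

end Com

/-- The `L⁺¹`-scheme `Com` for `L` the language of `HF(DLO)`. -/
def Com : Scheme (plusOne hfLang) :=
  LHom.sumInl.onSentence Com.sorts ⊓ LHom.sumInl.onSentence Com.setExtensionality ⊓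
    Com.comprehension

/-- The `L⁺¹`-scheme `HF(DLO) ∧ Com`. -/
def HFDLOCom : Scheme (plusOne hfLang) := HFDLO.onObjects ⊓ Com

/-- Two inner models that differ only in that the order of the one is the inverse of that of the
other. -/
def AreMirrored {M : Type u} (N₀ N₁ : InnerModel (plusOne hfLang) M) : Prop :=
  N₀.dom = N₁.dom ∧ N₀.eq = N₁.eq ∧ N₀.rel Com.mem = N₁.rel Com.mem ∧
    N₀.rel Com.atom = N₁.rel Com.atom ∧ N₀.rel Com.obj = N₁.rel Com.obj ∧
    N₀.rel Com.isIn = N₁.rel Com.isIn ∧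
    ∀ x y, ![x, y] ∈ N₀.rel Com.lt ↔ ![y, x] ∈ N₁.rel Com.lt

end Definiteness

namespace Definiteness

open FirstOrder FirstOrder.Language

/-! ### Definability over several sorts -/

/-! Standalone completeness is an Ehrenfeucht–Fraïssé argument carried out inside the metatheory.
Finite partial isomorphisms between dense linear orders without endpoints extend back and forth, and
they still do after hereditarily finite sets are added, provided that domains and ranges are kept
closed under taking elements. Adjunctive set theory is just strong enough to code such maps: an
element `s` of `M` codes the relation given by the pairs that belong to it, the empty set codes the
empty relation, and adjunction adds one pair. Finiteness in the two models may be non-standard, so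
the extension step `IsPartialIso.forth` is proved by `∈`-induction in one model, with inductions on
finite sets inside it. These inductions are instances of the schemes because the models are strong
and because "every coded partial isomorphism extends to one defined at `a`" is first-order over `M`.
Comprehension allows no elements of `M` as parameters there, so each induction predicate quantifies
over all codes `s` instead of fixing one. `realize_iff_of_backAndForth` turns the extension property
into elementary equivalence.

With `Com`, sets of atoms become available and completeness of the order becomes expressible. Inside
a model of ZF, infinite sets of natural numbers under the lexicographic order look like the reals in
`(0, 1]`, read through binary expansions. Discarding the sets that omit at most one number removes
`1` and the points `1/2, 3/4, 7/8, ...`. What remains is dense without endpoints, complete below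
`1/2`, and has gaps accumulating at its upper end only: see `exists_sup_below` and `exists_no_inf`.
The order and its inverse give two models of `HF(DLO) ∧ Com` on the same domain, and the sentence
about gaps tells them apart. Full comprehension holds in them because the objects form a set, so
that separation turns each class of objects into a set.

To refute completeness outright, one model of `PC(ZF)` in the given universe is needed. It is
obtained from a small elementary submodel of `ZFSet` with its definable relations as classes.

Most definability proofs are left to instance search: `Def` and `DefMap` treat predicates and maps
between sorts coded by tuples of elements of `M`, and their instances mirror the first-order
operations. -/

/-- A family of relations on `M`, indexed by arbitrary index types, that is closed under the
first-order operations. -/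
structure Definability (M : Type u) where
  dfn : ∀ {α : Type}, Set (α → M) → Prop
  univ : ∀ {α : Type}, dfn (Set.univ : Set (α → M))
  inter : ∀ {α : Type} {s t : Set (α → M)}, dfn s → dfn t → dfn (s ∩ t)
  compl : ∀ {α : Type} {s : Set (α → M)}, dfn s → dfn sᶜ
  preimage : ∀ {α β : Type} (f : α → β) {s : Set (α → M)}, dfn s →
    dfn ((fun v : β → M => v ∘ f) ⁻¹' s)
  image : ∀ {α β : Type} [Finite α] [Finite β] (f : α → β) {s : Set (β → M)}, dfn s →
    dfn ((fun v : β → M => v ∘ f) '' s)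
  eq : dfn {v : Fin 2 → M | v 0 = v 1}

/-- The relations that are definable with parameters from `A`. -/
def Definability.ofLanguage {M : Type u} (L : FirstOrder.Language.{0, u}) [L.Structure M]
    (A : Set M) : Definability M where
  dfn s := A.Definable L s
  univ := Set.definable_univ
  inter := Set.Definable.inter
  compl := Set.Definable.compl
  preimage f _ h := h.preimage_comp f
  image f _ h := h.image_comp f
  eq := ⟨((Term.var 0).equal (Term.var 1)), by ext v; simp⟩

/-- The sort `T` is coded by tuples of elements of `M`, in a definable way. -/
class Coded {M : Type u} (D : Definability M) (T : Type u) where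
  Index : Type
  fin : Finite Index
  IsCode : (Index → M) → T → Prop
  unique : ∀ {v t t'}, IsCode v t → IsCode v t' → t = t'
  surj : ∀ t, ∃ v, IsCode v t
  dfn_eq : D.dfn {w : Index ⊕ Index → M | ∃ t, IsCode (w ∘ Sum.inl) t ∧ IsCode (w ∘ Sum.inr) t}

section

variable {M : Type u} {D : Definability M}

attribute [instance] Coded.fin

/-- The indices of the coordinates of the codes of elements of `T`. -/
abbrev Coded.Idx (D : Definability M) (T : Type u) [Coded D T] : Type :=
  Coded.Index (D := D) (T := T)

/-- The tuple `v` is a code of `t`. -/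
abbrev Coded.code (D : Definability M) {T : Type u} [Coded D T] (v : Coded.Idx D T → M) (t : T) :
    Prop := Coded.IsCode (D := D) v t

/-- A tuple is a code exactly if it codes the same element as itself, so this is the diagonal of
`dfn_eq`. -/
theorem Coded.dfn_dom (T : Type u) [Coded D T] :
    D.dfn {v : Idx D T → M | ∃ t : T, code D v t} := by
  have := D.preimage (Sum.elim id id) (dfn_eq (D := D) (T := T))
  convert this using 1
  ext v
  simp only [Set.mem_ofPred_eq, Set.mem_preimage]
  constructor
  · rintro ⟨t, h⟩
    exact ⟨t, h, h⟩
  · rintro ⟨t, h, -⟩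
    exact ⟨t, h⟩

instance Coded.base : Coded D M where
  Index := Unit
  fin := inferInstance
  IsCode v t := v () = t
  unique h h' := h.symm.trans h'
  surj t := ⟨fun _ => t, rfl⟩
  dfn_eq := by
    convert D.preimage (![Sum.inl (), Sum.inr ()] : Fin 2 → Unit ⊕ Unit) D.eq using 1
    ext v
    simp [eq_comm]

instance Coded.prod (S T : Type u) [Coded D S] [Coded D T] : Coded D (S × T) where
  Index := Idx D S ⊕ Idx D T
  fin := inferInstance
  IsCode v p := code D (v ∘ Sum.inl) p.1 ∧ code D (v ∘ Sum.inr) p.2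
  unique h h' := Prod.ext (unique h.1 h'.1) (unique h.2 h'.2)
  surj p := by
    obtain ⟨v, hv⟩ := surj (D := D) p.1
    obtain ⟨w, hw⟩ := surj (D := D) p.2
    exact ⟨Sum.elim v w, hv, hw⟩
  dfn_eq := by
    have h₁ := D.preimage (Sum.map Sum.inl Sum.inl : _ → (Idx D S ⊕ Idx D T) ⊕ (Idx D S ⊕ Idx D T))
      (dfn_eq (D := D) (T := S))
    have h₂ := D.preimage (Sum.map Sum.inr Sum.inr : _ → (Idx D S ⊕ Idx D T) ⊕ (Idx D S ⊕ Idx D T))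
      (dfn_eq (D := D) (T := T))
    convert D.inter h₁ h₂ using 1
    ext w
    constructor
    · rintro ⟨t, ⟨h1, h2⟩, h3, h4⟩
      exact ⟨⟨t.1, h1, h3⟩, ⟨t.2, h2, h4⟩⟩
    · rintro ⟨⟨s, h1, h3⟩, ⟨t, h2, h4⟩⟩
      exact ⟨(s, t), ⟨h1, h2⟩, h3, h4⟩

variable (D) in
/-- The predicate `p` on a coded sort is definable. -/
class Def {Γ : Type u} [Coded D Γ] (p : Γ → Prop) : Prop where
  out : D.dfn {v | ∃ g, Coded.code D v g ∧ p g}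

variable (D) in
/-- The map `f` between coded sorts is definable. -/
class DefMap {Γ Δ : Type u} [Coded D Γ] [Coded D Δ] (f : Γ → Δ) : Prop where
  out : Def D fun x : Γ × Δ => f x.1 = x.2

variable {Γ Δ Ξ T : Type u} [Coded D Γ] [Coded D Δ] [Coded D Ξ] [Coded D T]

/-! ### Closure of definable predicates under logical operations and substitution. -/

theorem Def.congr {p q : Γ → Prop} (hp : Def D p) (h : ∀ g, p g ↔ q g) : Def D q := by
  rwa [← funext fun g => propext (h g)]

instance Def.and (p q : Γ → Prop) [hp : Def D p] [hq : Def D q] : Def D fun g => p g ∧ q g := by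
  refine ⟨?_⟩
  convert D.inter hp.out hq.out using 1
  ext v
  constructor
  · rintro ⟨g, h, h1, h2⟩
    exact ⟨⟨g, h, h1⟩, g, h, h2⟩
  · rintro ⟨⟨g, h, h1⟩, g', h', h2⟩
    obtain rfl := Coded.unique h h'
    exact ⟨g, h, h1, h2⟩

/-- The complement has to be taken among the tuples that are codes; uniqueness of the coded element
makes this the right set. -/
instance (priority := high) Def.not (p : Γ → Prop) [hp : Def D p] : Def D fun g => ¬ p g := by
  refine ⟨?_⟩
  convert D.inter (Coded.dfn_dom Γ) (D.compl hp.out) using 1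
  ext v
  constructor
  · rintro ⟨g, h, h1⟩
    refine ⟨⟨g, h⟩, ?_⟩
    rintro ⟨g', h', h2⟩
    obtain rfl := Coded.unique h h'
    exact h1 h2
  · rintro ⟨⟨g, h⟩, h1⟩
    exact ⟨g, h, fun h2 => h1 ⟨g, h, h2⟩⟩

instance Def.or (p q : Γ → Prop) [Def D p] [Def D q] : Def D fun g => p g ∨ q g :=
  (inferInstance : Def D fun g => ¬ (¬ p g ∧ ¬ q g)).congr fun g => by tauto

instance Def.imp (p q : Γ → Prop) [Def D p] [Def D q] : Def D fun g => p g → q g :=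
  (inferInstance : Def D fun g => ¬ (p g ∧ ¬ q g)).congr fun g => by tauto

instance Def.iff (p q : Γ → Prop) [Def D p] [Def D q] : Def D fun g => (p g ↔ q g) :=
  (inferInstance : Def D fun g => (p g → q g) ∧ (q g → p g)).congr fun g => by tauto

/-- Quantifying over `T` is projecting away the coordinates of its codes; every element of `T` has a
code, so no witness is lost. -/
instance Def.ex (p : Γ → T → Prop) [hp : Def D fun x : Γ × T => p x.1 x.2] :
    Def D fun g => ∃ t, p g t := by
  refine ⟨?_⟩
  convert D.image (Sum.inl : Coded.Idx D Γ → Coded.Idx D Γ ⊕ Coded.Idx D T) hp.out using 1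
  ext v
  constructor
  · rintro ⟨g, h, t, ht⟩
    obtain ⟨w, hw⟩ := Coded.surj (D := D) t
    exact ⟨Sum.elim v w, ⟨(g, t), ⟨h, hw⟩, ht⟩, rfl⟩
  · rintro ⟨v, ⟨⟨g, t⟩, ⟨h, -⟩, h'⟩, rfl⟩
    exact ⟨g, h, t, h'⟩

instance Def.all (p : Γ → T → Prop) [Def D fun x : Γ × T => p x.1 x.2] :
    Def D fun g => ∀ t, p g t :=
  (inferInstance : Def D fun g => ¬ ∃ t, ¬ p g t).congr fun g => by push Not; rfl

/-- `r` only selects coordinates. -/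
def IsCoord (D : Definability M) {Γ Δ : Type u} [Coded D Γ] [Coded D Δ] (r : Γ → Δ) : Prop :=
  ∃ ρ : Coded.Idx D Δ → Coded.Idx D Γ, ∀ v g, Coded.code D v g → Coded.code D (v ∘ ρ) (r g)

theorem IsCoord.id : IsCoord D fun g : Γ => g := ⟨_root_.id, fun _ _ h => h⟩

theorem IsCoord.fst {r : Γ → Δ × Ξ} (h : IsCoord D r) : IsCoord D fun g => (r g).1 := by
  obtain ⟨ρ, h⟩ := h
  exact ⟨ρ ∘ Sum.inl, fun v g hv => (h v g hv).1⟩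

theorem IsCoord.snd {r : Γ → Δ × Ξ} (h : IsCoord D r) : IsCoord D fun g => (r g).2 := by
  obtain ⟨ρ, h⟩ := h
  exact ⟨ρ ∘ Sum.inr, fun v g hv => (h v g hv).2⟩

theorem IsCoord.pair {r : Γ → Δ} {s : Γ → Ξ} (hr : IsCoord D r) (hs : IsCoord D s) :
    IsCoord D fun g => (r g, s g) := by
  obtain ⟨ρ, hr⟩ := hr
  obtain ⟨σ, hs⟩ := hs
  exact ⟨Sum.elim ρ σ, fun v g hv => ⟨hr v g hv, hs v g hv⟩⟩

theorem Def.coord {q : Δ → Prop} (hq : Def D q) {r : Γ → Δ} (hr : IsCoord D r) :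
    Def D fun g => q (r g) := by
  obtain ⟨ρ, hr⟩ := hr
  refine ⟨?_⟩
  convert D.inter (Coded.dfn_dom Γ) (D.preimage ρ hq.out) using 1
  ext v
  constructor
  · rintro ⟨g, h, h'⟩
    exact ⟨⟨g, h⟩, r g, hr v g h, h'⟩
  · rintro ⟨⟨g, h⟩, d, hd, h'⟩
    obtain rfl := Coded.unique hd (hr v g h)
    exact ⟨g, h, h'⟩

theorem Def.diagonal : Def D fun x : Δ × Δ => x.1 = x.2 := by
  refine ⟨?_⟩
  refine (congrArg D.dfn (Set.ext fun v => ?_)).mp (Coded.dfn_eq (D := D) (T := Δ))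
  refine Iff.symm ?_
  constructor
  · rintro ⟨⟨a, b⟩, h, h'⟩
    obtain rfl : a = b := h'
    exact ⟨a, h⟩
  · rintro ⟨a, h⟩
    exact ⟨(a, a), h, rfl⟩

theorem IsCoord.defMap {r : Γ → Δ} (hr : IsCoord D r) : DefMap D r := by
  obtain ⟨ρ, h⟩ := hr
  have h₁ : IsCoord D fun x : Γ × Δ => r x.1 := ⟨Sum.inl ∘ ρ, fun v g hv => h _ _ hv.1⟩
  exact ⟨Def.diagonal.coord (h₁.pair IsCoord.id.snd)⟩

/-- Only the graph of `f` is definable, so `q (f g)` is read as `∃ d, f g = d ∧ q d`. -/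
theorem Def.comp {q : Δ → Prop} (hq : Def D q) {f : Γ → Δ} (hf : DefMap D f) :
    Def D fun g => q (f g) := by
  have := hf.out
  have : Def D fun x : Γ × Δ => q x.2 := hq.coord IsCoord.id.snd
  exact (inferInstance : Def D fun g => ∃ d, f g = d ∧ q d).congr fun g => by simp

theorem DefMap.comp {h : Δ → Ξ} (hh : DefMap D h) {f : Γ → Δ} (hf : DefMap D f) :
    DefMap D fun g => h (f g) := by
  refine ⟨?_⟩
  have : Def D fun x : (Γ × Ξ) × Δ => f x.1.1 = x.2 :=
    hf.out.coord (IsCoord.pair IsCoord.id.fst.fst IsCoord.id.snd)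
  have : Def D fun x : (Γ × Ξ) × Δ => h x.2 = x.1.2 :=
    hh.out.coord (IsCoord.pair IsCoord.id.snd IsCoord.id.fst.snd)
  exact (inferInstance : Def D fun x : Γ × Ξ => ∃ d, f x.1 = d ∧ h d = x.2).congr fun g => by simp

instance DefMap.id : DefMap D fun g : Γ => g := IsCoord.id.defMap

instance DefMap.fst (f : Γ → Δ × Ξ) [hf : DefMap D f] : DefMap D fun g => (f g).1 :=
  (IsCoord.fst IsCoord.id).defMap.comp hf

instance DefMap.snd (f : Γ → Δ × Ξ) [hf : DefMap D f] : DefMap D fun g => (f g).2 :=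
  (IsCoord.snd IsCoord.id).defMap.comp hf

theorem DefMap.pair (f : Γ → Δ) (h : Γ → Ξ) [hf : DefMap D f] [hh : DefMap D h] :
    DefMap D fun g => (f g, h g) := by
  refine ⟨?_⟩
  have : Def D fun x : Γ × (Δ × Ξ) => f x.1 = x.2.1 :=
    hf.out.coord (IsCoord.pair IsCoord.id.fst IsCoord.id.snd.fst)
  have : Def D fun x : Γ × (Δ × Ξ) => h x.1 = x.2.2 :=
    hh.out.coord (IsCoord.pair IsCoord.id.fst IsCoord.id.snd.snd)
  exact (inferInstance : Def D fun x : Γ × (Δ × Ξ) => f x.1 = x.2.1 ∧ h x.1 = x.2.2).congr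
    fun g => by rw [Prod.ext_iff]

instance (priority := high) Def.eq (f h : Γ → Δ) [hf : DefMap D f] [hh : DefMap D h] :
    Def D fun g => f g = h g :=
  Def.diagonal.comp (DefMap.pair f h)

theorem Def.comp₂ {q : Δ → Ξ → Prop} (hq : Def D fun x : Δ × Ξ => q x.1 x.2) (f : Γ → Δ)
    (h : Γ → Ξ) [hf : DefMap D f] [hh : DefMap D h] : Def D fun g => q (f g) (h g) :=
  hq.comp (DefMap.pair f h)

theorem Def.comp₃ {q : Δ → Ξ → T → Prop} (hq : Def D fun x : Δ × Ξ × T => q x.1 x.2.1 x.2.2)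
    (f : Γ → Δ) (h : Γ → Ξ) (k : Γ → T) [hf : DefMap D f] [hh : DefMap D h] [hk : DefMap D k] :
    Def D fun g => q (f g) (h g) (k g) :=
  have := DefMap.pair (D := D) h k
  hq.comp (DefMap.pair f fun g => (h g, k g))

end

end Definiteness

namespace Definiteness

open FirstOrder FirstOrder.Language

/-! ### The meaning of the formulas of set theory -/

section

variable {K : Type*} (mem lt : K → K → Prop) (atm : K → Prop)

/-- `z = {x, y}` -/
def IsPair (z x y : K) : Prop := ∀ w, mem w z ↔ (w = x ∨ w = y)

/-- `z = {{x}, {x, y}}` -/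
def IsOrderedPair (z x y : K) : Prop := ∀ w, mem w z ↔ (IsPair mem w x x ∨ IsPair mem w x y)

/-- `⟨x, y⟩ ∈ f` -/
def OrderedPairMem (x y f : K) : Prop := ∃ w, IsOrderedPair mem w x y ∧ mem w f

/-- `z = x ∪ {y}` -/
def IsAdjunction (z x y : K) : Prop := ∀ w, mem w z ↔ (mem w x ∨ w = y)

/-- `x` is a transitive set. -/
def IsTransitive (x : K) : Prop := ∀ w, mem w x → ∀ v, mem v w → mem v x

/-- `f` is a bijection from `x` onto `y`. -/
def IsBijection (f x y : K) : Prop :=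
  (∀ w, mem w f → ∃ a b, mem a x ∧ mem b y ∧ IsOrderedPair mem w a b) ∧
  (∀ a, mem a x → ∃ b, ∀ b', mem b y ∧ (OrderedPairMem mem a b' f ↔ b' = b)) ∧
  (∀ b, mem b y → ∃ a, ∀ a', mem a x ∧ (OrderedPairMem mem a' b f ↔ a' = a))

/-- `x` is a natural number. -/
def IsNat (x : K) : Prop :=
  IsTransitive mem x ∧ ∀ w, (mem w x ∨ w = x) →
    ¬ atm w ∧ IsTransitive mem w ∧ ((∀ v, ¬ mem v w) ∨ ∃ v, IsAdjunction mem w v v)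

/-- Replacement for the relation `P`. -/
def Replacement (P : K → K → K → Prop) : Prop :=
  ∀ p x, (∀ z, mem z x → ∃ y, ∀ y', P p z y' ↔ y' = y) →
    ∃ u, ∀ y, mem y u ↔ ∃ z, mem z x ∧ P p z y

/-- `∈`-induction for the class `P`. -/
def Induction (P : K → Prop) : Prop := (∀ x, (∀ y, mem y x → P y) → P x) → ∀ x, P x

/-- The axioms of `HF(DLO)` that are not schemes. -/
structure IsHFDLO : Prop where
  pow : ∀ x, ∃ y, ∀ z, mem z y ↔ ¬ atm z ∧ ∀ w, mem w z → mem w x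
  union : ∀ x, ∃ y, ¬ atm y ∧ ∀ z, mem z y ↔ ∃ w, mem w x ∧ mem z w
  finite : ∀ x, ¬ atm x → ∃ n f, IsNat mem atm n ∧ IsBijection mem f n x
  ext : ∀ x y, ¬ atm x → ¬ atm y → (∀ z, mem z x ↔ mem z y) → x = y
  atoms_empty : ∀ x, atm x → ∀ y, ¬ mem y x
  exists_atom : ∃ x, atm x
  lt_atm : ∀ x y, lt x y → atm x ∧ atm y
  irrefl : ∀ x, atm x → ¬ lt x x
  trans : ∀ x y z, atm x → atm y → atm z → lt x y → lt y z → lt x z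
  total : ∀ x y, atm x → atm y → lt x y ∨ x = y ∨ lt y x
  dense : ∀ x y, atm x → atm y → lt x y → ∃ z, atm z ∧ lt x z ∧ lt z y
  no_min : ∀ x, atm x → ∃ y, atm y ∧ lt y x
  no_max : ∀ x, atm x → ∃ y, atm y ∧ lt x y

end

section

variable {L : FirstOrder.Language.{0, 0}} {K : Type u} [L.Structure K] {n : ℕ}

/-- The interpretation of a binary relation symbol. -/
abbrev rel₂ (K : Type u) [L.Structure K] (e : L.Relations 2) (x y : K) : Prop :=
  Structure.RelMap e ![x, y]

/-- The interpretation of a unary relation symbol. -/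
abbrev rel₁ (K : Type u) [L.Structure K] (a : L.Relations 1) (x : K) : Prop :=
  Structure.RelMap a ![x]

variable (e : L.Relations 2) (a : L.Relations 1) {v : Empty → K} {xs : Fin n → K}

@[simp] theorem realize_eqF (x y : Fin n) : (eqF (L := L) x y).Realize v xs ↔ xs x = xs y := by
  simp [eqF]

@[simp] theorem realize_unF (x : Fin n) : (unF a x).Realize v xs ↔ rel₁ K a (xs x) := by
  simp [unF, BoundedFormula.realize_rel₁]

@[simp] theorem realize_binF (x y : Fin n) :
    (binF e x y).Realize v xs ↔ rel₂ K e (xs x) (xs y) := by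
  simp [binF, BoundedFormula.realize_rel₂]

@[simp] theorem realize_isEmptyF (x : Fin n) :
    (isEmptyF e x).Realize v xs ↔ ∀ y, ¬ rel₂ K e y (xs x) := by
  simp [isEmptyF]

@[simp] theorem realize_subsetF (x y : Fin n) :
    (subsetF e x y).Realize v xs ↔ ∀ w, rel₂ K e w (xs x) → rel₂ K e w (xs y) := by
  simp [subsetF]

@[simp] theorem realize_isPairF (z x y : Fin n) :
    (isPairF e z x y).Realize v xs ↔ IsPair (rel₂ K e) (xs z) (xs x) (xs y) := by
  simp [isPairF, IsPair]

@[simp] theorem realize_isOrderedPairF (z x y : Fin n) :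
    (isOrderedPairF e z x y).Realize v xs ↔ IsOrderedPair (rel₂ K e) (xs z) (xs x) (xs y) := by
  simp [isOrderedPairF, IsOrderedPair]

@[simp] theorem realize_orderedPairMemF (x y f : Fin n) :
    (orderedPairMemF e x y f).Realize v xs ↔
      OrderedPairMem (rel₂ K e) (xs x) (xs y) (xs f) := by
  simp [orderedPairMemF, OrderedPairMem]

@[simp] theorem realize_isAdjunctionF (z x y : Fin n) :
    (isAdjunctionF e z x y).Realize v xs ↔ IsAdjunction (rel₂ K e) (xs z) (xs x) (xs y) := by
  simp [isAdjunctionF, IsAdjunction]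

@[simp] theorem realize_isTransitiveF (x : Fin n) :
    (isTransitiveF e x).Realize v xs ↔ IsTransitive (rel₂ K e) (xs x) := by
  simp [isTransitiveF, IsTransitive]

@[simp] theorem realize_isBijectionF (f x y : Fin n) :
    (isBijectionF e f x y).Realize v xs ↔ IsBijection (rel₂ K e) (xs f) (xs x) (xs y) := by
  simp only [isBijectionF, IsBijection, Fin.succ_last, BoundedFormula.realize_inf,
    BoundedFormula.realize_all, BoundedFormula.realize_imp, BoundedFormula.realize_ex,
    BoundedFormula.realize_iff, realize_binF, realize_isOrderedPairF, realize_orderedPairMemF,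
    realize_eqF, Fin.snoc_castSucc, Fin.snoc_last, and_assoc]

@[simp] theorem realize_isNatF (x : Fin n) :
    (isNatF e a x).Realize v xs ↔ IsNat (rel₂ K e) (rel₁ K a) (xs x) := by
  simp [isNatF, IsNat, and_assoc]

theorem realize_replF (P : L.Relations 3) :
    K ⊨ replF e P ↔ Replacement (rel₂ K e) fun x y z => Structure.RelMap P ![x, y, z] := by
  simp only [replF, Sentence.Realize, Formula.Realize, BoundedFormula.realize_all,
    BoundedFormula.realize_imp, BoundedFormula.realize_ex, BoundedFormula.realize_iff,
    BoundedFormula.realize_inf, realize_binF, realize_eqF, BoundedFormula.realize_rel]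
  -- The letter is applied to three of the five variables in scope; this evaluates the nested
  -- assignment at their indices.
  have h (p x z y w : K) (i j k : Fin 5) :
      (fun l : Fin 3 => Term.realize (Sum.elim (default : Empty → K)
        (Fin.snoc (Fin.snoc (Fin.snoc (Fin.snoc (Fin.snoc default p) x) z) y) w))
        ((![&i, &j, &k] : Fin 3 → L.Term (Empty ⊕ Fin 5)) l)) =
      ![(![p, x, z, y, w] : Fin 5 → K) i, ![p, x, z, y, w] j, ![p, x, z, y, w] k] := by
    have : (Fin.snoc (Fin.snoc (Fin.snoc (Fin.snoc (Fin.snoc default p) x) z) y) w : Fin 5 → K) =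
        ![p, x, z, y, w] := by
      funext l
      fin_cases l <;> rfl
    rw [this]
    funext l
    fin_cases l <;> rfl
  simp only [h]
  rfl

end

/-- The symbol `<` of `hfLang`. -/
def hfLt : hfLang.Relations 2 := HFRel.lt

/-- The symbol `∈` of `hfLang`. -/
def hfMem : hfLang.Relations 2 := HFRel.mem

/-- The symbol `A` of `hfLang`. -/
def hfAtom : hfLang.Relations 1 := HFRel.atom

section

variable {K : Type u} [hfLang.Structure K] (P : ∀ n, Set (Fin n → K))

theorem HFDLO_holdsAt_iff : HFDLO.HoldsAt K P ↔
    Replacement (rel₂ K hfMem) (fun x y z => ![x, y, z] ∈ P 3) ∧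
    Induction (rel₂ K hfMem) (fun x => ![x] ∈ P 1) ∧
    IsHFDLO (rel₂ K hfMem) (rel₂ K hfLt) (rel₁ K hfAtom) := by
  let _ := lettersStructure P
  have hm (x y : K) : rel₂ K HF.mem x y ↔ rel₂ K hfMem x y := Iff.rfl
  have hl (x y : K) : rel₂ K HF.lt x y ↔ rel₂ K hfLt x y := Iff.rfl
  have ha (x : K) : rel₁ K HF.atom x ↔ rel₁ K hfAtom x := Iff.rfl
  have h₁ : K ⊨ replF HF.mem (letter hfLang 3) ↔
    Replacement (rel₂ K hfMem) (fun x y z => ![x, y, z] ∈ P 3) := realize_replF _ _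
  have h₂ : K ⊨ HF.induction ↔ Induction (rel₂ K hfMem) (fun x => ![x] ∈ P 1) := by
    simp only [HF.induction, Sentence.Realize, Formula.Realize, BoundedFormula.realize_all,
      BoundedFormula.realize_imp, realize_binF, realize_unF]
    rfl
  have h₃ : K ⊨ (HF.powerset ⊓ HF.union ⊓ HF.finiteness ⊓ HF.extensionality ⊓ HF.atomsEmpty ⊓
      HF.atomsDLO) ↔ IsHFDLO (rel₂ K hfMem) (rel₂ K hfLt) (rel₁ K hfAtom) := by
    simp only [HF.powerset, HF.union, HF.finiteness, HF.extensionality, HF.atomsEmpty,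
      HF.atomsDLO, Sentence.Realize, Formula.Realize, BoundedFormula.realize_all,
      BoundedFormula.realize_imp, realize_binF, realize_unF, BoundedFormula.realize_inf,
      BoundedFormula.realize_ex, BoundedFormula.realize_iff, BoundedFormula.realize_not,
      realize_subsetF, realize_isNatF, realize_isBijectionF, realize_eqF, realize_isEmptyF,
      BoundedFormula.realize_sup]
    constructor
    · rintro ⟨⟨⟨⟨⟨p1, p2⟩, p3⟩, p4⟩, p5⟩, ⟨⟨⟨⟨⟨⟨⟨q1, q2⟩, q3⟩, q4⟩, q5⟩, q6⟩, q7⟩, q8⟩⟩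
      exact ⟨p1, p2, p3, fun x y hx hy h => p4 x y ⟨hx, hy⟩ h, p5, q1, q2, q3,
        fun x y z hx hy hz h h' => q4 x y z ⟨⟨hx, hy⟩, hz⟩ ⟨h, h'⟩,
        fun x y hx hy => or_assoc.mp (q5 x y ⟨hx, hy⟩),
        fun x y hx hy h => (q6 x y ⟨hx, hy⟩ h).imp fun z hz => and_assoc.mp hz, q7, q8⟩
    · rintro ⟨p1, p2, p3, p4, p5, q1, q2, q3, q4, q5, q6, q7, q8⟩
      exact ⟨⟨⟨⟨⟨p1, p2⟩, p3⟩, fun x y h => p4 x y h.1 h.2⟩, p5⟩, ⟨⟨⟨⟨⟨⟨⟨q1, q2⟩, q3⟩,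
        fun x y z h h' => q4 x y z h.1.1 h.1.2 h.2 h'.1 h'.2⟩,
        fun x y h => or_assoc.mpr (q5 x y h.1 h.2)⟩,
        fun x y h h' => (q6 x y h.1 h.2 h').imp fun z hz => and_assoc.mpr hz⟩, q7⟩, q8⟩⟩
  rw [← h₁, ← h₂, ← h₃]
  simp only [Scheme.HoldsAt, HFDLO, Sentence.Realize, Formula.Realize,
    BoundedFormula.realize_inf, and_assoc]

end

end Definiteness

namespace Definiteness

open FirstOrder FirstOrder.Language

/-! ### Definability of the notions of set theory -/

section

variable {M : Type u} {D : Definability M} {Γ K : Type u} [Coded D Γ] [Coded D K]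

/-- The relation `r` is definable. -/
class DefRel (D : Definability M) {S T : Type u} [Coded D S] [Coded D T] (r : S → T → Prop) :
    Prop where
  out : Def D fun x : S × T => r x.1 x.2

instance DefRel.comp {S T : Type u} [Coded D S] [Coded D T] (r : S → T → Prop)
    [h : DefRel D r] (f : Γ → S) (g : Γ → T) [DefMap D f] [DefMap D g] :
    Def D fun x => r (f x) (g x) :=
  h.out.comp₂ f g

variable (mem : K → K → Prop) [DefRel D mem] (f g h : Γ → K) [DefMap D f] [DefMap D g]
  [DefMap D h]

instance IsPair.def : Def D fun x => IsPair mem (f x) (g x) (h x) :=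
  Def.comp₃ (by unfold IsPair; infer_instance) f g h

instance IsOrderedPair.def : Def D fun x => IsOrderedPair mem (f x) (g x) (h x) :=
  Def.comp₃ (by unfold IsOrderedPair; infer_instance) f g h

instance OrderedPairMem.def : Def D fun x => OrderedPairMem mem (f x) (g x) (h x) :=
  Def.comp₃ (by unfold OrderedPairMem; infer_instance) f g h

instance IsAdjunction.def : Def D fun x => IsAdjunction mem (f x) (g x) (h x) :=
  Def.comp₃ (by unfold IsAdjunction; infer_instance) f g h

end

set_option synthInstance.maxSize 100000
set_option synthInstance.maxHeartbeats 400000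

/-! ### Hereditarily finite sets over a dense linear order -/

/-- The signature of `HF(DLO)`. -/
class HFSig (K : Type u) where
  mem : K → K → Prop
  lt : K → K → Prop
  atm : K → Prop

local infix:50 " ∈ₕ " => HFSig.mem
local infix:50 " <ₕ " => HFSig.lt

/-- `K` is a model of `HF(DLO)` with the schemes for all definable relations. -/
class HFModel {M : Type u} (D : Definability M) (K : Type u) [Coded D K] [HFSig K] : Prop where
  def_mem : DefRel D (HFSig.mem (K := K))
  def_lt : DefRel D (HFSig.lt (K := K))
  def_atm : Def D (HFSig.atm (K := K))
  repl : ∀ P : K → K → K → Prop, Def D (fun x : K × K × K => P x.1 x.2.1 x.2.2) →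
    Replacement HFSig.mem P
  ind : ∀ P : K → Prop, Def D P → Induction HFSig.mem P
  isHFDLO : IsHFDLO (K := K) HFSig.mem HFSig.lt HFSig.atm

namespace HFModel

attribute [instance] def_mem def_lt def_atm

variable {M : Type u} {D : Definability M} {Γ K : Type u} [Coded D Γ] [Coded D K] [HFSig K]

instance def_atm_comp [HFModel D K] (f : Γ → K) [hf : DefMap D f] : Def D fun x => HFSig.atm (f x) :=
  (def_atm (D := D) (K := K)).comp hf

instance def_isNat [HFModel D K] : Def D (IsNat (K := K) HFSig.mem HFSig.atm) := by
  unfold IsNat IsTransitive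
  infer_instance

/-! ### Forming finite sets inside a model of `HF(DLO)`. -/

section

variable (D K)

/-- An atom has no elements, so its union has none either, and the union axiom provides a non-atom.
-/
theorem exists_empty [HFModel D K] : ∃ e : K, ¬ HFSig.atm e ∧ ∀ z, ¬ z ∈ₕ e := by
  have h := isHFDLO (D := D) (K := K)
  obtain ⟨a, ha⟩ := h.exists_atom
  obtain ⟨e, he, he'⟩ := h.union a
  refine ⟨e, he, fun z hz => ?_⟩
  obtain ⟨w, hw, -⟩ := (he' z).mp hz
  exact h.atoms_empty a ha w hw

variable {K}

theorem exists_set [HFModel D K] (x : K) : ∃ y, ¬ HFSig.atm y ∧ ∀ z, z ∈ₕ y ↔ z ∈ₕ x := by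
  by_cases hx : HFSig.atm x
  · obtain ⟨e, he, he'⟩ := exists_empty D K
    exact ⟨e, he, fun z => iff_of_false (he' z) ((isHFDLO (D := D) (K := K)).atoms_empty x hx z)⟩
  · exact ⟨x, hx, fun _ => Iff.rfl⟩

/-- Replacement alone might return an atom when the image is empty; `exists_set` excludes this. The
parameter `p` is an explicit argument of `P` because definability may be without parameters from
`M`. -/
theorem exists_image [HFModel D K] (P : K → K → K → Prop) [hP : Def D fun x : K × K × K => P x.1 x.2.1 x.2.2]
    (p x : K) (hx : ∀ z, z ∈ₕ x → ∃ y, ∀ y', P p z y' ↔ y' = y) :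
    ∃ u, ¬ HFSig.atm u ∧ ∀ y, y ∈ₕ u ↔ ∃ z, z ∈ₕ x ∧ P p z y := by
  obtain ⟨u, hu⟩ := repl (D := D) P hP p x hx
  obtain ⟨v, hv, hv'⟩ := exists_set D u
  exact ⟨v, hv, fun y => (hv' y).trans (hu y)⟩

/-- The power set of the empty set is inhabited; replace its elements by `a`, which is the parameter
of replacement. -/
theorem exists_singleton [HFModel D K] (a : K) : ∃ s, ¬ HFSig.atm s ∧ ∀ z, z ∈ₕ s ↔ z = a := by
  have h := isHFDLO (D := D) (K := K)
  obtain ⟨e, he, he'⟩ := exists_empty D K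
  obtain ⟨p, hp⟩ := h.pow e
  have hep : e ∈ₕ p := (hp e).mpr ⟨he, fun w hw => hw⟩
  obtain ⟨s, hs, hs'⟩ := exists_image D (fun q _ y => y = q) a p fun z _ => ⟨a, fun y => Iff.rfl⟩
  exact ⟨s, hs, fun z => ⟨fun hz => ((hs' z).mp hz).choose_spec.2, fun hz => (hs' z).mpr
    ⟨e, hep, hz⟩⟩⟩

/-- The power set of `{b}` has exactly the elements `∅` and `{b}`. Send `∅` to the parameter `a`,
and `{b}` to its own element: thus `b` enters through the argument, and the one parameter of
replacement suffices. -/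
theorem exists_pair [HFModel D K] (a b : K) : ∃ s, ¬ HFSig.atm s ∧ ∀ z, z ∈ₕ s ↔ (z = a ∨ z = b) := by
  have h := isHFDLO (D := D) (K := K)
  obtain ⟨e, he, he'⟩ := exists_empty D K
  obtain ⟨t, ht, ht'⟩ := exists_singleton D b
  obtain ⟨p, hp⟩ := h.pow t
  have hep : e ∈ₕ p := (hp e).mpr ⟨he, fun w hw => (he' w hw).elim⟩
  have htp : t ∈ₕ p := (hp t).mpr ⟨ht, fun w hw => hw⟩
  have key : ∀ z, z ∈ₕ p → (∀ y, ¬ y ∈ₕ z) ∨ ∀ y, y ∈ₕ z ↔ y = b := by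
    intro z hz
    have hzt := ((hp z).mp hz).2
    by_cases hb : b ∈ₕ z
    · exact Or.inr fun y => ⟨fun hy => (ht' y).mp (hzt y hy), fun hy => hy ▸ hb⟩
    · exact Or.inl fun y hy => hb ((ht' y).mp (hzt y hy) ▸ hy)
  obtain ⟨s, hs, hs'⟩ := exists_image D (fun q z y : K => ((∀ w : K, ¬ w ∈ₕ z) ∧ y = q) ∨ y ∈ₕ z) a p (by
    intro z hz
    rcases key z hz with h | h
    · exact ⟨a, fun y => by simp [h]⟩
    · exact ⟨b, fun y => by simp [h]⟩)
  refine ⟨s, hs, fun z => ?_⟩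
  rw [hs']
  constructor
  · rintro ⟨w, hw, h1 | h1⟩
    · exact Or.inl h1.2
    · exact Or.inr ((ht' z).mp (((hp w).mp hw).2 z h1))
  · rintro (rfl | rfl)
    · exact ⟨e, hep, Or.inl ⟨he', rfl⟩⟩
    · exact ⟨t, htp, Or.inr ((ht' z).mpr rfl)⟩

theorem exists_adjunction [HFModel D K] (x y : K) : ∃ z, ¬ HFSig.atm z ∧ IsAdjunction HFSig.mem z x y := by
  have h := isHFDLO (D := D) (K := K)
  obtain ⟨t, ht, ht'⟩ := exists_singleton D y
  obtain ⟨s, -, hs⟩ := exists_pair D x t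
  obtain ⟨z, hz, hz'⟩ := h.union s
  refine ⟨z, hz, fun w => ?_⟩
  rw [hz']
  constructor
  · rintro ⟨v, hv, hw⟩
    rcases (hs v).mp hv with rfl | rfl
    · exact Or.inl hw
    · exact Or.inr ((ht' w).mp hw)
  · rintro (hw | hw)
    · exact ⟨x, (hs x).mpr (Or.inl rfl), hw⟩
    · exact ⟨t, (hs t).mpr (Or.inr rfl), (ht' w).mpr hw⟩

/-- Induction on finite sets. -/
theorem set_induction [HFModel D K] (Q : K → Prop) [hQ : Def D Q]
    (empty : ∀ x, ¬ HFSig.atm x → (∀ z, ¬ z ∈ₕ x) → Q x)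
    (adj : ∀ x y z, ¬ HFSig.atm x → ¬ HFSig.atm z → IsAdjunction HFSig.mem z x y → Q x → Q z)
    (x : K) (hx : ¬ HFSig.atm x) : Q x := by
  have h := isHFDLO (D := D) (K := K)
  have hQ' : ∀ {Γ : Type u} [Coded D Γ] (f : Γ → K) [DefMap D f], Def D fun g => Q (f g) :=
    fun f hf => hQ.comp hf
  -- `∈`-induction on the natural number `n` that enumerates the set. Both the enumeration `f` and
  -- the set `x` are quantified inside the predicate, which therefore has no parameters; `f` only
  -- needs to be functional on `n`, not injective. If `n = m ∪ {m}`, then `x` is the image of `m`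
  -- together with the value at `m`.
  have key := ind (D := D) (fun n : K => IsNat HFSig.mem HFSig.atm n → ∀ f : K,
    (∀ k : K, k ∈ₕ n → ∃ y : K, ∀ y' : K, OrderedPairMem HFSig.mem k y' f ↔ y' = y) →
    ∀ x : K, ¬ HFSig.atm x →
    (∀ y : K, y ∈ₕ x ↔ ∃ k : K, k ∈ₕ n ∧ OrderedPairMem HFSig.mem k y f) → Q x)
    (by infer_instance) (by
      intro n ih hn f hf x hx hxf
      rcases (hn.2 n (Or.inr rfl)).2.2 with h0 | ⟨m, hm⟩
      · exact empty x hx fun z hz => by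
          obtain ⟨k, hk, -⟩ := (hxf z).mp hz
          exact h0 k hk
      · have hmn : m ∈ₕ n := (hm m).mpr (Or.inr rfl)
        have hsub : ∀ w, w ∈ₕ m → w ∈ₕ n := fun w hw => (hm w).mpr (Or.inl hw)
        have hm' : IsNat HFSig.mem HFSig.atm m := by
          refine ⟨(hn.2 m (Or.inl hmn)).2.1, fun w hw => hn.2 w (Or.inl ?_)⟩
          rcases hw with hw | rfl
          · exact hsub w hw
          · exact hmn
        obtain ⟨x', hx', hxf'⟩ := exists_image D (fun f k y => OrderedPairMem HFSig.mem k y f) f m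
          fun k hk => hf k (hsub k hk)
        obtain ⟨y, hy⟩ := hf m hmn
        refine adj x' y x hx' hx (fun w => ?_)
          (ih m hmn hm' f (fun k hk => hf k (hsub k hk)) x' hx' hxf')
        rw [hxf, hxf']
        constructor
        · rintro ⟨k, hk, hkw⟩
          rcases (hm k).mp hk with hk | rfl
          · exact Or.inl ⟨k, hk, hkw⟩
          · exact Or.inr ((hy w).mp hkw)
        · rintro (⟨k, hk, hkw⟩ | rfl)
          · exact ⟨k, hsub k hk, hkw⟩
          · exact ⟨m, hmn, (hy w).mpr rfl⟩)
  obtain ⟨n, f, hn, -, hf, hf'⟩ := h.finite x hx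
  refine key n hn f (fun k hk => ?_) x hx fun y => ?_
  · obtain ⟨b, hb⟩ := hf k hk
    exact ⟨b, fun y' => (hb y').2⟩
  · constructor
    · intro hy
      obtain ⟨a, ha⟩ := hf' y hy
      exact ⟨a, (ha a).1, (ha a).2.mpr rfl⟩
    · rintro ⟨k, hk, hky⟩
      obtain ⟨b, hb⟩ := hf k hk
      rw [(hb y).2.mp hky]
      exact (hb b).1

/-- Induction on the finite set `d`: a new element either beats the previous maximum or does not.
The relation is left abstract so that both the order of the atoms and its inverse can be used. -/
theorem exists_greatest [HFModel D K] (r : K → K → Prop) [DefRel D r]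
    (trans : ∀ x y z, r x y → r y z → r x z)
    (total : ∀ x y, HFSig.atm x → HFSig.atm y → r x y ∨ x = y ∨ r y x)
    (atoms : ∀ x y, r x y → HFSig.atm x) (d a : K) (h : ∃ c, c ∈ₕ d ∧ r c a) :
    ∃ c, c ∈ₕ d ∧ r c a ∧ ∀ c', c' ∈ₕ d → r c' a → r c' c ∨ c' = c := by
  by_cases hd : HFSig.atm d
  · obtain ⟨c, hc, -⟩ := h
    exact ((isHFDLO (D := D) (K := K)).atoms_empty d hd c hc).elim
  -- The bound `a` must be quantified in the induction predicate, as it may not be a parameter.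
  revert a
  refine set_induction D (fun d : K => ∀ a, (∃ c, c ∈ₕ d ∧ r c a) →
    ∃ c, c ∈ₕ d ∧ r c a ∧ ∀ c', c' ∈ₕ d → r c' a → r c' c ∨ c' = c) ?_ ?_ d hd
  · rintro x - hx a ⟨c, hc, -⟩
    exact (hx c hc).elim
  · rintro x y z - - hz ih a ⟨c, hc, hca⟩
    by_cases hxa : ∃ c, c ∈ₕ x ∧ r c a
    · obtain ⟨b, hb, hba, hmax⟩ := ih a hxa
      by_cases hy : r y a ∧ r b y
      · refine ⟨y, (hz y).mpr (Or.inr rfl), hy.1, fun c' hc' hca' => ?_⟩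
        rcases (hz c').mp hc' with h1 | h1
        · rcases hmax c' h1 hca' with h2 | rfl
          · exact Or.inl (trans _ _ _ h2 hy.2)
          · exact Or.inl hy.2
        · exact Or.inr h1
      · refine ⟨b, (hz b).mpr (Or.inl hb), hba, fun c' hc' hca' => ?_⟩
        rcases (hz c').mp hc' with h1 | rfl
        · exact hmax c' h1 hca'
        · rcases total c' b (atoms _ _ hca') (atoms _ _ hba) with h1 | h1 | h1
          · exact Or.inl h1
          · exact Or.inr h1
          · exact (hy ⟨hca', h1⟩).elim
    · have hy : ∀ c', c' ∈ₕ z → r c' a → c' = y := fun c' hc' hca' =>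
        ((hz c').mp hc').resolve_left fun h => hxa ⟨c', h, hca'⟩
      obtain rfl := hy c hc hca
      exact ⟨c, hc, hca, fun c' hc' hca' => Or.inr (hy c' hc' hca')⟩

end

end HFModel

end Definiteness

namespace Definiteness

open FirstOrder FirstOrder.Language

set_option synthInstance.maxSize 100000
set_option synthInstance.maxHeartbeats 400000

local infix:50 " ∈ₕ " => HFSig.mem
local infix:50 " <ₕ " => HFSig.lt

/-! ### Back and forth between models of `HF(DLO)` -/

/-- `R` is a finite partial isomorphism with downward closed domain and range. -/
structure IsPartialIso {K₀ K₁ : Type u} [HFSig K₀] [HFSig K₁] (R : K₀ → K₁ → Prop) : Prop where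
  eq_iff : ∀ a b, R a b → ∀ a' b', R a' b' → (a = a' ↔ b = b')
  lt_iff : ∀ a b, R a b → ∀ a' b', R a' b' → (a <ₕ a' ↔ b <ₕ b')
  atm_iff : ∀ a b, R a b → (HFSig.atm a ↔ HFSig.atm b)
  left : ∀ a b, R a b → ∀ a', a' ∈ₕ a → ∃ b', b' ∈ₕ b ∧ R a' b'
  right : ∀ a b, R a b → ∀ b', b' ∈ₕ b → ∃ a', a' ∈ₕ a ∧ R a' b'
  dom : ∃ d : K₀, ∀ a, a ∈ₕ d ↔ ∃ b, R a b
  ran : ∃ e : K₁, ∀ b, b ∈ₕ e ↔ ∃ a, R a b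

theorem IsPartialIso.flip {K₀ K₁ : Type u} [HFSig K₀] [HFSig K₁] {R : K₀ → K₁ → Prop}
    (h : IsPartialIso R) : IsPartialIso fun b a => R a b where
  eq_iff _ _ h₁ _ _ h₂ := (h.eq_iff _ _ h₁ _ _ h₂).symm
  lt_iff _ _ h₁ _ _ h₂ := (h.lt_iff _ _ h₁ _ _ h₂).symm
  atm_iff _ _ h₁ := (h.atm_iff _ _ h₁).symm
  left _ _ h₁ := h.right _ _ h₁
  right _ _ h₁ := h.left _ _ h₁
  dom := h.ran
  ran := h.dom

theorem IsPartialIso.mem_iff {K₀ K₁ : Type u} [HFSig K₀] [HFSig K₁] {R : K₀ → K₁ → Prop}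
    (h : IsPartialIso R) {a a' : K₀} {b b' : K₁} (h₁ : R a b) (h₂ : R a' b') :
    a' ∈ₕ a ↔ b' ∈ₕ b := by
  constructor
  · intro ha
    obtain ⟨c, hc, hac⟩ := h.left _ _ h₁ _ ha
    rwa [(h.eq_iff _ _ h₂ _ _ hac).mp rfl]
  · intro hb
    obtain ⟨c, hc, hcb⟩ := h.right _ _ h₁ _ hb
    rwa [(h.eq_iff _ _ h₂ _ _ hcb).mpr rfl]

section

variable {M : Type u} {D : Definability M} {Γ S K₀ K₁ : Type u} [Coded D Γ] [Coded D S]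
  [Coded D K₀] [Coded D K₁] [HFSig K₀] [HFSig K₁]

/-- Definability is uniform in the index `s`, so that induction predicates can quantify over all
coded partial isomorphisms. -/
theorem IsPartialIso.def [HFModel D K₀] [HFModel D K₁] (R : S → K₀ → K₁ → Prop)
    (hR : Def D fun x : S × K₀ × K₁ => R x.1 x.2.1 x.2.2) : Def D fun s => IsPartialIso (R s) := by
  have hR' : ∀ {Γ : Type u} [Coded D Γ] (f : Γ → S) (g : Γ → K₀) (h : Γ → K₁) [DefMap D f]
    [DefMap D g] [DefMap D h], Def D fun x => R (f x) (g x) (h x) := fun f g h => hR.comp₃ f g h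
  have h₁ : Def D fun s => ∀ (a : K₀) (b : K₁), R s a b → ∀ (a' : K₀) (b' : K₁), R s a' b' →
    (a = a' ↔ b = b') := inferInstance
  have h₂ : Def D fun s => ∀ (a : K₀) (b : K₁), R s a b → ∀ (a' : K₀) (b' : K₁), R s a' b' →
    (a <ₕ a' ↔ b <ₕ b') := inferInstance
  have h₃ : Def D fun s => ∀ (a : K₀) (b : K₁), R s a b → (HFSig.atm a ↔ HFSig.atm b) :=
    inferInstance
  have h₄ : Def D fun s => ∀ (a : K₀) (b : K₁), R s a b →
    ∀ a' : K₀, a' ∈ₕ a → ∃ b' : K₁, b' ∈ₕ b ∧ R s a' b' := inferInstance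
  have h₅ : Def D fun s => ∀ (a : K₀) (b : K₁), R s a b →
    ∀ b' : K₁, b' ∈ₕ b → ∃ a' : K₀, a' ∈ₕ a ∧ R s a' b' := inferInstance
  have h₆ : Def D fun s => ∃ d : K₀, ∀ a : K₀, a ∈ₕ d ↔ ∃ b, R s a b := inferInstance
  have h₇ : Def D fun s => ∃ e : K₁, ∀ b : K₁, b ∈ₕ e ↔ ∃ a, R s a b := inferInstance
  refine (Def.and _ _ (hp := h₁) (hq := Def.and _ _ (hp := h₂) (hq := Def.and _ _ (hp := h₃)
    (hq := Def.and _ _ (hp := h₄) (hq := Def.and _ _ (hp := h₅)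
    (hq := Def.and _ _ (hp := h₆) (hq := h₇))))))).congr fun s => ?_
  exact ⟨fun ⟨h1, h2, h3, h4, h5, h6, h7⟩ => ⟨h1, h2, h3, h4, h5, h6, h7⟩,
    fun ⟨h1, h2, h3, h4, h5, h6, h7⟩ => ⟨h1, h2, h3, h4, h5, h6, h7⟩⟩

-- One step of the back and forth. The new pair must join elements outside the old domain and range,
-- in the same position in the order, of the same kind, whose elements are already matched.
-- Adjunction in each model keeps the domain and the range sets of that model, hence finite in its
-- sense.
variable (D) in
theorem IsPartialIso.adjoin [HFModel D K₀] [HFModel D K₁] {R R' : K₀ → K₁ → Prop}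
    (h : IsPartialIso R) {a : K₀} {b : K₁} (hR' : ∀ x y, R' x y ↔ R x y ∨ (x = a ∧ y = b))
    (ha : ∀ y, ¬ R a y) (hb : ∀ x, ¬ R x b)
    (hlt : ∀ x y, R x y → (a <ₕ x ↔ b <ₕ y) ∧ (x <ₕ a ↔ y <ₕ b))
    (hatm : HFSig.atm a ↔ HFSig.atm b)
    (left : ∀ a', a' ∈ₕ a → ∃ b', b' ∈ₕ b ∧ R a' b')
    (right : ∀ b', b' ∈ₕ b → ∃ a', a' ∈ₕ a ∧ R a' b') : IsPartialIso R' := by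
  have h₀ := HFModel.isHFDLO (D := D) (K := K₀)
  have h₁ := HFModel.isHFDLO (D := D) (K := K₁)
  have ia : ¬ a <ₕ a := fun h => h₀.irrefl a (h₀.lt_atm a a h).1 h
  have ib : ¬ b <ₕ b := fun h => h₁.irrefl b (h₁.lt_atm b b h).1 h
  refine ⟨?_, ?_, ?_, ?_, ?_, ?_, ?_⟩
  · intro x y hxy x' y' hxy'
    rcases (hR' _ _).mp hxy with hxy | ⟨rfl, rfl⟩ <;>
      rcases (hR' _ _).mp hxy' with hxy' | ⟨rfl, rfl⟩
    · exact h.eq_iff _ _ hxy _ _ hxy'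
    · refine iff_of_false ?_ ?_
      · rintro rfl
        exact ha _ hxy
      · rintro rfl
        exact hb _ hxy
    · refine iff_of_false ?_ ?_
      · rintro rfl
        exact ha _ hxy'
      · rintro rfl
        exact hb _ hxy'
    · exact iff_of_true rfl rfl
  · intro x y hxy x' y' hxy'
    rcases (hR' _ _).mp hxy with hxy | ⟨rfl, rfl⟩ <;>
      rcases (hR' _ _).mp hxy' with hxy' | ⟨rfl, rfl⟩
    · exact h.lt_iff _ _ hxy _ _ hxy'
    · exact (hlt _ _ hxy).2
    · exact (hlt _ _ hxy').1
    · exact iff_of_false ia ib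
  · intro x y hxy
    rcases (hR' _ _).mp hxy with hxy | ⟨rfl, rfl⟩
    · exact h.atm_iff _ _ hxy
    · exact hatm
  · intro x y hxy x' hx'
    rcases (hR' _ _).mp hxy with hxy | ⟨rfl, rfl⟩
    · obtain ⟨y', hy', hxy'⟩ := h.left _ _ hxy x' hx'
      exact ⟨y', hy', (hR' _ _).mpr (Or.inl hxy')⟩
    · obtain ⟨y', hy', hxy'⟩ := left x' hx'
      exact ⟨y', hy', (hR' _ _).mpr (Or.inl hxy')⟩
  · intro x y hxy y' hy'
    rcases (hR' _ _).mp hxy with hxy | ⟨rfl, rfl⟩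
    · obtain ⟨x', hx', hxy'⟩ := h.right _ _ hxy y' hy'
      exact ⟨x', hx', (hR' _ _).mpr (Or.inl hxy')⟩
    · obtain ⟨x', hx', hxy'⟩ := right y' hy'
      exact ⟨x', hx', (hR' _ _).mpr (Or.inl hxy')⟩
  · obtain ⟨d, hd⟩ := h.dom
    obtain ⟨d', -, hd'⟩ := HFModel.exists_adjunction D d a
    refine ⟨d', fun x => ?_⟩
    rw [hd' x, hd]
    constructor
    · rintro (⟨y, hy⟩ | rfl)
      · exact ⟨y, (hR' _ _).mpr (Or.inl hy)⟩
      · exact ⟨b, (hR' _ _).mpr (Or.inr ⟨rfl, rfl⟩)⟩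
    · rintro ⟨y, hy⟩
      rcases (hR' _ _).mp hy with hy | hy
      · exact Or.inl ⟨y, hy⟩
      · exact Or.inr hy.1
  · obtain ⟨d, hd⟩ := h.ran
    obtain ⟨d', -, hd'⟩ := HFModel.exists_adjunction D d b
    refine ⟨d', fun x => ?_⟩
    rw [hd' x, hd]
    constructor
    · rintro (⟨y, hy⟩ | rfl)
      · exact ⟨y, (hR' _ _).mpr (Or.inl hy)⟩
      · exact ⟨a, (hR' _ _).mpr (Or.inr ⟨rfl, rfl⟩)⟩
    · rintro ⟨y, hy⟩
      rcases (hR' _ _).mp hy with hy | hy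
      · exact Or.inl ⟨y, hy⟩
      · exact Or.inr hy.2

variable (D) in
/-- A new atom has a counterpart that lies in the same position. -/
theorem IsPartialIso.exists_atom [HFModel D K₀] [HFModel D K₁] {R : K₀ → K₁ → Prop}
    (h : IsPartialIso R) {a : K₀} (ha : HFSig.atm a) (hR : ∀ y, ¬ R a y) :
    ∃ b : K₁, HFSig.atm b ∧ ∀ x y, R x y → (a <ₕ x ↔ b <ₕ y) ∧ (x <ₕ a ↔ y <ₕ b) := by
  have h₀ := HFModel.isHFDLO (D := D) (K := K₀)
  have h₁ := HFModel.isHFDLO (D := D) (K := K₁)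
  have tr : ∀ x y z : K₀, x <ₕ y → y <ₕ z → x <ₕ z := fun x y z hxy hyz =>
    h₀.trans x y z (h₀.lt_atm _ _ hxy).1 (h₀.lt_atm _ _ hxy).2 (h₀.lt_atm _ _ hyz).2 hxy hyz
  have tr' : ∀ x y z : K₁, x <ₕ y → y <ₕ z → x <ₕ z := fun x y z hxy hyz =>
    h₁.trans x y z (h₁.lt_atm _ _ hxy).1 (h₁.lt_atm _ _ hxy).2 (h₁.lt_atm _ _ hyz).2 hxy hyz
  have as' : ∀ x y : K₁, x <ₕ y → ¬ y <ₕ x := fun x y hxy hyx =>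
    h₁.irrefl x (h₁.lt_atm _ _ hxy).1 (tr' _ _ _ hxy hyx)
  obtain ⟨d, hd⟩ := h.dom
  -- One direction is enough: since `a` is new, totality compares it with every atom of the domain,
  -- and a wrong comparison would give both `b < y` and `y < b`.
  suffices hs : ∃ b : K₁, HFSig.atm b ∧ ∀ x y, R x y → (a <ₕ x → b <ₕ y) ∧ (x <ₕ a → y <ₕ b) by
    obtain ⟨b, hb, hb'⟩ := hs
    refine ⟨b, hb, fun x y hxy => ⟨⟨(hb' x y hxy).1, fun hby => ?_⟩, ⟨(hb' x y hxy).2, fun hby => ?_⟩⟩⟩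
    all_goals
      have hx : HFSig.atm x := by
        have := h₁.lt_atm _ _ hby
        exact (h.atm_iff _ _ hxy).mpr (by tauto)
      rcases h₀.total a x ha hx with hax | rfl | hax
    · exact hax
    · exact (hR _ hxy).elim
    · exact (as' _ _ hby ((hb' x y hxy).2 hax)).elim
    · exact (as' _ _ hby ((hb' x y hxy).1 hax)).elim
    · exact (hR _ hxy).elim
    · exact hax
  -- The domain `d` is a set of the model, so `a` has a nearest neighbour in it on each side where
  -- it has any; the images of these neighbours delimit the place for `b`.
  have lower : (∃ c, c ∈ₕ d ∧ c <ₕ a) →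
      ∃ c y, R c y ∧ c <ₕ a ∧ ∀ x y', R x y' → x <ₕ a → y' <ₕ y ∨ y' = y := by
    intro hex
    obtain ⟨c, hc, hca, hmax⟩ := HFModel.exists_greatest D (K := K₀) HFSig.lt tr h₀.total
      (fun x y hxy => (h₀.lt_atm x y hxy).1) d a hex
    obtain ⟨y, hy⟩ := (hd c).mp hc
    refine ⟨c, y, hy, hca, fun x y' hxy hxa => ?_⟩
    exact (hmax x ((hd x).mpr ⟨y', hxy⟩) hxa).imp (h.lt_iff _ _ hxy _ _ hy).mp
      (h.eq_iff _ _ hxy _ _ hy).mp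
  have upper : (∃ c, c ∈ₕ d ∧ a <ₕ c) →
      ∃ c y, R c y ∧ a <ₕ c ∧ ∀ x y', R x y' → a <ₕ x → y <ₕ y' ∨ y = y' := by
    intro hex
    have : DefRel D fun x y : K₀ => y <ₕ x := ⟨inferInstance⟩
    obtain ⟨c, hc, hca, hmax⟩ := HFModel.exists_greatest D (K := K₀) (fun x y => y <ₕ x)
      (fun x y z hxy hyz => tr z y x hyz hxy)
      (fun x y hx hy => (h₀.total y x hy hx).imp id (Or.imp Eq.symm id))
      (fun x y hxy => (h₀.lt_atm y x hxy).2) d a hex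
    obtain ⟨y, hy⟩ := (hd c).mp hc
    refine ⟨c, y, hy, hca, fun x y' hxy hxa => ?_⟩
    exact (hmax x ((hd x).mpr ⟨y', hxy⟩) hxa).imp (h.lt_iff _ _ hy _ _ hxy).mp
      fun e => (h.eq_iff _ _ hy _ _ hxy).mp e.symm
  have nolower : ¬ (∃ c, c ∈ₕ d ∧ c <ₕ a) → ∀ x y, R x y → ¬ x <ₕ a := fun hn x y hxy hx =>
    hn ⟨x, (hd x).mpr ⟨y, hxy⟩, hx⟩
  have noupper : ¬ (∃ c, c ∈ₕ d ∧ a <ₕ c) → ∀ x y, R x y → ¬ a <ₕ x := fun hn x y hxy hx =>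
    hn ⟨x, (hd x).mpr ⟨y, hxy⟩, hx⟩
  have below : ∀ {y b y' : K₁}, (y' <ₕ y ∨ y' = y) → y <ₕ b → y' <ₕ b := by
    rintro y b y' (hy | rfl) hb
    · exact tr' _ _ _ hy hb
    · exact hb
  have above : ∀ {y b y' : K₁}, (y <ₕ y' ∨ y = y') → b <ₕ y → b <ₕ y' := by
    rintro y b y' (hy | rfl) hb
    · exact tr' _ _ _ hb hy
    · exact hb
  -- The four positions of `a` use, in turn, density, the absence of a maximum, the absence of a
  -- minimum, and the existence of an atom.
  by_cases hl : ∃ c, c ∈ₕ d ∧ c <ₕ a <;> by_cases hu : ∃ c, c ∈ₕ d ∧ a <ₕ c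
  · obtain ⟨c, y, hcy, hca, hmax⟩ := lower hl
    obtain ⟨c', y', hcy', hca', hmin⟩ := upper hu
    have hyy' := (h.lt_iff _ _ hcy _ _ hcy').mp (tr _ _ _ hca hca')
    obtain ⟨b, hb, hyb, hby⟩ := h₁.dense y y' (h₁.lt_atm _ _ hyy').1 (h₁.lt_atm _ _ hyy').2 hyy'
    exact ⟨b, hb, fun x z hxz => ⟨fun hax => above (hmin x z hxz hax) hby,
      fun hxa => below (hmax x z hxz hxa) hyb⟩⟩
  · obtain ⟨c, y, hcy, hca, hmax⟩ := lower hl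
    obtain ⟨b, hb, hyb⟩ := h₁.no_max y ((h.atm_iff _ _ hcy).mp (h₀.lt_atm _ _ hca).1)
    exact ⟨b, hb, fun x z hxz => ⟨fun hax => (noupper hu x z hxz hax).elim,
      fun hxa => below (hmax x z hxz hxa) hyb⟩⟩
  · obtain ⟨c', y', hcy', hca', hmin⟩ := upper hu
    obtain ⟨b, hb, hby⟩ := h₁.no_min y' ((h.atm_iff _ _ hcy').mp (h₀.lt_atm _ _ hca').2)
    exact ⟨b, hb, fun x z hxz => ⟨fun hax => above (hmin x z hxz hax) hby,
      fun hxa => (nolower hl x z hxz hxa).elim⟩⟩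
  · obtain ⟨b, hb⟩ := h₁.exists_atom
    exact ⟨b, hb, fun x z hxz => ⟨fun hax => (noupper hu x z hxz hax).elim,
      fun hxa => (nolower hl x z hxz hxa).elim⟩⟩

/-- Replacement in `K₁` does not apply to a relation between two models. The image is instead built
up by adjunction in `K₁`, along an induction on the set `x` of `K₀`. -/
theorem IsPartialIso.exists_image [HFModel D K₀] [HFModel D K₁] (R : S → K₀ → K₁ → Prop)
    (hR : Def D fun x : S × K₀ × K₁ => R x.1 x.2.1 x.2.2) (x : K₀) (hx : ¬ HFSig.atm x) (s : S)
    (hs : IsPartialIso (R s)) :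
    ∃ u : K₁, ¬ HFSig.atm u ∧ ∀ b, b ∈ₕ u ↔ ∃ a, a ∈ₕ x ∧ R s a b := by
  have hR' : ∀ {Γ : Type u} [Coded D Γ] (f : Γ → S) (g : Γ → K₀) (h : Γ → K₁) [DefMap D f]
    [DefMap D g] [DefMap D h], Def D fun x => R (f x) (g x) (h x) := fun f g h => hR.comp₃ f g h
  have hP := IsPartialIso.def R hR
  have hP' : ∀ {Γ : Type u} [Coded D Γ] (f : Γ → S) [DefMap D f],
    Def D fun x => IsPartialIso (R (f x)) := fun f hf => hP.comp hf
  revert s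
  refine HFModel.set_induction D (fun x : K₀ => ∀ s : S, IsPartialIso (R s) →
    ∃ u : K₁, ¬ HFSig.atm u ∧ ∀ b : K₁, b ∈ₕ u ↔ ∃ a : K₀, a ∈ₕ x ∧ R s a b) ?_ ?_ x hx
  · intro x _ hx s _
    obtain ⟨u, hu, hu'⟩ := HFModel.exists_empty D K₁
    exact ⟨u, hu, fun b => iff_of_false (hu' b) fun ⟨a, ha, _⟩ => hx a ha⟩
  · intro x y z _ _ hz ih s hs
    obtain ⟨u, hu, hu'⟩ := ih s hs
    by_cases hy : ∃ b, R s y b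
    · obtain ⟨c, hc⟩ := hy
      obtain ⟨v, hv, hv'⟩ := HFModel.exists_adjunction D u c
      refine ⟨v, hv, fun b => ?_⟩
      rw [hv' b, hu']
      constructor
      · rintro (⟨a, ha, hab⟩ | rfl)
        · exact ⟨a, (hz a).mpr (Or.inl ha), hab⟩
        · exact ⟨y, (hz y).mpr (Or.inr rfl), hc⟩
      · rintro ⟨a, ha, hab⟩
        rcases (hz a).mp ha with ha | rfl
        · exact Or.inl ⟨a, ha, hab⟩
        · exact Or.inr ((hs.eq_iff _ _ hab _ _ hc).mp rfl)
    · refine ⟨u, hu, fun b => ?_⟩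
      rw [hu']
      constructor
      · rintro ⟨a, ha, hab⟩
        exact ⟨a, (hz a).mpr (Or.inl ha), hab⟩
      · rintro ⟨a, ha, hab⟩
        rcases (hz a).mp ha with ha | rfl
        · exact ⟨a, ha, hab⟩
        · exact (hy ⟨b, hab⟩).elim

/-- By `∈`-induction on `a`, simultaneously for all `s`. An atom is placed by its position in the
order; for a set, all elements are first brought into the domain, and then it is sent to the set of
their images. -/
theorem IsPartialIso.forth [HFModel D K₀] [HFModel D K₁] (R : S → K₀ → K₁ → Prop)
    (hR : Def D fun x : S × K₀ × K₁ => R x.1 x.2.1 x.2.2)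
    (hadj : ∀ s a b, ∃ s', ∀ x y, R s' x y ↔ R s x y ∨ (x = a ∧ y = b)) (a : K₀) (s : S)
    (hs : IsPartialIso (R s)) :
    ∃ s', IsPartialIso (R s') ∧ (∀ x y, R s x y → R s' x y) ∧ ∃ b, R s' a b := by
  have hR' : ∀ {Γ : Type u} [Coded D Γ] (f : Γ → S) (g : Γ → K₀) (h : Γ → K₁) [DefMap D f]
    [DefMap D g] [DefMap D h], Def D fun x => R (f x) (g x) (h x) := fun f g h => hR.comp₃ f g h
  have hP := IsPartialIso.def R hR
  have hP' : ∀ {Γ : Type u} [Coded D Γ] (f : Γ → S) [DefMap D f],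
    Def D fun x => IsPartialIso (R (f x)) := fun f hf => hP.comp hf
  have h₀ := HFModel.isHFDLO (D := D) (K := K₀)
  have h₁ := HFModel.isHFDLO (D := D) (K := K₁)
  let Ext (a : K₀) : Prop := ∀ s : S, IsPartialIso (R s) →
    ∃ s' : S, IsPartialIso (R s') ∧ (∀ (x : K₀) (y : K₁), R s x y → R s' x y) ∧ ∃ b, R s' a b
  have hExt : Def D Ext := by
    unfold Ext
    infer_instance
  have hExt' : ∀ {Γ : Type u} [Coded D Γ] (f : Γ → K₀) [DefMap D f],
    Def D fun x => Ext (f x) := fun f hf => hExt.comp hf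
  -- If each element of `x` can be added to any partial isomorphism, then all can be added to one:
  -- induction on the finite set `x`.
  have extend : ∀ x : K₀, ¬ HFSig.atm x → (∀ a, a ∈ₕ x → Ext a) → ∀ s, IsPartialIso (R s) →
      ∃ s', IsPartialIso (R s') ∧ (∀ x y, R s x y → R s' x y) ∧ ∀ a, a ∈ₕ x → ∃ b, R s' a b := by
    refine HFModel.set_induction D (fun x : K₀ => (∀ a : K₀, a ∈ₕ x → Ext a) → ∀ s : S,
      IsPartialIso (R s) → ∃ s' : S, IsPartialIso (R s') ∧
        (∀ (x : K₀) (y : K₁), R s x y → R s' x y) ∧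
        ∀ a : K₀, a ∈ₕ x → ∃ b, R s' a b) ?_ ?_
    · intro x _ hx _ s hs
      exact ⟨s, hs, fun _ _ h => h, fun a ha => (hx a ha).elim⟩
    · intro x y z _ _ hz ih hE s hs
      obtain ⟨s₁, hs₁, hss₁, h1⟩ := ih (fun a ha => hE a ((hz a).mpr (Or.inl ha))) s hs
      obtain ⟨s₂, hs₂, hss₂, b, h2⟩ := hE y ((hz y).mpr (Or.inr rfl)) s₁ hs₁
      refine ⟨s₂, hs₂, fun x y h => hss₂ _ _ (hss₁ _ _ h), fun a ha => ?_⟩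
      rcases (hz a).mp ha with ha | rfl
      · obtain ⟨b', hb'⟩ := h1 a ha
        exact ⟨b', hss₂ _ _ hb'⟩
      · exact ⟨b, h2⟩
  refine HFModel.ind (D := D) Ext hExt ?_ a s hs
  intro a ih s hs
  by_cases ha : HFSig.atm a
  · by_cases had : ∃ b, R s a b
    · exact ⟨s, hs, fun _ _ h => h, had⟩
    have had' : ∀ b, ¬ R s a b := fun b hb => had ⟨b, hb⟩
    obtain ⟨b, hb, hlt⟩ := hs.exists_atom D ha had'
    obtain ⟨s', hs'⟩ := hadj s a b
    refine ⟨s', hs.adjoin D hs' had' (fun x hx => ?_) hlt (iff_of_true ha hb)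
      (fun x hx => (h₀.atoms_empty a ha x hx).elim) (fun x hx => (h₁.atoms_empty b hb x hx).elim),
      fun x y h => (hs' x y).mpr (Or.inl h), b, (hs' a b).mpr (Or.inr ⟨rfl, rfl⟩)⟩
    -- The atom `b` is new: if it were the image of `x`, then `x` would be an atom different from
    -- `a`, and its comparison with `a` would give `b < b`.
    have hxatm := (hs.atm_iff _ _ hx).mpr hb
    have hnlt := h₁.irrefl b hb
    rcases h₀.total a x ha hxatm with h | rfl | h
    · exact hnlt ((hlt _ _ hx).1.mp h)
    · exact had' _ hx
    · exact hnlt ((hlt _ _ hx).2.mp h)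
  · obtain ⟨s₁, hs₁, hss₁, hdom⟩ := extend a ha ih s hs
    by_cases had : ∃ b, R s₁ a b
    · exact ⟨s₁, hs₁, hss₁, had⟩
    have had' : ∀ b, ¬ R s₁ a b := fun b hb => had ⟨b, hb⟩
    obtain ⟨b, hb, hbmem⟩ := IsPartialIso.exists_image R hR a ha s₁ hs₁
    obtain ⟨s', hs'⟩ := hadj s₁ a b
    refine ⟨s', hs₁.adjoin D hs' had' (fun x hx => ?_) (fun x y _ => ?_) (iff_of_false ha hb)
      (fun x hx => ?_) (fun y hy => (hbmem y).mp hy),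
      fun x y h => (hs' x y).mpr (Or.inl (hss₁ x y h)), b, (hs' a b).mpr (Or.inr ⟨rfl, rfl⟩)⟩
    -- The set `b` is new: if it were the image of `x`, then `x` would have the same elements as
    -- `a`, so `x = a` by extensionality, although `a` is not in the domain.
    · have hxatm : ¬ HFSig.atm x := fun h => hb ((hs₁.atm_iff _ _ hx).mp h)
      refine had ⟨b, ?_⟩
      rwa [h₀.ext a x ha hxatm fun z => ?_]
      constructor
      · intro hz
        obtain ⟨c, hc⟩ := hdom z hz
        exact (hs₁.mem_iff hx hc).mpr ((hbmem c).mpr ⟨z, hz, hc⟩)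
      · intro hz
        obtain ⟨c, hc, hzc⟩ := hs₁.left _ _ hx z hz
        obtain ⟨z', hz', hzc'⟩ := (hbmem c).mp hc
        rwa [(hs₁.eq_iff _ _ hzc _ _ hzc').mpr rfl]
    · exact ⟨iff_of_false (fun h => ha (h₀.lt_atm _ _ h).1) (fun h => hb (h₁.lt_atm _ _ h).1),
        iff_of_false (fun h => ha (h₀.lt_atm _ _ h).2) (fun h => hb (h₁.lt_atm _ _ h).2)⟩
    · obtain ⟨c, hc⟩ := hdom x hx
      exact ⟨c, (hbmem c).mpr ⟨x, hx, hc⟩, hc⟩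

end

end Definiteness

namespace Definiteness

open FirstOrder FirstOrder.Language

set_option synthInstance.maxSize 100000
set_option synthInstance.maxHeartbeats 400000

/-! ### Back and forth and elementary equivalence -/

/-- Induction on formulas, where the extension properties carry the quantifier case. The family `I`
is external, so this holds for formulas of the actual language without any definability condition.
-/
theorem realize_iff_of_backAndForth {L : FirstOrder.Language.{0, 0}} [L.IsRelational]
    {K₀ K₁ : Type u} [L.Structure K₀] [L.Structure K₁] (I : (K₀ → K₁ → Prop) → Prop)
    (eq_iff : ∀ R, I R → ∀ a b a' b', R a b → R a' b' → (a = a' ↔ b = b'))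
    (rel_iff : ∀ R, I R → ∀ n (r : L.Relations n) (v : Fin n → K₀) (w : Fin n → K₁),
      (∀ i, R (v i) (w i)) → (Structure.RelMap r v ↔ Structure.RelMap r w))
    (forth : ∀ R, I R → ∀ a, ∃ R', I R' ∧ (∀ x y, R x y → R' x y) ∧ ∃ b, R' a b)
    (back : ∀ R, I R → ∀ b, ∃ R', I R' ∧ (∀ x y, R x y → R' x y) ∧ ∃ a, R' a b)
    {n : ℕ} (φ : L.BoundedFormula Empty n) :
    ∀ R, I R → ∀ (v : Fin n → K₀) (w : Fin n → K₁), (∀ i, R (v i) (w i)) →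
      (φ.Realize default v ↔ φ.Realize default w) := by
  have hterm : ∀ {n : ℕ} (R : K₀ → K₁ → Prop) (v : Fin n → K₀) (w : Fin n → K₁),
      (∀ i, R (v i) (w i)) → ∀ t : L.Term (Empty ⊕ Fin n),
      R (t.realize (Sum.elim default v)) (t.realize (Sum.elim default w)) := by
    intro n R v w h t
    cases t with
    | var i =>
      rcases i with i | i
      · exact i.elim
      · exact h i
    | func f _ => exact isEmptyElim f
  induction φ with
  | falsum => exact fun _ _ _ _ _ => Iff.rfl
  | equal t s => exact fun R hR v w h => eq_iff R hR _ _ _ _ (hterm R v w h t) (hterm R v w h s)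
  | rel r ts => exact fun R hR v w h => rel_iff R hR _ r _ _ fun i => hterm R v w h (ts i)
  | imp φ ψ ih ih' => exact fun R hR v w h => imp_congr (ih R hR v w h) (ih' R hR v w h)
  | all φ ih =>
    intro R hR v w h
    have snoc : ∀ (R' : K₀ → K₁ → Prop) (a : K₀) (b : K₁), (∀ x y, R x y → R' x y) → R' a b →
        ∀ i, R' (Fin.snoc (α := fun _ => K₀) v a i) (Fin.snoc (α := fun _ => K₁) w b i) := by
      intro R' a b hR' hab i
      refine Fin.lastCases ?_ (fun j => ?_) i
      · simpa using hab
      · simpa using hR' _ _ (h j)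
    simp only [BoundedFormula.realize_all]
    constructor
    · intro H b
      obtain ⟨R', hI, hR', a, hab⟩ := back R hR b
      exact (ih R' hI _ _ (snoc R' a b hR' hab)).mp (H a)
    · intro H a
      obtain ⟨R', hI, hR', b, hab⟩ := forth R hR a
      exact (ih R' hI _ _ (snoc R' a b hR' hab)).mpr (H b)

/-! ### Inner models as definable sorts -/

/-- The definable relations are exactly the classes. -/
structure Definability.IsClasses {M : Type u} (D : Definability M) (X : Classes M) : Prop where
  mem : ∀ n (s : Set (Fin n → M)), D.dfn s → s ∈ X n
  dfn : ∀ n (s : Set (Fin n → M)), s ∈ X n → D.dfn s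

/-- Comprehension makes definable relations classes; conversely each class has a relation symbol in
`classLang X`. -/
theorem Definability.isClasses_ofLanguage {L : FirstOrder.Language.{0, 0}} {M : Type u}
    [L.Structure M] {X : Classes M} {A : Set M}
    (h : ∀ (n : ℕ) (s : Set (Fin n → M)), A.Definable (L.sum (classLang X)) s → s ∈ X n) :
    (Definability.ofLanguage (L.sum (classLang X)) A).IsClasses X where
  mem := h
  dfn n s hs := by
    refine Set.Definable.mono (A := ∅) ?_ (Set.empty_subset A)
    rw [Set.empty_definable_iff]
    refine ⟨Relations.formula (L := L.sum (classLang X)) (n := n)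
      (Sum.inr (⟨s, hs⟩ : X n) : (L.sum (classLang X)).Relations n) Term.var, ?_⟩
    ext v
    rfl

/-- The relation of a relational structure is definable. -/
theorem Definability.dfn_ofLanguage {L : FirstOrder.Language.{0, 0}} {M : Type u}
    [L.Structure M] (X : Classes M) (A : Set M) {n : ℕ} (r : L.Relations n) :
    (Definability.ofLanguage (L.sum (classLang X)) A).dfn
      {v : Fin n → M | Structure.RelMap r v} := by
  refine Set.Definable.mono (A := ∅) ?_ (Set.empty_subset A)
  rw [Set.empty_definable_iff]
  refine ⟨Relations.formula (L := L.sum (classLang X)) (n := n)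
    (Sum.inl r : (L.sum (classLang X)).Relations n) Term.var, ?_⟩
  ext v
  rfl

theorem defRel_base {M : Type u} {D : Definability M} (r : M → M → Prop)
    (h : D.dfn {v : Fin 2 → M | r (v 0) (v 1)}) : DefRel D r := by
  refine ⟨⟨?_⟩⟩
  refine (congrArg D.dfn (Set.ext fun v => ?_)).mp
    (D.preimage (![Sum.inl (), Sum.inr ()] : Fin 2 → Unit ⊕ Unit) h)
  constructor
  · exact fun h => ⟨(_, _), ⟨rfl, rfl⟩, h⟩
  · rintro ⟨⟨a, b⟩, ⟨h1, h2⟩, h⟩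
    obtain rfl : _ = a := h1
    obtain rfl : _ = b := h2
    exact h

/-- A scheme is instantiated for all letters at once. The letters other than the relevant one are
read as the full relations, which are classes. -/
theorem exists_letters {M : Type u} {D : Definability M} {X : Classes M} (hD : D.IsClasses X)
    {m : ℕ} {s : Set (Fin m → M)} (hs : s ∈ X m) :
    ∃ P : ∀ n, Set (Fin n → M), (∀ n, P n ∈ X n) ∧ P m = s := by
  refine ⟨Function.update (fun _ => Set.univ) m s, fun n => ?_, by simp⟩
  by_cases h : n = m
  · subst h
    simpa using hs
  · simpa [h] using hD.mem n _ D.univ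

namespace InnerModel

variable {M : Type u} {D : Definability M} {X : Classes M} {L : FirstOrder.Language.{0, 0}}
  (N : InnerModel L M)

/-- The carrier of an inner model is a definable sort. -/
abbrev coded (hD : D.IsClasses X) (hN : N.IsIn X) : Coded D N.Carrier where
  Index := Unit
  fin := inferInstance
  IsCode v t := ∃ h : v () ∈ N.dom, Quotient.mk N.setoid ⟨v (), h⟩ = t
  unique := by
    rintro v t t' ⟨_, h⟩ ⟨_, h'⟩
    exact h.symm.trans h'
  surj t := by
    obtain ⟨x, rfl⟩ := Quotient.exists_rep t
    exact ⟨fun _ => x, x.2, rfl⟩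
  dfn_eq := by
    convert D.preimage (![Sum.inl (), Sum.inr ()] : Fin 2 → Unit ⊕ Unit) (hD.dfn _ _ hN.2.1)
      using 1
    ext v
    have e : v ∘ ![Sum.inl (), Sum.inr ()] = ![v (Sum.inl ()), v (Sum.inr ())] := by
      funext i
      fin_cases i <;> rfl
    rw [Set.mem_preimage, e]
    constructor
    · rintro ⟨t, ⟨h, rfl⟩, ⟨h', he⟩⟩
      exact Quotient.exact he.symm
    · intro h
      obtain ⟨h1, h2⟩ := N.eq_dom _ _ h
      exact ⟨Quotient.mk N.setoid ⟨_, h1⟩, ⟨h1, rfl⟩, h2, (Quotient.sound h : _ = _).symm⟩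

/-- The element `x` of `M` represents the element `a` of the carrier of the inner model. -/
def Represents (x : M) (a : N.Carrier) : Prop :=
  ∃ h : x ∈ N.dom, Quotient.mk N.setoid ⟨x, h⟩ = a

theorem defRel_represents (hD : D.IsClasses X) (hN : N.IsIn X) :
    letI := N.coded hD hN
    DefRel D N.Represents := by
  let _ := N.coded hD hN
  refine ⟨⟨?_⟩⟩
  refine (congrArg D.dfn (Set.ext fun v => ?_)).mp (Coded.dfn_eq (D := D) (T := N.Carrier))
  constructor
  · rintro ⟨t, h, h'⟩
    exact ⟨(v (Sum.inl ()), t), ⟨rfl, h'⟩, h⟩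
  · rintro ⟨⟨x, t⟩, ⟨h, h'⟩, h''⟩
    obtain rfl : _ = x := h
    exact ⟨t, h'', h'⟩

/-- The class consists of all representatives of elements satisfying `p`; it is invariant under the
equality of `N`, so its trace is `p` again. -/
theorem exists_class₁ (hD : D.IsClasses X) (hN : N.IsIn X) (p : N.Carrier → Prop)
    (hp : letI := N.coded hD hN; Def D p) : ∃ s ∈ X 1, ∀ x, ![x] ∈ N.trace s ↔ p x := by
  let _ := N.coded hD hN
  refine ⟨_, hD.mem 1 _ (D.preimage (fun _ : Unit => (0 : Fin 1)) hp.out), fun x => ?_⟩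
  constructor
  · rintro ⟨w, ⟨t, ⟨h, rfl⟩, ht⟩, hw⟩
    rwa [← show _ = x from hw 0]
  · intro h
    obtain ⟨y, rfl⟩ := Quotient.exists_rep x
    refine ⟨fun _ => y, ⟨_, ⟨y.2, rfl⟩, h⟩, fun i => ?_⟩
    fin_cases i
    rfl

theorem exists_class₃ (hD : D.IsClasses X) (hN : N.IsIn X)
    (p : N.Carrier → N.Carrier → N.Carrier → Prop)
    (hp : letI := N.coded hD hN; Def D fun x : N.Carrier × N.Carrier × N.Carrier =>
      p x.1 x.2.1 x.2.2) : ∃ s ∈ X 3, ∀ x y z, ![x, y, z] ∈ N.trace s ↔ p x y z := by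
  let _ := N.coded hD hN
  refine ⟨_, hD.mem 3 _ (D.preimage (Sum.elim (fun _ => 0) (Sum.elim (fun _ => 1) fun _ => 2) :
    Unit ⊕ (Unit ⊕ Unit) → Fin 3) hp.out), fun x y z => ?_⟩
  constructor
  · rintro ⟨w, ⟨⟨_, _, _⟩, ⟨⟨h1, rfl⟩, ⟨h2, rfl⟩, ⟨h3, rfl⟩⟩, ht⟩, hw⟩
    rwa [← show _ = x from hw 0, ← show _ = y from hw 1, ← show _ = z from hw 2]
  · intro h
    obtain ⟨x, rfl⟩ := Quotient.exists_rep x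
    obtain ⟨y, rfl⟩ := Quotient.exists_rep y
    obtain ⟨z, rfl⟩ := Quotient.exists_rep z
    refine ⟨![x, y, z], ⟨(_, _, _), ⟨⟨x.2, rfl⟩, ⟨y.2, rfl⟩, ⟨z.2, rfl⟩⟩, h⟩, fun i => ?_⟩
    fin_cases i <;> rfl

variable [L.IsRelational]

theorem rel₁_mk (r : L.Relations 1) {a : M} (ha : a ∈ N.dom) :
    rel₁ N.Carrier r (Quotient.mk N.setoid ⟨a, ha⟩) ↔ ![a] ∈ N.rel r := by
  constructor
  · rintro ⟨w, h, h'⟩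
    refine N.rel_congr r _ _ (fun i => ?_) h
    fin_cases i
    exact Quotient.exact (h' 0)
  · intro h
    refine ⟨fun _ => ⟨a, ha⟩, ?_, fun i => ?_⟩
    · convert h using 1
      funext i
      fin_cases i
      rfl
    · fin_cases i
      rfl

theorem rel₂_mk (r : L.Relations 2) {a b : M} (ha : a ∈ N.dom) (hb : b ∈ N.dom) :
    rel₂ N.Carrier r (Quotient.mk N.setoid ⟨a, ha⟩) (Quotient.mk N.setoid ⟨b, hb⟩) ↔
      ![a, b] ∈ N.rel r := by
  constructor
  · rintro ⟨w, h, h'⟩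
    refine N.rel_congr r _ _ (fun i => ?_) h
    fin_cases i
    · exact Quotient.exact (h' 0)
    · exact Quotient.exact (h' 1)
  · intro h
    refine ⟨![⟨a, ha⟩, ⟨b, hb⟩], ?_, fun i => ?_⟩
    · convert h using 1
      funext i
      fin_cases i <;> rfl
    · fin_cases i <;> rfl

theorem def_rel₁ (hD : D.IsClasses X) (hN : N.IsIn X) (r : L.Relations 1) :
    letI := N.coded hD hN
    Def D (rel₁ N.Carrier r) := by
  let _ := N.coded hD hN
  refine ⟨?_⟩
  refine (congrArg D.dfn (Set.ext fun v => ?_)).mp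
    (D.preimage (![()] : Fin 1 → Unit) (hD.dfn _ _ (hN.2.2 1 r)))
  have e : v ∘ ![()] = ![v ()] := by
    funext i
    fin_cases i
    rfl
  rw [Set.mem_preimage, e]
  constructor
  · intro h
    have h0 : v () ∈ N.dom := N.rel_dom r _ h 0
    exact ⟨Quotient.mk N.setoid ⟨_, h0⟩, ⟨h0, rfl⟩, (N.rel₁_mk r h0).mpr h⟩
  · rintro ⟨_, ⟨h0, rfl⟩, h⟩
    exact (N.rel₁_mk r h0).mp h

theorem defRel_rel₂ (hD : D.IsClasses X) (hN : N.IsIn X) (r : L.Relations 2) :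
    letI := N.coded hD hN
    DefRel D (rel₂ N.Carrier r) := by
  let _ := N.coded hD hN
  refine ⟨⟨?_⟩⟩
  refine (congrArg D.dfn (Set.ext fun v => ?_)).mp
    (D.preimage (![Sum.inl (), Sum.inr ()] : Fin 2 → Unit ⊕ Unit) (hD.dfn _ _ (hN.2.2 2 r)))
  have e : v ∘ ![Sum.inl (), Sum.inr ()] = ![v (Sum.inl ()), v (Sum.inr ())] := by
    funext i
    fin_cases i <;> rfl
  rw [Set.mem_preimage, e]
  constructor
  · intro h
    have h0 : v (Sum.inl ()) ∈ N.dom := N.rel_dom r _ h 0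
    have h1 : v (Sum.inr ()) ∈ N.dom := N.rel_dom r _ h 1
    exact ⟨(Quotient.mk N.setoid ⟨_, h0⟩, Quotient.mk N.setoid ⟨_, h1⟩),
      ⟨⟨h0, rfl⟩, ⟨h1, rfl⟩⟩, (N.rel₂_mk r h0 h1).mpr h⟩
  · rintro ⟨⟨_, _⟩, ⟨⟨h0, rfl⟩, ⟨h1, rfl⟩⟩, h⟩
    exact (N.rel₂_mk r h0 h1).mp h

end InnerModel

instance (N : InnerModel hfLang M) : HFSig N.Carrier where
  mem := rel₂ N.Carrier hfMem
  lt := rel₂ N.Carrier hfLt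
  atm := rel₁ N.Carrier hfAtom

/-- Every definable relation on the carrier is the trace of a class, so strong satisfaction yields
the schemes for all definable relations, including those that also speak about `M` or another inner
model. -/
theorem InnerModel.hfModel {M : Type u} {D : Definability M} {X : Classes M}
    (N : InnerModel hfLang M) (hD : D.IsClasses X) (hN : N.IsIn X)
    (h : N.IsStrongModel X HFDLO) :
    letI := N.coded hD hN
    HFModel D N.Carrier := by
  let _ := N.coded hD hN
  refine ⟨N.defRel_rel₂ hD hN _, N.defRel_rel₂ hD hN _, N.def_rel₁ hD hN _, ?_, ?_, ?_⟩
  · intro P hP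
    obtain ⟨s, hs, hs'⟩ := N.exists_class₃ hD hN P hP
    obtain ⟨Q, hQ, rfl⟩ := exists_letters hD hs
    have := ((HFDLO_holdsAt_iff _).mp (h Q hQ)).1
    simp only [hs'] at this
    exact this
  · intro P hP
    obtain ⟨s, hs, hs'⟩ := N.exists_class₁ hD hN P hP
    obtain ⟨Q, hQ, rfl⟩ := exists_letters hD hs
    have := ((HFDLO_holdsAt_iff _).mp (h Q hQ)).2.1
    simp only [hs'] at this
    exact this
  · exact ((HFDLO_holdsAt_iff _).mp (h _ fun n => hD.mem n _ D.univ)).2.2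

/-! ### Finite sets of pairs in adjunctive set theory -/

section

variable {K : Type*} (mem : K → K → Prop)

/-- `z` is a Kuratowski pair of `x` and `y`, without extensionality. -/
def IsWeakPair (z x y : K) : Prop :=
  (∃ w, mem w z ∧ IsPair mem w x x) ∧ (∃ w, mem w z ∧ IsPair mem w x y) ∧
    ∀ w, mem w z → IsPair mem w x x ∨ IsPair mem w x y

variable {mem}

theorem IsPair.unique {w x y x' y' : K} (h : IsPair mem w x y) (h' : IsPair mem w x' y') :
    (x = x' ∧ y = y') ∨ (x = y' ∧ y = x') := by
  have h1 := (h' x).mp ((h x).mpr (Or.inl rfl))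
  have h2 := (h' y).mp ((h y).mpr (Or.inr rfl))
  have h3 := (h x').mp ((h' x').mpr (Or.inl rfl))
  have h4 := (h y').mp ((h' y').mpr (Or.inr rfl))
  grind

/-- Without extensionality there may be many sets with the elements `x` and `y`. The components are
therefore recovered from the elements of the elements of `z`, never from the identity of those sets.
-/
theorem IsWeakPair.unique {z x y x' y' : K} (h : IsWeakPair mem z x y)
    (h' : IsWeakPair mem z x' y') : x = x' ∧ y = y' := by
  obtain ⟨⟨w, hw, hwx⟩, ⟨v, hv, hvx⟩, hall⟩ := h
  obtain ⟨⟨w', hw', hwx'⟩, ⟨v', hv', hvx'⟩, hall'⟩ := h'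
  have h1 := (hall' w hw).imp hwx.unique hwx.unique
  have h2 := (hall' v hv).imp hvx.unique hvx.unique
  have h3 := (hall v' hv').imp hvx'.unique hvx'.unique
  grind

theorem exists_isWeakPair (empty : ∃ x, ∀ y, ¬ mem y x)
    (adj : ∀ x y, ∃ z, IsAdjunction mem z x y) (x y : K) : ∃ z, IsWeakPair mem z x y := by
  obtain ⟨e, he⟩ := empty
  obtain ⟨a, ha⟩ := adj e x
  obtain ⟨b, hb⟩ := adj a y
  obtain ⟨c, hc⟩ := adj e a
  obtain ⟨d, hd⟩ := adj c b
  have ha' : IsPair mem a x x := fun w => by simp [ha w, he]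
  have hb' : IsPair mem b x y := fun w => by simp [hb w, ha w, he]
  have hd' : ∀ w, mem w d ↔ w = a ∨ w = b := fun w => by simp [hd w, hc w, he]
  refine ⟨d, ⟨a, (hd' a).mpr (Or.inl rfl), ha'⟩, ⟨b, (hd' b).mpr (Or.inr rfl), hb'⟩, ?_⟩
  intro w hw
  rcases (hd' w).mp hw with rfl | rfl
  · exact Or.inl ha'
  · exact Or.inr hb'

end

end Definiteness

namespace Definiteness

open FirstOrder FirstOrder.Language

set_option synthInstance.maxSize 100000
set_option synthInstance.maxHeartbeats 400000

/-! ### Standalone completeness of `HF(DLO)` -/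

/-- The symbol `∈` of the language of set theory. -/
def setMem : setLang.Relations 2 := SetRel.mem

/-- A relation between two models that is coded by an element `s` of a model of adjunctive set
theory. -/
def CodedRel {M K₀ K₁ : Type u} (mem : M → M → Prop) (rep₀ : M → K₀ → Prop) (rep₁ : M → K₁ → Prop)
    (s : M) (a : K₀) (b : K₁) : Prop :=
  ∃ z : M, mem z s ∧ ∃ x y : M, rep₀ x a ∧ rep₁ y b ∧ IsWeakPair mem z x y

instance IsWeakPair.def {M Γ K : Type u} {D : Definability M} [Coded D Γ] [Coded D K]
    (mem : K → K → Prop) [DefRel D mem] (f g h : Γ → K) [DefMap D f] [DefMap D g] [DefMap D h] :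
    Def D fun x => IsWeakPair mem (f x) (g x) (h x) :=
  Def.comp₃ (by unfold IsWeakPair; infer_instance) f g h

/-- Add to `s` a weak pair of representatives. It determines both representatives, and these
determine the elements of the models, so nothing but the intended pair is added. -/
theorem CodedRel.exists_adjunction {M K₀ K₁ : Type u} {mem : M → M → Prop}
    {rep₀ : M → K₀ → Prop} {rep₁ : M → K₁ → Prop}
    (empty : ∃ x, ∀ y, ¬ mem y x) (adj : ∀ x y, ∃ z, IsAdjunction mem z x y)
    (surj₀ : ∀ a, ∃ x, rep₀ x a) (surj₁ : ∀ a, ∃ x, rep₁ x a)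
    (unique₀ : ∀ x a a', rep₀ x a → rep₀ x a' → a = a')
    (unique₁ : ∀ x a a', rep₁ x a → rep₁ x a' → a = a') (s : M) (a : K₀) (b : K₁) :
    ∃ s', ∀ a' b', CodedRel mem rep₀ rep₁ s' a' b' ↔
      CodedRel mem rep₀ rep₁ s a' b' ∨ (a' = a ∧ b' = b) := by
  obtain ⟨x, hx⟩ := surj₀ a
  obtain ⟨y, hy⟩ := surj₁ b
  obtain ⟨z, hz⟩ := exists_isWeakPair empty adj x y
  obtain ⟨s', hs'⟩ := adj s z
  refine ⟨s', fun a' b' => ⟨?_, ?_⟩⟩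
  · rintro ⟨z', hz', x', y', hx', hy', h'⟩
    rcases (hs' z').mp hz' with h | rfl
    · exact Or.inl ⟨z', h, x', y', hx', hy', h'⟩
    · obtain ⟨rfl, rfl⟩ := hz.unique h'
      exact Or.inr ⟨unique₀ _ _ _ hx' hx, unique₁ _ _ _ hy' hy⟩
  · rintro (⟨z', hz', h⟩ | ⟨rfl, rfl⟩)
    · exact ⟨z', (hs' z').mpr (Or.inl hz'), h⟩
    · exact ⟨z, (hs' z).mpr (Or.inr rfl), x, y, hx, hy, hz⟩

theorem AS_holds {M : Type u} [setLang.Structure M] {X : Classes M} (h : Satisfies AS M X)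
    (hX : ∀ n, (X n).Nonempty) :
    (∃ x, ∀ y, ¬ rel₂ M setMem y x) ∧
      ∀ x y, ∃ z, IsAdjunction (rel₂ M setMem) z x y := by
  choose P hP using hX
  let _ := lettersStructure P
  have hm (x y : M) : rel₂ M elt x y ↔ rel₂ M setMem x y := Iff.rfl
  have h₁ := h _ (Or.inl rfl) P hP
  have h₂ := h _ (Or.inr rfl) P hP
  simp only [Scheme.HoldsAt, Sentence.Realize, Formula.Realize, BoundedFormula.realize_ex,
    BoundedFormula.realize_all, realize_isEmptyF, realize_isAdjunctionF] at h₁ h₂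
  exact ⟨h₁, h₂⟩

/-- The back-and-forth system consists of all partial isomorphisms coded by elements of `M`.
Definability is here without parameters from `M`, with classes allowed. -/
theorem standaloneCompleteIn_HFDLO_AS : StandaloneCompleteIn.{u} HFDLO AS := by
  intro M _ X hX N₀ N₁ hN₀ hN₁ h₀ h₁
  have hD := Definability.isClasses_ofLanguage hX.1
  set D := Definability.ofLanguage (setLang.sum (classLang X)) (∅ : Set M)
  obtain ⟨hempty, hadj⟩ := AS_holds hX.2 fun n => ⟨_, hD.mem n _ D.univ⟩
  set E := rel₂ M setMem
  have hE : DefRel D E := defRel_base E (by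
    convert Definability.dfn_ofLanguage X (∅ : Set M) setMem using 3
      with v
    have : ![v 0, v 1] = v := by
      funext i
      fin_cases i <;> rfl
    rw [← this]
    rfl)
  let _ := N₀.coded hD hN₀
  let _ := N₁.coded hD hN₁
  have := N₀.hfModel hD hN₀ h₀
  have := N₁.hfModel hD hN₁ h₁
  have := N₀.defRel_represents hD hN₀
  have := N₁.defRel_represents hD hN₁
  have surj : ∀ (N : InnerModel hfLang M) (a : N.Carrier), ∃ x, N.Represents x a := by
    intro N a
    obtain ⟨x, rfl⟩ := Quotient.exists_rep a
    exact ⟨x, x.2, rfl⟩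
  have unique : ∀ (N : InnerModel hfLang M) (x : M) (a a' : N.Carrier), N.Represents x a →
      N.Represents x a' → a = a' := by
    rintro N x a a' ⟨_, h⟩ ⟨_, h'⟩
    exact h.symm.trans h'
  let R : M → N₀.Carrier → N₁.Carrier → Prop := CodedRel E N₀.Represents N₁.Represents
  have hR : Def D fun x : M × N₀.Carrier × N₁.Carrier => R x.1 x.2.1 x.2.2 := by
    unfold R CodedRel
    infer_instance
  have hR' : Def D fun x : M × N₁.Carrier × N₀.Carrier => R x.1 x.2.2 x.2.1 := by
    unfold R CodedRel
    infer_instance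
  have adjR := CodedRel.exists_adjunction (rep₀ := N₀.Represents) (rep₁ := N₁.Represents)
    hempty hadj (surj N₀) (surj N₁) (unique N₀) (unique N₁)
  obtain ⟨e, he⟩ := hempty
  have hRe : IsPartialIso (R e) := by
    have hRe : ∀ a b, ¬ R e a b := fun a b ⟨z, hz, _⟩ => he z hz
    obtain ⟨d₀, -, hd₀⟩ := HFModel.exists_empty D N₀.Carrier
    obtain ⟨d₁, -, hd₁⟩ := HFModel.exists_empty D N₁.Carrier
    exact ⟨fun _ _ h => (hRe _ _ h).elim, fun _ _ h => (hRe _ _ h).elim,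
      fun _ _ h => (hRe _ _ h).elim, fun _ _ h => (hRe _ _ h).elim,
      fun _ _ h => (hRe _ _ h).elim, ⟨d₀, fun a => iff_of_false (hd₀ a) fun ⟨_, h⟩ => hRe _ _ h⟩,
      ⟨d₁, fun a => iff_of_false (hd₁ a) fun ⟨_, h⟩ => hRe _ _ h⟩⟩
  rw [elementarilyEquivalent_iff]
  intro φ
  refine realize_iff_of_backAndForth (fun Q => ∃ s, Q = R s ∧ IsPartialIso (R s)) ?_ ?_ ?_ ?_ φ
    (R e) ⟨e, rfl, hRe⟩ _ _ (fun i => i.elim0)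
  · rintro _ ⟨s, rfl, hs⟩ a b a' b' h h'
    exact hs.eq_iff _ _ h _ _ h'
  · rintro _ ⟨s, rfl, hs⟩ n r v w hvw
    cases r with
    | lt =>
      have e₀ : v = ![v 0, v 1] := by
        funext i
        fin_cases i <;> rfl
      have e₁ : w = ![w 0, w 1] := by
        funext i
        fin_cases i <;> rfl
      rw [e₀, e₁]
      exact hs.lt_iff _ _ (hvw 0) _ _ (hvw 1)
    | mem =>
      have e₀ : v = ![v 0, v 1] := by
        funext i
        fin_cases i <;> rfl
      have e₁ : w = ![w 0, w 1] := by
        funext i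
        fin_cases i <;> rfl
      rw [e₀, e₁]
      exact hs.mem_iff (hvw 1) (hvw 0)
    | atom =>
      have e₀ : v = ![v 0] := by
        funext i
        fin_cases i
        rfl
      have e₁ : w = ![w 0] := by
        funext i
        fin_cases i
        rfl
      rw [e₀, e₁]
      exact hs.atm_iff _ _ (hvw 0)
  · rintro _ ⟨s, rfl, hs⟩ a
    obtain ⟨s', hs', hss', h⟩ := IsPartialIso.forth R hR adjR a s hs
    exact ⟨_, ⟨s', rfl, hs'⟩, hss', h⟩
  · rintro _ ⟨s, rfl, hs⟩ b
    -- The back property is the forth property of the converse relations, under the same codes.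
    obtain ⟨s', hs', hss', h⟩ := IsPartialIso.forth (fun s b a => R s a b) hR'
      (fun s b a => (adjR s a b).imp fun s' hs' x y => (hs' y x).trans (or_congr_right and_comm))
      b s hs.flip
    exact ⟨_, ⟨s', rfl, hs'.flip⟩, fun x y => hss' y x, h⟩

end Definiteness

namespace Definiteness

open FirstOrder FirstOrder.Language

set_option synthInstance.maxSize 100000
set_option synthInstance.maxHeartbeats 400000

/-! ### Models of set theory with definable classes -/

theorem DefMap.comp₂ {M : Type u} {D : Definability M} {Γ Δ Ξ T : Type u} [Coded D Γ] [Coded D Δ]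
    [Coded D Ξ] [Coded D T] {F : Δ → Ξ → T} (hF : DefMap D fun x : Δ × Ξ => F x.1 x.2) (f : Γ → Δ)
    (h : Γ → Ξ) [DefMap D f] [DefMap D h] : DefMap D fun g => F (f g) (h g) :=
  hF.comp (DefMap.pair f h)

/-- `V` is a model of Zermelo-Fraenkel set theory with the schemes for all definable relations,
where all elements of `V` are allowed as parameters. -/
class SetModel (V : Type u) extends Membership V V where
  definability : Definability V
  def_mem : Def definability fun x : V × V => x.1 ∈ x.2
  def_const : ∀ c : V, Def definability fun x : V => c = x
  ext : ∀ x y : V, (∀ z, z ∈ x ↔ z ∈ y) → x = y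
  found : ∀ x : V, (∃ y, y ∈ x) → ∃ y ∈ x, ∀ z ∈ y, z ∉ x
  pair : ∀ x y : V, ∃ z : V, ∀ w, w ∈ z ↔ w = x ∨ w = y
  union : ∀ x : V, ∃ y : V, ∀ z, z ∈ y ↔ ∃ w ∈ x, z ∈ w
  pow : ∀ x : V, ∃ y : V, ∀ z, z ∈ y ↔ ∀ w ∈ z, w ∈ x
  inf : ∃ x : V, (∃ e ∈ x, ∀ z, z ∉ e) ∧ ∀ y ∈ x, ∃ z ∈ x, ∀ w, w ∈ z ↔ w ∈ y ∨ w = y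
  sep : ∀ p : V → Prop, Def definability p → ∀ x : V, ∃ y : V, ∀ z, z ∈ y ↔ z ∈ x ∧ p z
  repl : ∀ r : V → V → Prop, Def definability (fun x : V × V => r x.1 x.2) → ∀ x : V,
    (∀ z ∈ x, ∃ y, ∀ y', r z y' ↔ y' = y) → ∃ u : V, ∀ y, y ∈ u ↔ ∃ z ∈ x, r z y

namespace SetModel

/-- The definable classes of a model of set theory. -/
abbrev dfn (V : Type u) [SetModel V] : Definability V := definability

variable {V : Type u} [SetModel V] {Γ : Type u} [Coded (dfn V) Γ]

instance mem_def (f g : Γ → V) [DefMap (dfn V) f] [DefMap (dfn V) g] : Def (dfn V) fun x => f x ∈ g x :=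
  def_mem.comp₂ (q := fun a b : V => a ∈ b) f g

instance const_def (c : V) : DefMap (dfn V) fun _ : Γ => c :=
  ⟨(def_const c).coord (IsCoord.snd IsCoord.id)⟩

instance : HasSubset V := ⟨fun x y => ∀ z ∈ x, z ∈ y⟩

instance subset_def (f g : Γ → V) [DefMap (dfn V) f] [DefMap (dfn V) g] : Def (dfn V) fun x => f x ⊆ g x :=
  Def.comp₂ (q := fun a b : V => a ⊆ b)
    (inferInstance : Def (dfn V) fun x : V × V => ∀ z, z ∈ x.1 → z ∈ x.2) f g

instance mem_def_const (a : V) : Def (dfn V) (Membership.mem a) := mem_def (fun x : V => x) fun _ => a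

instance subset_def_const (a : V) : Def (dfn V) (HasSubset.Subset a) :=
  subset_def (fun _ => a) fun x : V => x

theorem exists_sep (p : V → Prop) [h : Def (dfn V) p] (x : V) : ∃ y : V, ∀ z, z ∈ y ↔ z ∈ x ∧ p z :=
  sep p h x

/-! ### Basic set operations and the definability of their graphs. -/

theorem exists_empty : ∃ e : V, ∀ z, z ∉ e := by
  obtain ⟨x, ⟨e, -, he⟩, -⟩ := inf (V := V)
  exact ⟨e, he⟩

/-- The empty set. -/
noncomputable def empty : V := Classical.choose (exists_empty (V := V))

@[simp] theorem not_mem_empty (z : V) : z ∉ (empty : V) := Classical.choose_spec exists_empty z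

theorem eq_empty {x : V} (h : ∀ z, z ∉ x) : x = empty := ext _ _ fun z => by simp [h z]

theorem exists_adj (x y : V) : ∃ z : V, ∀ w, w ∈ z ↔ w ∈ x ∨ w = y := by
  obtain ⟨s, hs⟩ := pair y y
  obtain ⟨p, hp⟩ := pair x s
  obtain ⟨z, hz⟩ := union p
  refine ⟨z, fun w => ?_⟩
  simp [hz, hp, hs]

/-- `x ∪ {y}` -/
noncomputable def adj (x y : V) : V := Classical.choose (exists_adj x y)

@[simp] theorem mem_adj {x y w : V} : w ∈ adj x y ↔ w ∈ x ∨ w = y :=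
  Classical.choose_spec (exists_adj x y) w

theorem eq_adj {x y z : V} (h : ∀ w, w ∈ z ↔ w ∈ x ∨ w = y) : z = adj x y :=
  ext _ _ fun w => by simp [h w]

instance adj_def (f g : Γ → V) [DefMap (dfn V) f] [DefMap (dfn V) g] :
    DefMap (dfn V) fun x => adj (f x) (g x) := by
  refine DefMap.comp₂ ⟨?_⟩ f g
  exact (inferInstance : Def (dfn V) fun x : (V × V) × V =>
    ∀ w, w ∈ x.2 ↔ w ∈ x.1.1 ∨ w = x.1.2).congr fun x => ⟨fun h => (eq_adj h).symm, fun h w => by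
      simp [← h]⟩

/-- The power set. -/
noncomputable def powerset (x : V) : V := Classical.choose (pow x)

@[simp] theorem mem_powerset {x z : V} : z ∈ powerset x ↔ z ⊆ x :=
  Classical.choose_spec (pow x) z

instance powerset_def : DefMap (dfn V) (powerset : V → V) := by
  refine ⟨?_⟩
  exact (inferInstance : Def (dfn V) fun x : V × V => ∀ w, w ∈ x.2 ↔ w ⊆ x.1).congr
    fun x => ⟨fun h => ext _ _ fun w => by simp [h], fun h w => by simp [← h]⟩

instance powerset_def_comp (f : Γ → V) [DefMap (dfn V) f] :
    DefMap (dfn V) fun x => powerset (f x) :=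
  powerset_def.comp inferInstance

/-- `{x, y}` -/
noncomputable def upair (x y : V) : V := adj (adj empty x) y

@[simp] theorem mem_upair {x y w : V} : w ∈ upair x y ↔ w = x ∨ w = y := by simp [upair]

instance upair_def (f g : Γ → V) [DefMap (dfn V) f] [DefMap (dfn V) g] :
    DefMap (dfn V) fun x => upair (f x) (g x) := by
  unfold upair
  infer_instance

/-- The Kuratowski pair `{{x}, {x, y}}`. -/
noncomputable def opair (x y : V) : V := upair (upair x x) (upair x y)

@[simp] theorem mem_opair {x y w : V} : w ∈ opair x y ↔ w = upair x x ∨ w = upair x y := by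
  simp [opair]

instance opair_def (f g : Γ → V) [DefMap (dfn V) f] [DefMap (dfn V) g] :
    DefMap (dfn V) fun x => opair (f x) (g x) := by
  unfold opair
  infer_instance

theorem isPair_iff {z x y : V} : IsPair (· ∈ ·) z x y ↔ z = upair x y :=
  ⟨fun h => ext _ _ fun w => by simp [h w], fun h w => by simp [h]⟩

@[simp] theorem opair_inj {x y x' y' : V} : opair x y = opair x' y' ↔ x = x' ∧ y = y' := by
  refine ⟨fun h => ?_, fun h => by rw [h.1, h.2]⟩
  have hw : ∀ x y : V, IsWeakPair (· ∈ ·) (opair x y) x y := fun x y =>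
    ⟨⟨upair x x, by simp, isPair_iff.mpr rfl⟩, ⟨upair x y, by simp, isPair_iff.mpr rfl⟩,
      fun w hw => by simpa [isPair_iff] using hw⟩
  exact (hw x y).unique (h ▸ hw x' y')

theorem mem_irrefl (x : V) : x ∉ x := by
  intro h
  obtain ⟨y, hy, hy'⟩ := found (upair x x) ⟨x, by simp⟩
  obtain rfl : y = x := by simpa using hy
  exact hy' y h (by simp)

theorem mem_asymm {x y : V} (h : x ∈ y) : y ∉ x := by
  intro h'
  obtain ⟨z, hz, hz'⟩ := found (upair x y) ⟨x, by simp⟩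
  rcases mem_upair.mp hz with rfl | rfl
  · exact hz' y h' (by simp)
  · exact hz' x h (by simp)

/-! ### Natural numbers -/

theorem exists_naturals : ∃ n : V, ∀ x, x ∈ n ↔
    ∀ s : V, empty ∈ s → (∀ y ∈ s, adj y y ∈ s) → x ∈ s := by
  obtain ⟨i, ⟨e, hei, he⟩, hi⟩ := inf (V := V)
  obtain rfl := eq_empty he
  obtain ⟨n, hn⟩ := exists_sep (fun x : V => ∀ s : V, (empty : V) ∈ s → (∀ y, y ∈ s → adj y y ∈ s) →
    x ∈ s) i
  refine ⟨n, fun x => (hn x).trans ⟨And.right, fun h => ⟨h i hei fun y hy => ?_, h⟩⟩⟩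
  obtain ⟨z, hz, hz'⟩ := hi y hy
  rwa [← eq_adj hz']

variable (V) in
/-- The set of natural numbers. -/
noncomputable def naturals : V := Classical.choose (exists_naturals (V := V))

theorem mem_naturals {x : V} : x ∈ naturals V ↔
    ∀ s : V, empty ∈ s → (∀ y ∈ s, adj y y ∈ s) → x ∈ s :=
  Classical.choose_spec (exists_naturals (V := V)) x

@[simp] theorem empty_mem_naturals : (empty : V) ∈ naturals V := mem_naturals.mpr fun _ h _ => h

theorem succ_mem_naturals {n : V} (hn : n ∈ naturals V) : adj n n ∈ naturals V :=
  mem_naturals.mpr fun s h h' => h' _ (mem_naturals.mp hn s h h')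

theorem naturals_induction (p : V → Prop) [Def (dfn V) p] (zero : p empty)
    (succ : ∀ n ∈ naturals V, p n → p (adj n n)) : ∀ n ∈ naturals V, p n := by
  obtain ⟨s, hs⟩ := exists_sep p (naturals V)
  intro n hn
  refine ((hs n).mp (mem_naturals.mp hn s ?_ ?_)).2
  · exact (hs _).mpr ⟨empty_mem_naturals, zero⟩
  · intro y hy
    obtain ⟨hy, hy'⟩ := (hs y).mp hy
    exact (hs _).mpr ⟨succ_mem_naturals hy, succ y hy hy'⟩

theorem mem_naturals_of_mem : ∀ n ∈ naturals V, ∀ m ∈ n, m ∈ naturals V := by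
  refine naturals_induction _ (by simp) fun n hn ih m hm => ?_
  rcases mem_adj.mp hm with h | rfl
  · exact ih m h
  · exact hn

theorem naturals_trans : ∀ n ∈ naturals V, ∀ m ∈ n, ∀ k ∈ m, k ∈ n := by
  refine naturals_induction _ (by simp) fun n hn ih m hm k hk => ?_
  rcases mem_adj.mp hm with h | rfl
  · exact mem_adj.mpr (Or.inl (ih m h k hk))
  · exact mem_adj.mpr (Or.inl hk)

theorem empty_mem_or_eq : ∀ n ∈ naturals V, empty ∈ n ∨ n = empty := by
  refine naturals_induction _ (Or.inr rfl) fun n hn ih => Or.inl ?_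
  rcases ih with h | rfl
  · exact mem_adj.mpr (Or.inl h)
  · simp

theorem succ_mem_succ : ∀ n ∈ naturals V, ∀ m ∈ n, adj m m ∈ adj n n := by
  refine naturals_induction _ (by simp) fun n hn ih m hm => ?_
  rcases mem_adj.mp hm with h | rfl
  · exact mem_adj.mpr (Or.inl (ih m h))
  · simp

theorem naturals_total : ∀ n ∈ naturals V, ∀ m ∈ naturals V, m ∈ n ∨ m = n ∨ n ∈ m := by
  refine naturals_induction _ (fun m hm => ?_) fun n hn ih m hm => ?_
  · rcases empty_mem_or_eq m hm with h | h
    · exact Or.inr (Or.inr h)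
    · exact Or.inr (Or.inl h)
  · rcases ih m hm with h | rfl | h
    · exact Or.inl (mem_adj.mpr (Or.inl h))
    · exact Or.inl (by simp)
    · rcases mem_adj.mp (succ_mem_succ m hm n h) with h | h
      · exact Or.inr (Or.inr h)
      · exact Or.inr (Or.inl h.symm)

theorem succ_ne_empty (x : V) : adj x x ≠ empty := fun h => not_mem_empty x (h ▸ by simp)

theorem succ_inj {x y : V} (h : adj x x = adj y y) : x = y := by
  have h1 : x ∈ adj y y := h ▸ by simp
  have h2 : y ∈ adj x x := h ▸ by simp
  rcases mem_adj.mp h1 with h1 | h1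
  · rcases mem_adj.mp h2 with h2 | h2
    · exact (mem_asymm h1 h2).elim
    · exact h2.symm
  · exact h1

/-- A definable property that holds somewhere holds at an `∈`-minimal natural number. -/
theorem exists_least (p : V → Prop) [Def (dfn V) p] {n : V} (hn : n ∈ naturals V) (hp : p n) :
    ∃ m ∈ naturals V, p m ∧ ∀ k ∈ m, ¬ p k := by
  obtain ⟨s, hs⟩ := exists_sep p (naturals V)
  obtain ⟨m, hm, hm'⟩ := found s ⟨n, (hs n).mpr ⟨hn, hp⟩⟩
  obtain ⟨hm, hpm⟩ := (hs m).mp hm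
  exact ⟨m, hm, hpm, fun k hk hpk =>
    hm' k hk ((hs k).mpr ⟨mem_naturals_of_mem m hm k hk, hpk⟩)⟩

/-- Natural numbers `m` and `n` are below a common natural number. -/
theorem exists_upper {m n : V} (hm : m ∈ naturals V) (hn : n ∈ naturals V) :
    ∃ k ∈ naturals V, m ∈ k ∧ n ∈ k := by
  rcases naturals_total n hn m hm with h | rfl | h
  · exact ⟨_, succ_mem_naturals hn, mem_adj.mpr (Or.inl h), by simp⟩
  · exact ⟨_, succ_mem_naturals hn, by simp, by simp⟩
  · exact ⟨_, succ_mem_naturals hm, by simp, mem_adj.mpr (Or.inl h)⟩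

/-! ### Iteration -/

/-- `f` is a set of pairs `⟨n, v⟩`, each justified by `v` being the `n`-th iterate of `F` at `a`. -/
def Grounded (F : V → V) (a f : V) : Prop :=
  ∀ p ∈ f, p = opair empty a ∨ ∃ k v, opair k v ∈ f ∧ p = opair (adj k k) (F v)

/-- By induction, each natural number `n` has exactly one value `v` such that `⟨n, v⟩` lies in a
grounded set, since a pair at `n + 1` can only be justified by a pair at `n`. Replacement collects
these values. No grounded set has to be a function on all of `n`, which avoids gluing
approximations. -/
theorem exists_iterates (F : V → V) [hF : DefMap (dfn V) F] (a : V) :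
    ∃ s : V, a ∈ s ∧ ∀ x ∈ s, F x ∈ s := by
  have hF' : ∀ {Γ : Type u} [Coded (dfn V) Γ] (f : Γ → V) [DefMap (dfn V) f],
      DefMap (dfn V) fun x => F (f x) := fun {_} _ _ _ => hF.comp inferInstance
  have key : ∀ n ∈ naturals V, ∃ v, ∀ v', (∃ f, Grounded F a f ∧ opair n v' ∈ f) ↔ v' = v := by
    unfold Grounded
    refine naturals_induction _ ⟨a, fun v' => ⟨?_, ?_⟩⟩ fun n hn ⟨v, hv⟩ => ⟨F v, fun v' => ⟨?_, ?_⟩⟩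
    · rintro ⟨f, hf, hv⟩
      rcases hf _ hv with h | ⟨k, w, -, h⟩
      · exact (opair_inj.mp h).2
      · exact (succ_ne_empty _ (opair_inj.mp h).1.symm).elim
    · rintro rfl
      exact ⟨adj empty (opair empty v'), fun p hp => Or.inl (by simpa using hp), by simp⟩
    · rintro ⟨f, hf, hv'⟩
      rcases hf _ hv' with h | ⟨k, w, hw, h⟩
      · exact (succ_ne_empty _ (opair_inj.mp h).1).elim
      · obtain ⟨h1, rfl⟩ := opair_inj.mp h
        obtain rfl := succ_inj h1
        rw [(hv w).mp ⟨f, hf, hw⟩]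
    · rintro rfl
      obtain ⟨f, hf, h⟩ := (hv v).mpr rfl
      refine ⟨adj f (opair (adj n n) (F v)), fun p hp => ?_, by simp⟩
      rcases mem_adj.mp hp with hp | rfl
      · rcases hf p hp with h | ⟨k, w, hw, h⟩
        · exact Or.inl h
        · exact Or.inr ⟨k, w, mem_adj.mpr (Or.inl hw), h⟩
      · exact Or.inr ⟨n, v, mem_adj.mpr (Or.inl h), rfl⟩
  obtain ⟨s, hs⟩ := repl (fun n v => ∃ f, Grounded F a f ∧ opair n v ∈ f)
    (by
      change Def (dfn V) _
      unfold Grounded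
      infer_instance) (naturals V) key
  refine ⟨s, (hs a).mpr ⟨empty, empty_mem_naturals, adj empty (opair empty a),
    fun p hp => Or.inl (by simpa using hp), by simp⟩, fun v hv => ?_⟩
  obtain ⟨n, hn, f, hf, h⟩ := (hs v).mp hv
  refine (hs _).mpr ⟨adj n n, succ_mem_naturals hn, adj f (opair (adj n n) (F v)),
    fun p hp => ?_, by simp⟩
  rcases mem_adj.mp hp with hp | rfl
  · rcases hf p hp with h | ⟨k, w, hw, h⟩
    · exact Or.inl h
    · exact Or.inr ⟨k, w, mem_adj.mpr (Or.inl hw), h⟩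
  · exact Or.inr ⟨n, v, mem_adj.mpr (Or.inl h), rfl⟩

/-- There is a set that contains all subsets of a given transitive set, and is closed under
adjunction. -/
theorem exists_closed_adj (a : V) (ha : ∀ x ∈ a, x ⊆ a) :
    ∃ w : V, powerset a ⊆ w ∧ ∀ x ∈ w, ∀ y ∈ w, adj x y ∈ w := by
  obtain ⟨s₀, ha₀, hs₀⟩ := exists_iterates powerset a
  -- Passing to the least set that contains `a` and is closed under power sets provides induction
  -- over the stages. The required set is the union of these stages, which are transitive, contain
  -- `a`, and are directed under inclusion.
  obtain ⟨s, hs⟩ := exists_sep (fun x : V => ∀ t : V, a ∈ t → (∀ y, y ∈ t → powerset y ∈ t) → x ∈ t)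
    s₀
  have has : a ∈ s := (hs a).mpr ⟨ha₀, fun t h _ => h⟩
  have hss : ∀ x ∈ s, powerset x ∈ s := fun x hx =>
    (hs _).mpr ⟨hs₀ x ((hs x).mp hx).1, fun t h h' => h' _ (((hs x).mp hx).2 t h h')⟩
  have ind : ∀ (p : V → Prop) [Def (dfn V) p], p a → (∀ x ∈ s, p x → p (powerset x)) →
      ∀ x ∈ s, p x := by
    intro p _ h h' x hx
    obtain ⟨t, ht⟩ := exists_sep p s
    refine ((ht x).mp (((hs x).mp hx).2 t ((ht a).mpr ⟨has, h⟩) fun y hy => ?_)).2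
    obtain ⟨hy, hy'⟩ := (ht y).mp hy
    exact (ht _).mpr ⟨hss y hy, h' y hy hy'⟩
  have trans : ∀ x ∈ s, ∀ y ∈ x, y ⊆ x :=
    ind _ ha fun x hx ih y hy z hz => mem_powerset.mpr (ih z (mem_powerset.mp hy z hz))
  have sub : ∀ x ∈ s, a ⊆ x :=
    ind _ (fun z hz => hz) fun x hx ih z hz => mem_powerset.mpr (trans x hx z (ih z hz))
  have directed : ∀ x ∈ s, ∀ y ∈ s, ∃ z ∈ s, x ⊆ z ∧ y ⊆ z := by
    refine ind _ (fun y hy => ⟨y, hy, sub y hy, fun z hz => hz⟩) fun x hx ih y hy => ?_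
    obtain ⟨z, hz, hxz, hyz⟩ := ih y hy
    exact ⟨powerset z, hss z hz,
      fun v hv => mem_powerset.mpr fun w hw => hxz w (mem_powerset.mp hv w hw),
      fun v hv => mem_powerset.mpr (trans z hz v (hyz v hv))⟩
  obtain ⟨w, hw⟩ := union s
  refine ⟨w, fun x hx => (hw x).mpr ⟨_, hss a has, hx⟩, fun x hx y hy => ?_⟩
  obtain ⟨x', hx', hx⟩ := (hw x).mp hx
  obtain ⟨y', hy', hy⟩ := (hw y).mp hy
  obtain ⟨z, hz, hxz, hyz⟩ := directed x' hx' y' hy'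
  refine (hw _).mpr ⟨powerset z, hss z hz, mem_powerset.mpr fun v hv => ?_⟩
  rcases mem_adj.mp hv with hv | rfl
  · exact trans z hz x (hxz x hx) v hv
  · exact hyz v hy

end SetModel

end Definiteness

namespace Definiteness

open FirstOrder FirstOrder.Language

set_option synthInstance.maxSize 100000
set_option synthInstance.maxHeartbeats 400000

namespace SetModel

variable {V : Type u} [SetModel V] {Γ : Type u} [Coded (dfn V) Γ]

/-! ### The order of the atoms -/

/-- Infinite sets of natural numbers correspond to binary expansions of the reals in `(0, 1]`. The
whole set stands for `1`, and the set that omits only `n` stands for `1 - 2^(-n-1)`; excluding them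
removes the maximum and creates gaps that accumulate at the top only. -/
theorem exists_atoms : ∃ a : V, ∀ b, b ∈ a ↔ b ⊆ naturals V ∧
    (∀ n ∈ naturals V, ∃ m ∈ b, n ∈ m) ∧
    ∃ i ∈ naturals V, ∃ j ∈ naturals V, ¬ i = j ∧ i ∉ b ∧ j ∉ b := by
  obtain ⟨a, ha⟩ := exists_sep (fun b : V => (∀ n ∈ naturals V, ∃ m ∈ b, n ∈ m) ∧
    ∃ i ∈ naturals V, ∃ j ∈ naturals V, ¬ i = j ∧ i ∉ b ∧ j ∉ b) (powerset (naturals V))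
  exact ⟨a, fun b => by rw [ha, mem_powerset]⟩

variable (V) in
/-- The set of infinite sets of natural numbers that omit at least two natural numbers. -/
noncomputable def atoms : V := Classical.choose (exists_atoms (V := V))

theorem mem_atoms {b : V} : b ∈ atoms V ↔ b ⊆ naturals V ∧ (∀ n ∈ naturals V, ∃ m ∈ b, n ∈ m) ∧
    ∃ i ∈ naturals V, ∃ j ∈ naturals V, ¬ i = j ∧ i ∉ b ∧ j ∉ b :=
  Classical.choose_spec (exists_atoms (V := V)) b

/-- The lexicographic order of sets of natural numbers: the first difference of `b` and `c` belongs
to `c`. -/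
def LexLt (b c : V) : Prop := ∃ n ∈ c, n ∉ b ∧ ∀ m ∈ n, m ∈ b ↔ m ∈ c

instance lexLt_def (f g : Γ → V) [DefMap (dfn V) f] [DefMap (dfn V) g] :
    Def (dfn V) fun x => LexLt (f x) (g x) :=
  Def.comp₂ (q := fun a b : V => LexLt a b) (by unfold LexLt; infer_instance) f g

theorem LexLt.irrefl (b : V) : ¬ LexLt b b := fun ⟨_, h, h', _⟩ => h' h

theorem LexLt.trans {b c d : V} (hc : c ⊆ naturals V) (hd : d ⊆ naturals V) (h : LexLt b c)
    (h' : LexLt c d) : LexLt b d := by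
  obtain ⟨n, hn, hnb, hn'⟩ := h
  obtain ⟨m, hm, hmc, hm'⟩ := h'
  rcases naturals_total m (hd m hm) n (hc n hn) with h | rfl | h
  · exact ⟨n, (hm' n h).mp hn, hnb, fun k hk =>
      (hn' k hk).trans (hm' k (naturals_trans m (hd m hm) n h k hk))⟩
  · exact (hmc hn).elim
  · exact ⟨m, hm, fun hmb => hmc ((hn' m h).mp hmb), fun k hk =>
      (hn' k (naturals_trans n (hc n hn) m h k hk)).trans (hm' k hk)⟩

theorem LexLt.total {b c : V} (hb : b ⊆ naturals V) (hc : c ⊆ naturals V) :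
    LexLt b c ∨ b = c ∨ LexLt c b := by
  by_cases h : b = c
  · exact Or.inr (Or.inl h)
  · have : ∃ n, ¬ (n ∈ b ↔ n ∈ c) := by
      by_contra! hbc
      exact h (ext b c hbc)
    obtain ⟨n, hn⟩ := this
    have hn' : n ∈ naturals V := by
      by_contra hn'
      exact hn (iff_of_false (fun h => hn' (hb n h)) fun h => hn' (hc n h))
    obtain ⟨m, -, hm, hm'⟩ := exists_least (fun n => ¬ (n ∈ b ↔ n ∈ c)) hn' hn
    simp only [not_not] at hm'
    by_cases hmb : m ∈ b
    · exact Or.inr (Or.inr ⟨m, hmb, fun h => hm (iff_of_true hmb h), fun k hk => (hm' k hk).symm⟩)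
    · refine Or.inl ⟨m, ?_, hmb, hm'⟩
      by_contra h
      exact hm (iff_of_false hmb h)

theorem LexLt.asymm {b c : V} (hb : b ⊆ naturals V) (hc : c ⊆ naturals V) (h : LexLt b c) :
    ¬ LexLt c b := fun h' => irrefl b (h.trans hc hb h')

/-- Removing a natural number from an atom gives an atom. -/
theorem exists_remove {c m : V} (hc : c ∈ atoms V) (hm : m ∈ naturals V) :
    ∃ z ∈ atoms V, ∀ k, k ∈ z ↔ k ∈ c ∧ ¬ k = m := by
  obtain ⟨hcn, hcu, i, hi, j, hj, hij, hic, hjc⟩ := mem_atoms.mp hc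
  obtain ⟨z, hz⟩ := exists_sep (fun k : V => ¬ k = m) c
  refine ⟨z, mem_atoms.mpr ⟨fun k hk => hcn k ((hz k).mp hk).1, fun n hn => ?_, i, hi, j, hj, hij,
    fun h => hic ((hz i).mp h).1, fun h => hjc ((hz j).mp h).1⟩, hz⟩
  obtain ⟨p, hp, hnp, hmp⟩ := exists_upper hn hm
  obtain ⟨k, hk, hpk⟩ := hcu p hp
  have htr := naturals_trans k (hcn k hk) p hpk
  refine ⟨k, (hz k).mpr ⟨hk, ?_⟩, htr n hnp⟩
  rintro rfl
  exact mem_irrefl k (htr k hmp)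

theorem lexLt_of_remove {c m z : V} (hm : m ∈ c)
    (hz : ∀ k, k ∈ z ↔ k ∈ c ∧ ¬ k = m) : LexLt z c :=
  ⟨m, hm, fun h => ((hz m).mp h).2 rfl, fun k hk => (hz k).trans (and_iff_left (by
    rintro rfl
    exact mem_irrefl k hk))⟩

/-- Exchanging an omitted natural number `i` for a larger element `m` of an atom gives a larger
atom. -/
theorem exists_exchange {b i : V} (hb : b ∈ atoms V) (hi : i ∈ naturals V) (hib : i ∉ b) :
    ∃ z ∈ atoms V, LexLt b z ∧ ∃ m ∈ b, i ∈ m ∧ ∀ k, k ∈ z ↔ (k ∈ b ∨ k = i) ∧ ¬ k = m := by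
  obtain ⟨hbn, hbu, j, hj, hjb, hji⟩ : b ⊆ naturals V ∧ (∀ n ∈ naturals V, ∃ m ∈ b, n ∈ m) ∧
      ∃ j ∈ naturals V, j ∉ b ∧ ¬ j = i := by
    obtain ⟨hbn, hbu, j, hj, k, hk, hjk, hjb, hkb⟩ := mem_atoms.mp hb
    refine ⟨hbn, hbu, ?_⟩
    by_cases h : j = i
    · exact ⟨k, hk, hkb, fun h' => hjk (h.trans h'.symm)⟩
    · exact ⟨j, hj, hjb, h⟩
  -- Adding `i` alone could leave only one omitted number; taking out `m` ensures that `j` and `m`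
  -- are both omitted. As `m` is larger than `i`, the first difference is still `i`.
  obtain ⟨m, hm, him⟩ := hbu i hi
  have hmn := hbn m hm
  obtain ⟨z, hz⟩ := exists_sep (fun k : V => ¬ k = m) (adj b i)
  simp only [mem_adj] at hz
  refine ⟨z, mem_atoms.mpr ⟨fun k hk => ?_, fun n hn => ?_, j, hj, m, hmn, ?_, ?_, ?_⟩,
    ⟨i, (hz i).mpr ⟨Or.inr rfl, ?_⟩, hib, fun k hk => ?_⟩, m, hm, him, hz⟩
  · rcases ((hz k).mp hk).1 with h | rfl
    · exact hbn k h
    · exact hi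
  · obtain ⟨p, hp, hnp, hmp⟩ := exists_upper hn hmn
    obtain ⟨k, hk, hpk⟩ := hbu p hp
    have htr := naturals_trans k (hbn k hk) p hpk
    refine ⟨k, (hz k).mpr ⟨Or.inl hk, ?_⟩, htr n hnp⟩
    rintro rfl
    exact mem_irrefl k (htr k hmp)
  · rintro rfl
    exact hjb hm
  · exact fun h => ((hz j).mp h).1.elim hjb hji
  · exact fun h => ((hz m).mp h).2 rfl
  · rintro rfl
    exact mem_irrefl i him
  · have hki : ¬ k = i := by
      rintro rfl
      exact mem_irrefl k hk
    have hkm : ¬ k = m := by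
      rintro rfl
      exact mem_asymm hk him
    simp [hz, hki, hkm]

theorem atoms_no_min {c : V} (hc : c ∈ atoms V) : ∃ z ∈ atoms V, LexLt z c := by
  obtain ⟨m, hm, -⟩ := (mem_atoms.mp hc).2.1 empty empty_mem_naturals
  obtain ⟨z, hz, hz'⟩ := exists_remove hc ((mem_atoms.mp hc).1 m hm)
  exact ⟨z, hz, lexLt_of_remove hm hz'⟩

theorem atoms_no_max {b : V} (hb : b ∈ atoms V) : ∃ z ∈ atoms V, LexLt b z := by
  obtain ⟨-, -, i, hi, -, -, -, hib, -⟩ := mem_atoms.mp hb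
  obtain ⟨z, hz, hbz, -⟩ := exists_exchange hb hi hib
  exact ⟨z, hz, hbz⟩

/-- Remove from `c` an element beyond its first difference with `b`: the result still exceeds `b` at
that difference, and is smaller than `c`. -/
theorem atoms_dense {b c : V} (hc : c ∈ atoms V) (h : LexLt b c) :
    ∃ z ∈ atoms V, LexLt b z ∧ LexLt z c := by
  obtain ⟨n, hn, hnb, hn'⟩ := h
  obtain ⟨hcn, hcu, -⟩ := mem_atoms.mp hc
  obtain ⟨m, hm, hnm⟩ := hcu n (hcn n hn)
  obtain ⟨z, hz, hz'⟩ := exists_remove hc (hcn m hm)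
  refine ⟨z, hz, ⟨n, (hz' n).mpr ⟨hn, ?_⟩, hnb, fun k hk => ?_⟩, lexLt_of_remove hm hz'⟩
  · rintro rfl
    exact mem_irrefl n hnm
  · rw [hn' k hk, hz', and_iff_left]
    rintro rfl
    exact mem_asymm hk hnm

/-- The sets of all natural numbers except two are atoms. -/
theorem exists_cofinite {i j : V} (hi : i ∈ naturals V) (hj : j ∈ naturals V) (hij : ¬ i = j) :
    ∃ z ∈ atoms V, ∀ k, k ∈ z ↔ k ∈ naturals V ∧ ¬ k = i ∧ ¬ k = j := by
  obtain ⟨z, hz⟩ := exists_sep (fun k : V => ¬ k = i ∧ ¬ k = j) (naturals V)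
  refine ⟨z, mem_atoms.mpr ⟨fun k hk => ((hz k).mp hk).1, fun n hn => ?_, i, hi, j, hj, hij,
    fun h => ((hz i).mp h).2.1 rfl, fun h => ((hz j).mp h).2.2 rfl⟩, hz⟩
  obtain ⟨p, hp, hip, hjp⟩ := exists_upper hi hj
  obtain ⟨k, hk, hnk, hpk⟩ := exists_upper hn hp
  have htr := naturals_trans k hk p hpk
  refine ⟨k, (hz k).mpr ⟨hk, ?_, ?_⟩, hnk⟩
  · rintro rfl
    exact mem_irrefl k (htr k hip)
  · rintro rfl
    exact mem_irrefl k (htr k hjp)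

/-- Above every atom there is a non-empty set of atoms without an infimum. -/
theorem exists_no_inf {x : V} (hx : x ∈ atoms V) : ∃ Y ⊆ atoms V, (∃ y, y ∈ Y) ∧
    (∀ y ∈ Y, LexLt x y) ∧ ∀ z ∈ atoms V, (∀ y ∈ Y, LexLt z y ∨ z = y) →
      ∃ w ∈ atoms V, (∀ y ∈ Y, LexLt w y) ∧ LexLt z w := by
  obtain ⟨i, hi, hix, hi'⟩ : ∃ i ∈ naturals V, i ∉ x ∧ ∀ k ∈ i, k ∈ x := by
    obtain ⟨-, -, i, hi, -, -, -, hix, -⟩ := mem_atoms.mp hx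
    obtain ⟨i, hi, hix, h⟩ := exists_least (fun i => i ∉ x) hi hix
    exact ⟨i, hi, hix, fun k hk => not_not.mp (h k hk)⟩
  -- With `i` the least number omitted by `x`, let `Y` consist of the atoms that contain all numbers
  -- up to `i`. Among all infinite sets its infimum would be the set of all numbers except `i`,
  -- which is not an atom.
  obtain ⟨Y, hY⟩ := exists_sep (fun d : V => i ∈ d ∧ ∀ k ∈ i, k ∈ d) (atoms V)
  refine ⟨Y, fun y hy => ((hY y).mp hy).1, ?_, fun y hy => ?_, fun z hz hzY => ?_⟩
  · have hj := succ_mem_naturals hi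
    have hij : i ∈ adj i i := by simp
    have hjk : adj i i ∈ adj (adj i i) (adj i i) := by simp
    have hk := succ_mem_naturals hj
    have hik := naturals_trans _ hk _ hjk _ hij
    obtain ⟨y, hy, hy'⟩ := exists_cofinite hj hk fun h => mem_irrefl (adj i i) (h.symm ▸ hjk :)
    have key : ∀ l ∈ naturals V, l ∈ i ∨ l = i → l ∈ y := by
      intro l hl hli
      refine (hy' l).mpr ⟨hl, ?_, ?_⟩
      · rintro rfl
        exact mem_irrefl _ (mem_adj.mpr hli)
      · rintro rfl
        exact mem_asymm hjk (mem_adj.mpr hli)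
    exact ⟨y, (hY y).mpr ⟨hy, key i hi (Or.inr rfl),
      fun l hl => key l (mem_naturals_of_mem i hi l hl) (Or.inl hl)⟩⟩
  · obtain ⟨-, h, h'⟩ := (hY y).mp hy
    exact ⟨i, h, hix, fun m hm => iff_of_true (hi' m hm) (h' m hm)⟩
  · obtain ⟨hzn, hzu, p, hp, q, hq, hpq, hpz, hqz⟩ := mem_atoms.mp hz
    -- A lower bound `z` omits some number up to `i`; take the least one. Otherwise removing a later
    -- element from `z` would give an element of `Y` below `z`.
    obtain ⟨k, hk, hkz, hki, hk'⟩ : ∃ k ∈ naturals V, k ∉ z ∧ (k ∈ i ∨ k = i) ∧ ∀ l ∈ k, l ∈ z := by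
      by_contra hne
      have hall : ∀ k ∈ naturals V, (k ∈ i ∨ k = i) → k ∈ z := by
        intro k hk hki
        by_contra hkz
        obtain ⟨l, hl, hlz, hl'⟩ := exists_least (fun k => k ∉ z ∧ (k ∈ i ∨ k = i)) hk ⟨hkz, hki⟩
        refine hne ⟨l, hl, hlz.1, hlz.2, fun m hm => ?_⟩
        by_contra hmz
        refine hl' m hm ⟨hmz, Or.inl ?_⟩
        rcases hlz.2 with h | rfl
        · exact naturals_trans i hi l h m hm
        · exact hm
      obtain ⟨m, hm, him⟩ := hzu i hi
      obtain ⟨w, hw, hw'⟩ := exists_remove hz (hzn m hm)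
      have hwz := lexLt_of_remove hm hw'
      have hwY : w ∈ Y := by
        refine (hY w).mpr ⟨hw, (hw' i).mpr ⟨hall i hi (Or.inr rfl), ?_⟩, fun k hk => (hw' k).mpr
          ⟨hall k (mem_naturals_of_mem i hi k hk) (Or.inl hk), ?_⟩⟩
        · rintro rfl
          exact mem_irrefl i him
        · rintro rfl
          exact mem_asymm hk him
      rcases hzY w hwY with h | rfl
      · exact h.asymm hzn (mem_atoms.mp hw).1 hwz
      · exact LexLt.irrefl z hwz
    -- An atom omits two numbers, so a number `j` beyond `k` is omitted as well. Putting `j` in, at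
    -- the cost of a later element, enlarges `z` but leaves it unchanged up to `k`, hence still
    -- below `Y`.
    obtain ⟨j, hj, hjz, hjk⟩ : ∃ j ∈ naturals V, j ∉ z ∧ k ∈ j := by
      have : ∀ j ∈ naturals V, j ∉ z → ¬ j = k → k ∈ j := by
        intro j hj hjz hjk
        rcases naturals_total j hj k hk with h | h | h
        · exact h
        · exact (hjk h.symm).elim
        · exact (hjz (hk' j h)).elim
      by_cases h : p = k
      · exact ⟨q, hq, hqz, this q hq hqz fun h' => hpq (h.trans h'.symm)⟩
      · exact ⟨p, hp, hpz, this p hp hpz h⟩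
    obtain ⟨w, hw, hzw, m, hm, hjm, hw'⟩ := exists_exchange hz hj hjz
    refine ⟨w, hw, fun y hy => ?_, hzw⟩
    have hkm := naturals_trans m (hzn m hm) j hjm k hjk
    obtain ⟨-, hyi, hy'⟩ := (hY y).mp hy
    have hky : k ∈ y := by
      rcases hki with h | rfl
      · exact hy' k h
      · exact hyi
    refine ⟨k, hky, fun h => ?_, fun l hl => iff_of_true ?_ ?_⟩
    · rcases ((hw' k).mp h).1 with h | rfl
      · exact hkz h
      · exact mem_irrefl k hjk
    · refine (hw' l).mpr ⟨Or.inl (hk' l hl), ?_⟩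
      rintro rfl
      exact mem_asymm hl hkm
    · refine hy' l ?_
      rcases hki with h | rfl
      · exact naturals_trans i hi k h l hl
      · exact hl

/-- `b` and `c` differ below `n`, and the first difference belongs to `c`. -/
def LexLtBelow (n b c : V) : Prop := ∃ k ∈ n, k ∈ c ∧ k ∉ b ∧ ∀ m ∈ k, m ∈ b ↔ m ∈ c

instance lexLtBelow_def (h f g : Γ → V) [DefMap (dfn V) h] [DefMap (dfn V) f]
    [DefMap (dfn V) g] : Def (dfn V) fun x => LexLtBelow (h x) (f x) (g x) :=
  Def.comp₃ (q := fun n a b : V => LexLtBelow n a b) (by unfold LexLtBelow; infer_instance) h f g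

/-- Below some atom, every non-empty set of atoms has a supremum. -/
theorem exists_sup_below : ∃ x ∈ atoms V, ∀ Y : V, Y ⊆ atoms V → (∃ y, y ∈ Y) →
    (∀ y ∈ Y, LexLt y x) → ∃ z ∈ atoms V, (∀ y ∈ Y, LexLt y z ∨ y = z) ∧
      ∀ w ∈ atoms V, (∀ y ∈ Y, LexLt y w ∨ y = w) → ¬ LexLt w z := by
  have h1 : adj (empty : V) empty ∈ naturals V := succ_mem_naturals empty_mem_naturals
  have h01 : ¬ (empty : V) = adj empty empty := (succ_ne_empty empty).symm
  -- The bound omits exactly `0` and `1`, and everything below it omits them too. So does the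
  -- supremum formed below, which is why it is again an atom.
  obtain ⟨x, hx, hx'⟩ := exists_cofinite empty_mem_naturals h1 h01
  refine ⟨x, hx, fun Y hY ⟨y₀, hy₀⟩ hYx => ?_⟩
  have sub : ∀ y ∈ Y, y ⊆ naturals V := fun y hy => (mem_atoms.mp (hY y hy)).1
  have omit₀ : ∀ y ∈ Y, (empty : V) ∉ y ∧ adj empty empty ∉ y := by
    intro y hy
    obtain ⟨n, hn, hny, hn'⟩ := hYx y hy
    obtain ⟨hn, hn0, hn1⟩ := (hx' n).mp hn
    have h0n : empty ∈ n := (empty_mem_or_eq n hn).resolve_right hn0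
    have h1n : adj empty empty ∈ n := by
      rcases mem_adj.mp (succ_mem_succ n hn empty h0n) with h | h
      · exact h
      · exact (hn1 h.symm).elim
    rw [hn' _ h0n, hn' _ h1n, hx', hx']
    simp
  -- `Max n y` says that the part of `y` below `n` is lexicographically largest among the members of
  -- `Y`. Any two such `y` agree below `n`.
  let Max : V → V → Prop := fun n y => y ∈ Y ∧ ∀ y' ∈ Y, ¬ LexLtBelow n y y'
  have agree : ∀ n ∈ naturals V, ∀ y y', Max n y → Max n y' → ∀ k ∈ n, k ∈ y ↔ k ∈ y' := by
    intro n hn y y' hy hy' k hk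
    by_contra hne
    obtain ⟨l, hl, ⟨hln, hl'⟩, hmin⟩ := exists_least (fun k => k ∈ n ∧ ¬ (k ∈ y ↔ k ∈ y'))
      (mem_naturals_of_mem n hn k hk) ⟨hk, hne⟩
    have hag : ∀ m ∈ l, m ∈ y ↔ m ∈ y' := fun m hm => by
      by_contra h
      exact hmin m hm ⟨naturals_trans n hn l hln m hm, h⟩
    by_cases hly : l ∈ y
    · exact hy'.2 y hy.1 ⟨l, hln, hly, fun h => hl' (iff_of_true hly h),
        fun m hm => (hag m hm).symm⟩
    · refine hy.2 y' hy'.1 ⟨l, hln, ?_, hly, hag⟩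
      by_contra h
      exact hl' (iff_of_false hly h)
  have mono : ∀ n ∈ naturals V, ∀ m ∈ n, ∀ y, Max n y → Max m y := fun n hn m hm y hy =>
    ⟨hy.1, fun y' hy' ⟨k, hk, h⟩ => hy.2 y' hy' ⟨k, naturals_trans n hn m hm k hk, h⟩⟩
  have exMax : ∀ n ∈ naturals V, ∃ y, Max n y := by
    refine naturals_induction _ ⟨y₀, hy₀, ?_⟩ ?_
    · rintro y' - ⟨k, hk, -⟩
      exact not_mem_empty k hk
    · rintro n hn ⟨y, hy⟩
      -- Among the members that are maximal below `n`, prefer one that contains `n`; it is then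
      -- maximal below `n + 1`.
      obtain ⟨y, hy, hny⟩ : ∃ y, Max n y ∧ ∀ y', Max n y' → n ∈ y' → n ∈ y := by
        by_cases h : ∃ y', Max n y' ∧ n ∈ y'
        · obtain ⟨y', hy', h⟩ := h
          exact ⟨y', hy', fun _ _ _ => h⟩
        · exact ⟨y, hy, fun y' hy' hn' => (h ⟨y', hy', hn'⟩).elim⟩
      refine ⟨y, hy.1, ?_⟩
      rintro y' hy' ⟨k, hk, hky', hky, hag⟩
      rcases mem_adj.mp hk with hk | rfl
      · exact hy.2 y' hy' ⟨k, hk, hky', hky, hag⟩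
      · refine hky (hny y' ⟨hy', ?_⟩ hky')
        rintro y'' hy'' ⟨l, hl, hly'', hly', hag'⟩
        have htr := naturals_trans k hn l hl
        exact hy.2 y'' hy'' ⟨l, hl, hly'', fun h => hly' ((hag l hl).mp h),
          fun m hm => (hag m (htr m hm)).trans (hag' m hm)⟩
  -- The supremum is assembled digit by digit: `z` agrees up to `n` with every member of `Y` that is
  -- maximal below `n + 1`.
  obtain ⟨z, hz⟩ := exists_sep (fun n : V => ∃ y, Max (adj n n) y ∧ n ∈ y) (naturals V)
  have hzag : ∀ n ∈ naturals V, ∀ y, Max (adj n n) y → ∀ k ∈ adj n n, k ∈ z ↔ k ∈ y := by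
    intro n hn y hy k hk
    have hsn := succ_mem_naturals hn
    have hkn := mem_naturals_of_mem _ hsn k hk
    have hy' : Max (adj k k) y := by
      rcases mem_adj.mp hk with h | rfl
      · refine mono _ hsn _ ?_ y hy
        exact succ_mem_succ n hn k h
      · exact hy
    refine (hz k).trans ⟨fun ⟨_, y', h, h'⟩ => ?_, fun h => ⟨hkn, y, hy', h⟩⟩
    exact (agree _ (succ_mem_naturals hkn) y' y h hy' k (by simp)).mp h'
  have hzn : z ⊆ naturals V := fun k hk => ((hz k).mp hk).1
  have upper : ∀ y ∈ Y, LexLt y z ∨ y = z := by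
    intro y hy
    rcases LexLt.total (sub y hy) hzn with h | h | h
    · exact Or.inl h
    · exact Or.inr h
    · obtain ⟨k, hk, hkz, hag⟩ := h
      have hkn := sub y hy k hk
      obtain ⟨y', hy'⟩ := exMax _ (succ_mem_naturals hkn)
      have h := hzag k hkn y' hy'
      refine (hy'.2 y hy ⟨k, by simp, hk, fun h' => hkz ((h k (by simp)).mpr h'), fun m hm => ?_⟩).elim
      rw [← h m (mem_adj.mpr (Or.inl hm)), hag m hm]
  refine ⟨z, mem_atoms.mpr ⟨hzn, fun n hn => ?_, _, empty_mem_naturals, _, h1, h01, ?_, ?_⟩, upper,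
    fun w hw hwY ⟨k, hk, hkw, hag⟩ => ?_⟩
  -- If `z` had no element beyond `n`, a member `y` of `Y` maximal below `n + 1` would agree with
  -- `z` up to `n`. It cannot be strictly below `z`, so it equals `z`, but `y` is infinite.
  · by_contra! hbd
    obtain ⟨y, hy⟩ := exMax _ (succ_mem_naturals hn)
    have h := hzag n hn y hy
    rcases upper y hy.1 with ⟨k, hk, hky, -⟩ | rfl
    · have hkn : k ∈ adj n n := by
        rcases naturals_total n hn k (hzn k hk) with h | h | h
        · exact mem_adj.mpr (Or.inl h)
        · exact mem_adj.mpr (Or.inr h)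
        · exact (hbd k hk h).elim
      exact hky ((h k hkn).mp hk)
    · obtain ⟨m, hm, hnm⟩ := (mem_atoms.mp (hY y hy.1)).2.1 n hn
      exact hbd m hm hnm
  · intro h
    obtain ⟨-, y, hy, h⟩ := (hz _).mp h
    exact (omit₀ y hy.1).1 h
  · intro h
    obtain ⟨-, y, hy, h⟩ := (hz _).mp h
    exact (omit₀ y hy.1).2 h
  · have hkn := hzn k hk
    obtain ⟨y, hy⟩ := exMax _ (succ_mem_naturals hkn)
    have h := hzag k hkn y hy
    have hwy : LexLt w y := ⟨k, (h k (by simp)).mp hk, hkw, fun m hm => by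
      rw [hag m hm, h m (mem_adj.mpr (Or.inl hm))]⟩
    rcases hwY y hy.1 with h' | rfl
    · exact hwy.asymm (mem_atoms.mp hw).1 (sub y hy.1) h'
    · exact LexLt.irrefl y hwy

end SetModel

end Definiteness

namespace Definiteness

open FirstOrder FirstOrder.Language

set_option synthInstance.maxSize 100000
set_option synthInstance.maxHeartbeats 400000

namespace SetModel

variable {V : Type u} [SetModel V] {Γ : Type u} [Coded (dfn V) Γ]

/-! ### Hereditarily finite sets over the atoms -/

/-- Atoms are subsets of the transitive set of natural numbers, so the set from `exists_closed_adj`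
is one competitor, and the least competitor can be separated from it. -/
theorem exists_objects : ∃ o : V, ∀ u, u ∈ o ↔ ∀ t : V, empty ∈ t → atoms V ⊆ t →
    (∀ x ∈ t, x ∉ atoms V → ∀ y ∈ t, adj x y ∈ t) → u ∈ t := by
  obtain ⟨w, hw, hw'⟩ := exists_closed_adj (naturals V)
    fun n hn m hm => mem_naturals_of_mem n hn m hm
  obtain ⟨o, ho⟩ := exists_sep (fun u : V => ∀ t : V, (empty : V) ∈ t → atoms V ⊆ t →
    (∀ x, x ∈ t → x ∉ atoms V → ∀ y, y ∈ t → adj x y ∈ t) → u ∈ t) w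
  refine ⟨o, fun u => (ho u).trans ⟨And.right, fun h => ⟨h w ?_ ?_ ?_, h⟩⟩⟩
  · exact hw _ (mem_powerset.mpr fun z hz => (not_mem_empty z hz).elim)
  · exact fun b hb => hw _ (mem_powerset.mpr (mem_atoms.mp hb).1)
  · exact fun x hx _ y hy => hw' x hx y hy

variable (V) in
/-- The set of the atoms and the hereditarily finite sets over them. -/
noncomputable def objects : V := Classical.choose (exists_objects (V := V))

theorem mem_objects {u : V} : u ∈ objects V ↔ ∀ t : V, empty ∈ t → atoms V ⊆ t →
    (∀ x ∈ t, x ∉ atoms V → ∀ y ∈ t, adj x y ∈ t) → u ∈ t :=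
  Classical.choose_spec (exists_objects (V := V)) u

/-- `x` is a hereditarily finite set over the atoms. -/
def IsSet (x : V) : Prop := x ∈ objects V ∧ x ∉ atoms V

instance isSet_def : Def (dfn V) (IsSet : V → Prop) := by
  unfold IsSet
  infer_instance

instance isSet_def_comp (f : Γ → V) [DefMap (dfn V) f] : Def (dfn V) fun x => IsSet (f x) :=
  isSet_def.comp inferInstance

theorem atoms_subset_objects : atoms V ⊆ objects V := fun b hb =>
  mem_objects.mpr fun _ _ h _ => h b hb

theorem empty_mem_objects : empty ∈ objects V := mem_objects.mpr fun _ h _ _ => h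

theorem adj_mem_objects {x y : V} (hx : IsSet x) (hy : y ∈ objects V) : adj x y ∈ objects V :=
  mem_objects.mpr fun t h h' h'' => h'' x (mem_objects.mp hx.1 t h h' h'') hx.2 y
    (mem_objects.mp hy t h h' h'')

theorem objects_induction (p : V → Prop) [Def (dfn V) p] (empty : p empty)
    (atom : ∀ b ∈ atoms V, p b)
    (adj : ∀ x y, IsSet x → y ∈ objects V → p x → p y → p (adj x y)) : ∀ x ∈ objects V, p x := by
  obtain ⟨t, ht⟩ := exists_sep p (objects V)
  intro x hx
  refine ((ht x).mp (mem_objects.mp hx t ?_ ?_ ?_)).2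
  · exact (ht _).mpr ⟨empty_mem_objects, empty⟩
  · exact fun b hb => (ht b).mpr ⟨atoms_subset_objects b hb, atom b hb⟩
  · intro x hx hxa y hy
    obtain ⟨hx, hpx⟩ := (ht x).mp hx
    obtain ⟨hy, hpy⟩ := (ht y).mp hy
    exact (ht _).mpr ⟨adj_mem_objects ⟨hx, hxa⟩ hy, adj x y ⟨hx, hxa⟩ hy hpx hpy⟩

theorem not_mem_atoms_of_bounded {x n : V} (hn : n ∈ naturals V)
    (h : ∀ m ∈ x, m ∈ naturals V → m ∈ n) : x ∉ atoms V := by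
  intro hx
  obtain ⟨hxn, hxu, -⟩ := mem_atoms.mp hx
  obtain ⟨m, hm, hnm⟩ := hxu n hn
  exact mem_asymm hnm (h m hm (hxn m hm))

/-- Atoms are themselves sets of `V`, so they must not be confused with finite sets of natural
numbers. The natural numbers in a hereditarily finite set are bounded, whereas an atom is an
unbounded set of them. -/
theorem exists_bound : ∀ x ∈ objects V, x ∈ atoms V ∨
    ∃ n ∈ naturals V, ∀ m ∈ x, m ∈ naturals V → m ∈ n := by
  refine objects_induction _ (Or.inr ⟨empty, by simp⟩) (fun _ => Or.inl) ?_
  rintro x y hx hy ih -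
  obtain ⟨n, hn, hn'⟩ := ih.resolve_left hx.2
  refine Or.inr ?_
  by_cases hyn : y ∈ naturals V
  · obtain ⟨k, hk, hnk, hyk⟩ := exists_upper hn hyn
    refine ⟨k, hk, fun m hm hmn => ?_⟩
    rcases mem_adj.mp hm with h | rfl
    · exact naturals_trans k hk n hnk m (hn' m h hmn)
    · exact hyk
  · refine ⟨n, hn, fun m hm hmn => ?_⟩
    rcases mem_adj.mp hm with h | rfl
    · exact hn' m h hmn
    · exact (hyn hmn).elim

theorem isSet_empty : IsSet (empty : V) :=
  ⟨empty_mem_objects, not_mem_atoms_of_bounded empty_mem_naturals fun m hm => (not_mem_empty m hm).elim⟩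

/-- Adjoining one element preserves the bound on natural numbers, so it never produces an atom. -/
theorem isSet_adj {x y : V} (hx : IsSet x) (hy : y ∈ objects V) : IsSet (adj x y) := by
  refine ⟨adj_mem_objects hx hy, fun h => ?_⟩
  obtain ⟨hn, hu, -⟩ := mem_atoms.mp h
  obtain ⟨n, hnn, hn'⟩ := (exists_bound x hx.1).resolve_left hx.2
  obtain ⟨k, hk, hnk, hyk⟩ := exists_upper hnn (hn y (by simp))
  refine not_mem_atoms_of_bounded hk (fun m hm hmn => ?_) h
  rcases mem_adj.mp hm with h | rfl
  · exact naturals_trans k hk n hnk m (hn' m h hmn)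
  · exact hyk

/-! ### Induction and closure properties of the hereditarily finite sets. -/

theorem isSet_induction (p : V → Prop) [Def (dfn V) p] (empty : p empty)
    (adj : ∀ x y, IsSet x → y ∈ objects V → p x → p (adj x y)) : ∀ x, IsSet x → p x := by
  intro x hx
  refine (objects_induction (fun x : V => x ∈ atoms V ∨ p x) (Or.inr empty) (fun _ => Or.inl)
    ?_ x hx.1).resolve_left hx.2
  intro x y hx hy ih _
  exact Or.inr (adj x y hx hy (ih.resolve_left hx.2))

theorem mem_objects_of_mem : ∀ x : V, IsSet x → ∀ y ∈ x, y ∈ objects V := by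
  refine isSet_induction _ (by simp) fun x y hx hy ih z hz => ?_
  rcases mem_adj.mp hz with h | rfl
  · exact ih z h
  · exact hy

theorem isSet_of_mem_naturals : ∀ n ∈ naturals V, IsSet n :=
  naturals_induction _ isSet_empty fun _ _ ih => isSet_adj ih ih.1

theorem isSet_upair {x y : V} (hx : x ∈ objects V) (hy : y ∈ objects V) : IsSet (upair x y) :=
  isSet_adj (isSet_adj isSet_empty hx) hy

theorem isSet_opair {x y : V} (hx : x ∈ objects V) (hy : y ∈ objects V) : IsSet (opair x y) :=
  isSet_upair (isSet_upair hx hx).1 (isSet_upair hx hy).1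

theorem exists_binary_union {a : V} (ha : IsSet a) :
    ∀ b : V, IsSet b → ∃ c : V, IsSet c ∧ ∀ z, z ∈ c ↔ z ∈ a ∨ z ∈ b := by
  refine isSet_induction _ ⟨a, ha, by simp⟩ ?_
  rintro b y - hy ⟨c, hc, hc'⟩
  exact ⟨adj c y, isSet_adj hc hy, fun z => by rw [mem_adj, mem_adj, hc', or_assoc]⟩

theorem isSet_of_subset : ∀ x : V, IsSet x → ∀ z, z ⊆ x → IsSet z := by
  refine isSet_induction _ (fun z hz => ?_) fun x y hx hy ih z hz => ?_
  · rw [eq_empty fun w hw => not_mem_empty w (hz w hw)]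
    exact isSet_empty
  · obtain ⟨z', hz'⟩ := exists_sep (fun w : V => ¬ w = y) z
    have hs : IsSet z' := ih z' fun w hw => by
      obtain ⟨h, h'⟩ := (hz' w).mp hw
      exact (mem_adj.mp (hz w h)).resolve_right h'
    by_cases hyz : y ∈ z
    · have : z = adj z' y := eq_adj fun w => by
        rw [hz']
        by_cases h : w = y
        · simp [h, hyz]
        · simp [h]
      rw [this]
      exact isSet_adj hs hy
    · have : z = z' := ext _ _ fun w => by
        rw [hz', iff_self_and]
        rintro h rfl
        exact hyz h
      rwa [this]

/-- Replacement in `V` would not show that the image is hereditarily finite; building it by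
adjunctions does. -/
theorem exists_image (r : V → V → Prop) [hr : Def (dfn V) fun x : V × V => r x.1 x.2] :
    ∀ x : V, IsSet x → (∀ z ∈ x, ∃ y ∈ objects V, ∀ y', r z y' ↔ y' = y) →
      ∃ u : V, IsSet u ∧ ∀ y, y ∈ u ↔ ∃ z ∈ x, r z y := by
  have hr' : ∀ {Γ : Type u} [Coded (dfn V) Γ] (f g : Γ → V) [DefMap (dfn V) f]
      [DefMap (dfn V) g], Def (dfn V) fun x => r (f x) (g x) := fun f g => hr.comp₂ f g
  refine isSet_induction _ (fun _ => ⟨empty, isSet_empty, by simp⟩) fun x y hx hy ih h => ?_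
  obtain ⟨u, hu, hu'⟩ := ih fun z hz => h z (mem_adj.mpr (Or.inl hz))
  obtain ⟨v, hv, hv'⟩ := h y (by simp)
  refine ⟨adj u v, isSet_adj hu hv, fun w => ?_⟩
  simp only [mem_adj, hu', ← hv']
  constructor
  · rintro (⟨z, hz, h⟩ | h)
    · exact ⟨z, Or.inl hz, h⟩
    · exact ⟨y, Or.inr rfl, h⟩
  · rintro ⟨z, hz | rfl, hw⟩
    · exact Or.inl ⟨z, hz, hw⟩
    · exact Or.inr hw

/-- A subset of `x ∪ {y}` is a subset of `x` or is `z ∪ {y}` for some `z ⊆ x`. -/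
theorem isSet_powerset : ∀ x : V, IsSet x → IsSet (powerset x) := by
  refine isSet_induction _ ?_ fun x y hx hy ih => ?_
  · have : powerset (empty : V) = adj empty empty := ext _ _ fun z => by
      simp only [mem_powerset, mem_adj, not_mem_empty, false_or]
      refine ⟨fun h => eq_empty fun w hw => not_mem_empty w (h w hw), ?_⟩
      rintro rfl
      exact fun w hw => hw
    rw [this]
    exact isSet_adj isSet_empty empty_mem_objects
  · obtain ⟨u, hu, hu'⟩ := exists_image (fun z w : V => w = adj z y) (powerset x) ih fun z hz =>
      ⟨adj z y, adj_mem_objects (isSet_of_subset x hx z (mem_powerset.mp hz)) hy, fun _ => Iff.rfl⟩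
    obtain ⟨c, hc, hc'⟩ := exists_binary_union ih u hu
    have : powerset (adj x y) = c := ext _ _ fun z => by
      rw [hc', hu', mem_powerset, mem_powerset]
      constructor
      · intro hz
        obtain ⟨z', hz'⟩ := exists_sep (fun w : V => ¬ w = y) z
        have hzx : z' ⊆ x := fun w hw => by
          obtain ⟨h, h'⟩ := (hz' w).mp hw
          exact (mem_adj.mp (hz w h)).resolve_right h'
        by_cases hyz : y ∈ z
        · refine Or.inr ⟨z', mem_powerset.mpr hzx, eq_adj fun w => ?_⟩
          rw [hz']
          by_cases h : w = y
          · simp [h, hyz]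
          · simp [h]
        · refine Or.inl fun w hw => hzx w ((hz' w).mpr ⟨hw, ?_⟩)
          rintro rfl
          exact hyz hw
      · rintro (h | ⟨z', hz', rfl⟩) w hw
        · exact mem_adj.mpr (Or.inl (h w hw))
        · rcases mem_adj.mp hw with hw | rfl
          · exact mem_adj.mpr (Or.inl (mem_powerset.mp hz' w hw))
          · simp
    rwa [this]

theorem exists_union : ∀ x : V, IsSet x →
    ∃ y : V, IsSet y ∧ ∀ z, z ∈ y ↔ ∃ w ∈ x, w ∉ atoms V ∧ z ∈ w := by
  refine isSet_induction _ ⟨empty, isSet_empty, by simp⟩ ?_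
  rintro x y hx hy ⟨u, hu, hu'⟩
  by_cases hya : y ∈ atoms V
  · refine ⟨u, hu, fun z => (hu' z).trans (exists_congr fun w => ?_)⟩
    rw [mem_adj]
    constructor
    · exact fun h => ⟨Or.inl h.1, h.2⟩
    · rintro ⟨h | rfl, h'⟩
      · exact ⟨h, h'⟩
      · exact (h'.1 hya).elim
  · obtain ⟨c, hc, hc'⟩ := exists_binary_union hu y ⟨hy, hya⟩
    refine ⟨c, hc, fun z => ?_⟩
    rw [hc', hu']
    constructor
    · rintro (⟨w, hw, h⟩ | h)
      · exact ⟨w, mem_adj.mpr (Or.inl hw), h⟩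
      · exact ⟨y, by simp, hya, h⟩
    · rintro ⟨w, hw, h⟩
      rcases mem_adj.mp hw with hw | rfl
      · exact Or.inl ⟨w, hw, h⟩
      · exact Or.inr h.2

/-- Every hereditarily finite set is in bijection with a natural number. -/
theorem exists_bijection : ∀ x : V, IsSet x → ∃ n ∈ naturals V, ∃ f : V, IsSet f ∧
    (∀ w ∈ f, ∃ a ∈ n, ∃ b ∈ x, w = opair a b) ∧
    (∀ a ∈ n, ∃ b ∈ x, ∀ b', opair a b' ∈ f ↔ b' = b) ∧
    (∀ b ∈ x, ∃ a ∈ n, ∀ a', opair a' b ∈ f ↔ a' = a) := by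
  refine isSet_induction _ ⟨empty, empty_mem_naturals, empty, isSet_empty, by simp⟩ ?_
  rintro x y hx hy ⟨n, hn, f, hf, hfp, hfn, hfx⟩
  by_cases hyx : y ∈ x
  · have : adj x y = x := (eq_adj fun w => by
      rw [iff_self_or]
      rintro rfl
      exact hyx).symm
    rw [this]
    exact ⟨n, hn, f, hf, hfp, hfn, hfx⟩
  · refine ⟨adj n n, succ_mem_naturals hn, adj f (opair n y),
      isSet_adj hf (isSet_opair (isSet_of_mem_naturals n hn).1 hy).1, ?_, ?_, ?_⟩
    · intro w hw
      rcases mem_adj.mp hw with hw | rfl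
      · obtain ⟨a, ha, b, hb, rfl⟩ := hfp w hw
        exact ⟨a, mem_adj.mpr (Or.inl ha), b, mem_adj.mpr (Or.inl hb), rfl⟩
      · exact ⟨n, by simp, y, by simp, rfl⟩
    · intro a ha
      rcases mem_adj.mp ha with ha | rfl
      · obtain ⟨b, hb, hb'⟩ := hfn a ha
        refine ⟨b, mem_adj.mpr (Or.inl hb), fun b' => ?_⟩
        rw [mem_adj, hb', opair_inj, or_iff_left]
        rintro ⟨rfl, -⟩
        exact mem_irrefl a ha
      · refine ⟨y, by simp, fun b' => ?_⟩
        rw [mem_adj, opair_inj, or_iff_right]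
        · simp
        · intro h
          obtain ⟨a', ha', b, -, h⟩ := hfp _ h
          rw [(opair_inj.mp h).1] at ha'
          exact mem_irrefl _ ((opair_inj.mp h).1 ▸ ha' :)
    · intro b hb
      rcases mem_adj.mp hb with hb | rfl
      · obtain ⟨a, ha, ha'⟩ := hfx b hb
        refine ⟨a, mem_adj.mpr (Or.inl ha), fun a' => ?_⟩
        rw [mem_adj, ha', opair_inj, or_iff_left]
        exact fun h => hyx (h.2 ▸ hb :)
      · refine ⟨n, by simp, fun a' => ?_⟩
        rw [mem_adj, opair_inj, or_iff_right]
        · simp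
        · intro h
          obtain ⟨a, -, b', hb', h⟩ := hfp _ h
          exact hyx ((opair_inj.mp h).2 ▸ hb' :)

theorem naturals_cases : ∀ n ∈ naturals V, n = empty ∨ ∃ m ∈ naturals V, n = adj m m :=
  naturals_induction _ (Or.inl rfl) fun n hn _ => Or.inr ⟨n, hn, rfl⟩

/-! ### The structure of the hereditarily finite sets -/

variable (V) in
/-- The type of the atoms and the hereditarily finite sets over them. -/
abbrev Obj : Type u := {x : V // x ∈ objects V}

/-- Membership between objects, where atoms are considered to have no elements. -/
def Obj.mem (x y : Obj V) : Prop := x.1 ∈ y.1 ∧ y.1 ∉ atoms V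

/-- The order of the atoms. -/
def Obj.lt (x y : Obj V) : Prop := x.1 ∈ atoms V ∧ y.1 ∈ atoms V ∧ LexLt x.1 y.1

/-- The predicate of being an atom. -/
def Obj.atm (x : Obj V) : Prop := x.1 ∈ atoms V

/-- A pair has an element in the sense of `Obj.mem`, so it is not an atom and its elements are those
it has in `V`. -/
theorem Obj.isPair_iff {z x y : Obj V} : IsPair Obj.mem z x y ↔ z.1 = upair x.1 y.1 := by
  constructor
  · intro h
    have hz := ((h x).mpr (Or.inl rfl)).2
    refine SetModel.ext _ _ fun w => ?_
    constructor
    · intro hw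
      rcases (h ⟨w, mem_objects_of_mem z.1 ⟨z.2, hz⟩ w hw⟩).mp ⟨hw, hz⟩ with h | h
      · simp [← h]
      · simp [← h]
    · intro hw
      rcases mem_upair.mp hw with rfl | rfl
      · exact ((h x).mpr (Or.inl rfl)).1
      · exact ((h y).mpr (Or.inr rfl)).1
  · intro h w
    have hz : z.1 ∉ atoms V := h ▸ (isSet_upair x.2 y.2).2
    rw [Obj.mem, and_iff_left hz, h, mem_upair, Subtype.ext_iff, Subtype.ext_iff]

theorem Obj.isOrderedPair_iff {z x y : Obj V} :
    IsOrderedPair Obj.mem z x y ↔ z.1 = opair x.1 y.1 := by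
  have hxx := isSet_upair x.2 x.2
  have hxy := isSet_upair x.2 y.2
  constructor
  · intro h
    have h₁ := (h ⟨_, hxx.1⟩).mpr (Or.inl (isPair_iff.mpr rfl))
    have h₂ := (h ⟨_, hxy.1⟩).mpr (Or.inr (isPair_iff.mpr rfl))
    refine SetModel.ext _ _ fun w => ?_
    constructor
    · intro hw
      have := (h ⟨w, mem_objects_of_mem z.1 ⟨z.2, h₁.2⟩ w hw⟩).mp ⟨hw, h₁.2⟩
      rwa [isPair_iff, isPair_iff, ← mem_opair] at this
    · intro hw
      rcases mem_opair.mp hw with rfl | rfl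
      · exact h₁.1
      · exact h₂.1
  · intro h w
    have hz : z.1 ∉ atoms V := h ▸ (isSet_opair x.2 y.2).2
    rw [Obj.mem, and_iff_left hz, h, mem_opair, isPair_iff, isPair_iff]

theorem Obj.orderedPairMem_iff {x y f : Obj V} (hf : f.1 ∉ atoms V) :
    OrderedPairMem Obj.mem x y f ↔ opair x.1 y.1 ∈ f.1 := by
  constructor
  · rintro ⟨w, hw, h⟩
    rw [← isOrderedPair_iff.mp hw]
    exact h.1
  · intro h
    exact ⟨⟨_, (isSet_opair x.2 y.2).1⟩, isOrderedPair_iff.mpr rfl, h, hf⟩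

theorem Obj.isNat {n : V} (hn : n ∈ naturals V) :
    IsNat Obj.mem Obj.atm (⟨n, (isSet_of_mem_naturals n hn).1⟩ : Obj V) := by
  have trans : ∀ n (hn : n ∈ naturals V),
      IsTransitive Obj.mem (⟨n, (isSet_of_mem_naturals n hn).1⟩ : Obj V) :=
    fun n hn w hw v hv => ⟨naturals_trans n hn w hw.1 v hv.1, hw.2⟩
  refine ⟨trans n hn, fun w hw => ?_⟩
  have hwn : w.1 ∈ naturals V := by
    rcases hw with h | rfl
    · exact mem_naturals_of_mem n hn w.1 h.1
    · exact hn
  have hws := isSet_of_mem_naturals w.1 hwn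
  refine ⟨hws.2, trans w.1 hwn, ?_⟩
  rcases naturals_cases w.1 hwn with h | ⟨m, hm, h⟩
  · exact Or.inl fun v hv => not_mem_empty v.1 (h ▸ hv.1)
  · have hms := isSet_of_mem_naturals m hm
    refine Or.inr ⟨⟨m, hms.1⟩, fun v => ?_⟩
    rw [Obj.mem, Obj.mem, and_iff_left hws.2, and_iff_left hms.2, h, mem_adj, Subtype.ext_iff]

theorem Obj.exists_set (x : Obj V) : ∃ y : V, IsSet y ∧ ∀ z : Obj V, z.1 ∈ y ↔ Obj.mem z x := by
  by_cases h : x.1 ∈ atoms V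
  · exact ⟨empty, isSet_empty, fun z => iff_of_false (not_mem_empty _) fun h' => h'.2 h⟩
  · exact ⟨x.1, ⟨x.2, h⟩, fun z => (and_iff_left h).symm⟩

theorem Obj.isHFDLO : IsHFDLO (K := Obj V) Obj.mem Obj.lt Obj.atm where
  pow x := by
    obtain ⟨y, hy, hy'⟩ := exists_set x
    have hp := isSet_powerset y hy
    refine ⟨⟨_, hp.1⟩, fun z => ?_⟩
    rw [Obj.mem, and_iff_left hp.2, mem_powerset]
    constructor
    · intro h
      refine ⟨(isSet_of_subset y hy z.1 h).2, fun w hw => (hy' w).mp (h w.1 hw.1)⟩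
    · rintro ⟨hz, h⟩ w hw
      have hwo := mem_objects_of_mem z.1 ⟨z.2, hz⟩ w hw
      exact (hy' ⟨w, hwo⟩).mpr (h ⟨w, hwo⟩ ⟨hw, hz⟩)
  union x := by
    obtain ⟨y, hy, hy'⟩ := exists_set x
    obtain ⟨u, hu, hu'⟩ := exists_union y hy
    refine ⟨⟨u, hu.1⟩, hu.2, fun z => ?_⟩
    rw [Obj.mem, and_iff_left hu.2, hu']
    constructor
    · rintro ⟨w, hw, hwa, hz⟩
      have hwo := mem_objects_of_mem y hy w hw
      exact ⟨⟨w, hwo⟩, (hy' ⟨w, hwo⟩).mp hw, hz, hwa⟩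
    · rintro ⟨w, hw, hz, hwa⟩
      exact ⟨w.1, (hy' w).mpr hw, hwa, hz⟩
  finite x hx := by
    obtain ⟨n, hn, f, hf, hfp, hfn, hfx⟩ := exists_bijection x.1 ⟨x.2, hx⟩
    have hns := isSet_of_mem_naturals n hn
    have mn : ∀ a : Obj V, Obj.mem a ⟨n, hns.1⟩ ↔ a.1 ∈ n := fun a => and_iff_left hns.2
    have mx : ∀ a : Obj V, Obj.mem a x ↔ a.1 ∈ x.1 := fun a => and_iff_left hx
    have on : ∀ a ∈ n, a ∈ objects V := mem_objects_of_mem n hns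
    have ox : ∀ a ∈ x.1, a ∈ objects V := mem_objects_of_mem x.1 ⟨x.2, hx⟩
    refine ⟨⟨n, hns.1⟩, ⟨f, hf.1⟩, isNat hn, fun w hw => ?_, fun a ha => ?_, fun b hb => ?_⟩
    · obtain ⟨a, ha, b, hb, h⟩ := hfp w.1 hw.1
      exact ⟨⟨a, on a ha⟩, ⟨b, ox b hb⟩, (mn _).mpr ha, (mx _).mpr hb, isOrderedPair_iff.mpr h⟩
    · obtain ⟨b, hb, hb'⟩ := hfn a.1 ((mn a).mp ha)
      refine ⟨⟨b, ox b hb⟩, fun b' => ⟨(mx _).mpr hb, ?_⟩⟩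
      rw [orderedPairMem_iff hf.2, Subtype.ext_iff]
      exact hb' b'.1
    · obtain ⟨a, ha, ha'⟩ := hfx b.1 ((mx b).mp hb)
      refine ⟨⟨a, on a ha⟩, fun a' => ⟨(mn _).mpr ha, ?_⟩⟩
      rw [orderedPairMem_iff hf.2, Subtype.ext_iff]
      exact ha' a'.1
  ext x y hx hy h := by
    refine Subtype.ext (SetModel.ext _ _ fun z => ⟨fun hz => ?_, fun hz => ?_⟩)
    · exact ((h ⟨z, mem_objects_of_mem x.1 ⟨x.2, hx⟩ z hz⟩).mp ⟨hz, hx⟩).1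
    · exact ((h ⟨z, mem_objects_of_mem y.1 ⟨y.2, hy⟩ z hz⟩).mpr ⟨hz, hy⟩).1
  atoms_empty x hx y hy := hy.2 hx
  exists_atom := by
    obtain ⟨x, hx, -⟩ := exists_sup_below (V := V)
    exact ⟨⟨x, atoms_subset_objects x hx⟩, hx⟩
  lt_atm x y h := ⟨h.1, h.2.1⟩
  irrefl x _ h := LexLt.irrefl x.1 h.2.2
  trans x y z hx hy hz h h' :=
    ⟨hx, hz, h.2.2.trans (mem_atoms.mp hy).1 (mem_atoms.mp hz).1 h'.2.2⟩
  total x y hx hy := by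
    rcases LexLt.total (mem_atoms.mp hx).1 (mem_atoms.mp hy).1 with h | h | h
    · exact Or.inl ⟨hx, hy, h⟩
    · exact Or.inr (Or.inl (Subtype.ext h))
    · exact Or.inr (Or.inr ⟨hy, hx, h⟩)
  dense x y hx hy h := by
    obtain ⟨z, hz, hxz, hzy⟩ := atoms_dense hy h.2.2
    exact ⟨⟨z, atoms_subset_objects z hz⟩, hz, ⟨hx, hz, hxz⟩, hz, hy, hzy⟩
  no_min x hx := by
    obtain ⟨z, hz, h⟩ := atoms_no_min hx
    exact ⟨⟨z, atoms_subset_objects z hz⟩, hz, hz, hx, h⟩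
  no_max x hx := by
    obtain ⟨z, hz, h⟩ := atoms_no_max hx
    exact ⟨⟨z, atoms_subset_objects z hz⟩, hz, hx, hz, h⟩

theorem Obj.replacement (r : V → V → V → Prop)
    (hr : Def (dfn V) fun x : V × V × V => r x.1 x.2.1 x.2.2) :
    Replacement (K := Obj V) Obj.mem fun x y z => r x.1 y.1 z.1 := by
  intro p x hx
  have hr' : ∀ {Γ : Type u} [Coded (dfn V) Γ] (f g h : Γ → V) [DefMap (dfn V) f]
      [DefMap (dfn V) g] [DefMap (dfn V) h], Def (dfn V) fun x => r (f x) (g x) (h x) :=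
    fun f g h => hr.comp₃ f g h
  obtain ⟨y, hy, hy'⟩ := exists_set x
  -- Functionality is only known among objects, so the relation is cut down to object values before
  -- the image is taken.
  obtain ⟨u, hu, hu'⟩ := exists_image (fun z w : V => w ∈ objects V ∧ r p.1 z w) y hy fun z hz => by
    have hzo := mem_objects_of_mem y hy z hz
    obtain ⟨w, hw⟩ := hx ⟨z, hzo⟩ ((hy' ⟨z, hzo⟩).mp hz)
    refine ⟨w.1, w.2, fun w' => ⟨fun h => ?_, ?_⟩⟩
    · exact congrArg Subtype.val ((hw ⟨w', h.1⟩).mp h.2)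
    · rintro rfl
      exact ⟨w.2, (hw w).mpr rfl⟩
  refine ⟨⟨u, hu.1⟩, fun w => ?_⟩
  rw [Obj.mem, and_iff_left hu.2, hu']
  constructor
  · rintro ⟨z, hz, -, h⟩
    have hzo := mem_objects_of_mem y hy z hz
    exact ⟨⟨z, hzo⟩, (hy' ⟨z, hzo⟩).mp hz, h⟩
  · rintro ⟨z, hz, h⟩
    exact ⟨z.1, (hy' z).mpr hz, w.2, h⟩

/-- Foundation in `V`, applied to the set of counterexamples; membership between objects implies
membership in `V`. -/
theorem Obj.induction (p : V → Prop) [Def (dfn V) p] :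
    Induction (K := Obj V) Obj.mem fun x => p x.1 := by
  intro h
  by_contra! hne
  obtain ⟨x, hx⟩ := hne
  obtain ⟨s, hs⟩ := exists_sep (fun x : V => ¬ p x) (objects V)
  obtain ⟨y, hy, hy'⟩ := found s ⟨x.1, (hs _).mpr ⟨x.2, hx⟩⟩
  obtain ⟨hyo, hpy⟩ := (hs y).mp hy
  refine hpy (h ⟨y, hyo⟩ fun z hz => ?_)
  by_contra hpz
  exact hy' z.1 hz.1 ((hs _).mpr ⟨z.2, hpz⟩)

end SetModel

/-- The inverse of a dense linear order without endpoints is one too, and the other axioms do not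
mention the order. -/
theorem IsHFDLO.flip {K : Type*} {mem lt : K → K → Prop} {atm : K → Prop}
    (h : IsHFDLO mem lt atm) : IsHFDLO mem (fun x y => lt y x) atm where
  pow := h.pow
  union := h.union
  finite := h.finite
  ext := h.ext
  atoms_empty := h.atoms_empty
  exists_atom := h.exists_atom
  lt_atm x y hxy := (h.lt_atm y x hxy).symm
  irrefl := h.irrefl
  trans x y z hx hy hz hxy hyz := h.trans z y x hz hy hx hyz hxy
  total x y hx hy := (h.total y x hy hx).imp_right (Or.imp_left Eq.symm)
  dense x y hx hy hxy := (h.dense y x hy hx hxy).imp fun _ hz => ⟨hz.1, hz.2.2, hz.2.1⟩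
  no_min := h.no_max
  no_max := h.no_min

end Definiteness

namespace Definiteness

open FirstOrder FirstOrder.Language

set_option synthInstance.maxSize 100000
set_option synthInstance.maxHeartbeats 400000

/-! ### Definable predicates and classes -/

section

variable {M : Type u} {D : Definability M}

theorem Def.dfn₁ {p : M → Prop} (hp : Def D p) {n : ℕ} (i : Fin n) :
    D.dfn {v : Fin n → M | p (v i)} := by
  refine (congrArg D.dfn (Set.ext fun v => ?_)).mp (D.preimage (fun _ : Unit => i) hp.out)
  constructor
  · rintro ⟨_, rfl, h⟩
    exact h
  · exact fun h => ⟨_, rfl, h⟩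

theorem Def.dfn₂ {p : M → M → Prop} (hp : Def D fun x : M × M => p x.1 x.2) {n : ℕ}
    (i j : Fin n) : D.dfn {v : Fin n → M | p (v i) (v j)} := by
  refine (congrArg D.dfn (Set.ext fun v => ?_)).mp
    (D.preimage (Sum.elim (fun _ => i) fun _ => j : Unit ⊕ Unit → Fin n) hp.out)
  constructor
  · rintro ⟨_, ⟨h, h'⟩, hp⟩
    change p (v i) (v j)
    rwa [show v i = _ from h, show v j = _ from h']
  · exact fun h => ⟨(_, _), ⟨rfl, rfl⟩, h⟩

theorem def_of_dfn₁ {s : Set (Fin 1 → M)} (hs : D.dfn s) : Def D fun x => ![x] ∈ s := by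
  refine ⟨(congrArg D.dfn (Set.ext fun v => ?_)).mp (D.preimage (fun _ : Fin 1 => ()) hs)⟩
  have e : v ∘ (fun _ : Fin 1 => ()) = ![v ()] := by
    funext i
    fin_cases i
    rfl
  rw [Set.mem_preimage, e]
  constructor
  · exact fun h => ⟨_, rfl, h⟩
  · rintro ⟨_, rfl, h⟩
    exact h

theorem def_of_dfn₃ {s : Set (Fin 3 → M)} (hs : D.dfn s) :
    Def D fun x : M × M × M => ![x.1, x.2.1, x.2.2] ∈ s := by
  refine ⟨(congrArg D.dfn (Set.ext fun v => ?_)).mp (D.preimage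
    (![Sum.inl (), Sum.inr (Sum.inl ()), Sum.inr (Sum.inr ())] : Fin 3 → Unit ⊕ (Unit ⊕ Unit)) hs)⟩
  have e : v ∘ (![Sum.inl (), Sum.inr (Sum.inl ()), Sum.inr (Sum.inr ())]) =
      ![v (Sum.inl ()), v (Sum.inr (Sum.inl ())), v (Sum.inr (Sum.inr ()))] := by
    funext i
    fin_cases i <;> rfl
  rw [Set.mem_preimage, e]
  constructor
  · exact fun h => ⟨(_, _, _), ⟨rfl, rfl, rfl⟩, h⟩
  · rintro ⟨⟨a, b, c⟩, ⟨h1, h2, h3⟩, h⟩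
    rw [show v _ = a from h1, show v _ = b from h2, show v _ = c from h3]
    exact h

theorem defMap_const {L : FirstOrder.Language.{0, u}} {M : Type u} [L.Structure M] (c : M) :
    Def (Definability.ofLanguage L (Set.univ : Set M)) fun x : M => c = x := by
  refine ⟨⟨((L.con (⟨c, trivial⟩ : (Set.univ : Set M))).term).equal (Term.var ()), ?_⟩⟩
  ext v
  simp only [Set.mem_ofPred_eq, Formula.realize_equal, Term.realize_var, Term.realize_constants,
    Language.coe_con]
  constructor
  · rintro ⟨_, rfl, h⟩
    exact h
  · exact fun h => ⟨_, rfl, h⟩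

end

/-! ### Models of `PC(ZF)` as models of set theory -/

section

variable {M : Type u} [setLang.Structure M] {X : Classes M}

/-- A model of `PC(ZF)` is a model of set theory with definable classes. -/
abbrev ModelsPC.setModel (h : ModelsPC ZF M X) : SetModel M :=
  have hD := Definability.isClasses_ofLanguage h.1
  let D := Definability.ofLanguage (setLang.sum (classLang X)) (Set.univ : Set M)
  have hm : ∀ (P : ∀ n, Set (Fin n → M)) (x y : M),
      @rel₂ _ M (@sumStructure _ _ M _ (lettersStructure P)) elt x y ↔ rel₂ M setMem x y :=
    fun _ _ _ => Iff.rfl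
  have ex : ∃ P : ∀ n, Set (Fin n → M), ∀ n, P n ∈ X n := ⟨_, fun n => hD.mem n _ D.univ⟩
  { mem := fun y x => rel₂ M setMem x y
    definability := D
    def_mem := (defRel_base (D := D) (fun x y : M => rel₂ M setMem x y) (by
      convert Definability.dfn_ofLanguage X (Set.univ : Set M) setMem using 3 with v
      have : ![v 0, v 1] = v := by
        funext i
        fin_cases i <;> rfl
      rw [← this]
      rfl)).out
    def_const := defMap_const
    ext := by
      obtain ⟨P, hP⟩ := ex
      have := h.2 _ (Or.inl rfl) P hP
      simp only [Scheme.HoldsAt, Sentence.Realize, Formula.Realize, BoundedFormula.realize_all,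
        BoundedFormula.realize_imp, BoundedFormula.realize_iff, realize_binF, realize_eqF] at this
      exact this
    found := by
      obtain ⟨P, hP⟩ := ex
      have := h.2 _ (Or.inr (Or.inl rfl)) P hP
      simp only [Scheme.HoldsAt, Sentence.Realize, Formula.Realize, BoundedFormula.realize_all,
        BoundedFormula.realize_imp, BoundedFormula.realize_not, BoundedFormula.realize_inf,
        BoundedFormula.realize_ex, realize_binF, realize_isEmptyF] at this
      intro x hx
      exact this x fun hne => hx.elim hne
    pair := by
      obtain ⟨P, hP⟩ := ex
      have := h.2 _ (Or.inr (Or.inr (Or.inl rfl))) P hP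
      simp only [Scheme.HoldsAt, Sentence.Realize, Formula.Realize, BoundedFormula.realize_all,
        BoundedFormula.realize_ex, realize_isPairF] at this
      exact this
    union := by
      obtain ⟨P, hP⟩ := ex
      have := h.2 _ (Or.inr (Or.inr (Or.inr (Or.inl rfl)))) P hP
      simp only [Scheme.HoldsAt, Sentence.Realize, Formula.Realize, BoundedFormula.realize_all,
        BoundedFormula.realize_ex, BoundedFormula.realize_iff, BoundedFormula.realize_inf,
        realize_binF] at this
      exact this
    pow := by
      obtain ⟨P, hP⟩ := ex
      have := h.2 _ (Or.inr (Or.inr (Or.inr (Or.inr (Or.inl rfl))))) P hP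
      simp only [Scheme.HoldsAt, Sentence.Realize, Formula.Realize, BoundedFormula.realize_all,
        BoundedFormula.realize_ex, BoundedFormula.realize_iff, realize_subsetF,
        realize_binF] at this
      exact this
    inf := by
      obtain ⟨P, hP⟩ := ex
      have := h.2 _ (Or.inr (Or.inr (Or.inr (Or.inr (Or.inr (Or.inl rfl)))))) P hP
      simp only [Scheme.HoldsAt, Sentence.Realize, Formula.Realize, BoundedFormula.realize_all,
        BoundedFormula.realize_ex, BoundedFormula.realize_inf, BoundedFormula.realize_imp,
        realize_isEmptyF, realize_isAdjunctionF, realize_binF] at this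
      obtain ⟨x, ⟨e, he, hex⟩, hx⟩ := this
      exact ⟨x, ⟨e, hex, he⟩, fun y hy => (hx y hy).imp fun z hz => hz.symm⟩
    sep := by
      intro p hp x
      obtain ⟨P, hP, hP'⟩ := exists_letters hD (hD.mem _ _ (hp.dfn₁ (1 : Fin 2)))
      have := h.2 _ (Or.inr (Or.inr (Or.inr (Or.inr (Or.inr (Or.inr (Or.inl rfl))))))) P hP
      simp only [Scheme.HoldsAt, Sentence.Realize, Formula.Realize, BoundedFormula.realize_all,
        BoundedFormula.realize_ex, BoundedFormula.realize_inf, BoundedFormula.realize_iff,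
        realize_binF] at this
      -- All parameters are already absorbed in the definability of `p`, so the parameter place of
      -- the axiom is filled arbitrarily.
      obtain ⟨y, hy⟩ := this x x
      refine ⟨y, fun z => (hy z).trans (and_congr_right fun _ => ?_)⟩
      change ![x, z] ∈ P 2 ↔ _
      rw [hP']
      rfl
    repl := by
      intro r hr x hx
      obtain ⟨P, hP, hP'⟩ := exists_letters hD (hD.mem _ _ (hr.dfn₂ (1 : Fin 3) 2))
      have := (@realize_replF _ _ (@sumStructure _ _ M _ (lettersStructure P)) _ _).mp
        (h.2 _ (Or.inr (Or.inr (Or.inr (Or.inr (Or.inr (Or.inr (Or.inr rfl))))))) P hP)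
      have hP'' : ∀ x y z : M, ![x, y, z] ∈ P 3 ↔ r y z := fun x y z => by
        rw [hP']
        rfl
      have key : ∀ x y z : M, @Structure.RelMap _ M (@sumStructure _ _ M _ (lettersStructure P)) _
        (letter setLang 3) ![x, y, z] ↔ r y z := hP''
      simp only [key] at this
      exact this x x hx }

end

/-! ### Inner models with true equality -/

namespace InnerModel

variable {L : FirstOrder.Language.{0, 0}} {M : Type u} (dom : Set M) (hdom : dom.Nonempty)
  (rel : ∀ {n : ℕ}, L.Relations n → Set (Fin n → M))
  (hrel : ∀ {n : ℕ} (r : L.Relations n) (v : Fin n → M), v ∈ rel r → ∀ i, v i ∈ dom)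

/-- An inner model whose equality is true equality. -/
def ofEq : InnerModel L M where
  dom := dom
  eq := {v | v 0 = v 1 ∧ v 0 ∈ dom}
  rel := rel
  dom_nonempty := hdom
  eq_dom x y h := ⟨h.2, (show x = y from h.1) ▸ h.2⟩
  eq_refl x hx := ⟨rfl, hx⟩
  eq_symm x y h := ⟨(show x = y from h.1).symm, (show x = y from h.1) ▸ h.2⟩
  eq_trans x y z h h' := ⟨(show x = y from h.1).trans h'.1, h.2⟩
  rel_dom := hrel
  rel_congr r v w h h' := by
    rwa [← funext fun i => show v i = w i from (h i).1]

/-- The quotient by true equality is trivial. -/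
noncomputable def carrierEquiv : dom ≃ (ofEq dom hdom rel hrel).Carrier :=
  Equiv.ofBijective (Quotient.mk (ofEq dom hdom rel hrel).setoid) ⟨fun _ _ h =>
    Subtype.ext (Quotient.exact h).1, Quotient.mk_surjective⟩

theorem mem_trace_ofEq {n : ℕ} (s : Set (Fin n → M)) (v : Fin n → dom) :
    (carrierEquiv dom hdom rel hrel ∘ v) ∈ (ofEq dom hdom rel hrel).trace s ↔
      (fun i => (v i : M)) ∈ s := by
  constructor
  · rintro ⟨w, h, h'⟩
    rwa [← funext fun i => (carrierEquiv dom hdom rel hrel).injective (h' i)]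
  · exact fun h => ⟨v, h, fun _ => rfl⟩

variable [L.IsRelational]

/-- A family of relations on `M`, restricted to a subset. -/
abbrev domStructure : L.Structure dom where
  funMap f := isEmptyElim f
  RelMap r v := (fun i => (v i : M)) ∈ rel r

theorem realize_ofEq (φ : L.Sentence) :
    (ofEq dom hdom rel hrel).Carrier ⊨ φ ↔ @Sentence.Realize L dom (domStructure dom rel) φ := by
  let _ := domStructure dom rel
  let e : dom ≃[L] (ofEq dom hdom rel hrel).Carrier :=
    { carrierEquiv dom hdom rel hrel with
      map_fun' := fun f => isEmptyElim f
      map_rel' := fun r v => mem_trace_ofEq dom hdom rel hrel (rel r) v }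
  exact (StrongHomClass.realize_sentence e φ).symm

theorem holdsAt_ofEq (σ : Scheme L) (P : ∀ n, Set (Fin n → M)) :
    σ.HoldsAt (ofEq dom hdom rel hrel).Carrier (fun n => (ofEq dom hdom rel hrel).trace (P n)) ↔
      @Scheme.HoldsAt L σ dom (domStructure dom rel) fun n => {v | (fun i => (v i : M)) ∈ P n} := by
  let _ := domStructure dom rel
  let _ : letters.Structure dom := lettersStructure fun n => {v | (fun i => (v i : M)) ∈ P n}
  let _ : letters.Structure (ofEq dom hdom rel hrel).Carrier :=
    lettersStructure fun n => (ofEq dom hdom rel hrel).trace (P n)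
  let e : dom ≃[L.sum letters] (ofEq dom hdom rel hrel).Carrier :=
    { carrierEquiv dom hdom rel hrel with
      map_fun' := fun f => isEmptyElim f
      map_rel' := fun r v => by
        rcases r with r | r
        · exact mem_trace_ofEq dom hdom rel hrel (rel r) v
        · exact mem_trace_ofEq dom hdom rel hrel (P _) v }
  exact (StrongHomClass.realize_sentence e σ).symm

end InnerModel

/-! ### Relativization -/

/-- The range of the embedding `g` is the extension of `U`, so the relativised quantifiers range
over exactly the image of `K`. -/
theorem realize_relativize {L L' : FirstOrder.Language.{0, 0}} [L.IsRelational] {K K' : Type u}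
    [L.Structure K] [L'.Structure K'] (f : L →ᴸ L') (U : L'.Relations 1) (g : K → K')
    (hg : Function.Injective g) (hU : ∀ y, rel₁ K' U y ↔ ∃ x, g x = y)
    (hrel : ∀ (n : ℕ) (r : L.Relations n) (v : Fin n → K),
      Structure.RelMap (f.onRelation r) (g ∘ v) ↔ Structure.RelMap r v)
    {n : ℕ} (φ : L.BoundedFormula Empty n) (v : Fin n → K) :
    (relativize f U φ).Realize default (g ∘ v) ↔ φ.Realize default v := by
  have hterm : ∀ {n : ℕ} (v : Fin n → K) (t : L.Term (Empty ⊕ Fin n)),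
      (f.onTerm t).realize (Sum.elim default (g ∘ v)) = g (t.realize (Sum.elim default v)) := by
    intro n v t
    cases t with
    | var i =>
      rcases i with i | i
      · exact i.elim
      · rfl
    | func f _ => exact isEmptyElim f
  induction φ with
  | falsum => exact Iff.rfl
  | equal t s =>
    change (f.onTerm t).realize _ = (f.onTerm s).realize _ ↔ t.realize _ = s.realize _
    rw [hterm, hterm, hg.eq_iff]
  | rel r ts =>
    change Structure.RelMap (f.onRelation r) (fun i => (f.onTerm (ts i)).realize _) ↔
      Structure.RelMap r fun i => (ts i).realize _
    simp only [hterm]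
    exact hrel _ r _
  | imp φ ψ ih ih' => exact imp_congr (ih v) (ih' v)
  | all φ ih =>
    have snoc : ∀ x, Fin.snoc (α := fun _ => K') (g ∘ v) (g x) =
        g ∘ Fin.snoc (α := fun _ => K) v x := by
      intro x
      funext i
      refine Fin.lastCases ?_ (fun j => ?_) i
      · simp
      · simp
    simp only [relativize, BoundedFormula.realize_all, BoundedFormula.realize_imp, realize_unF,
      Fin.snoc_last, hU]
    constructor
    · intro h x
      refine (ih _).mp ?_
      rw [← snoc]
      exact h _ ⟨x, rfl⟩
    · rintro h _ ⟨x, rfl⟩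
      rw [snoc]
      exact (ih _).mpr (h x)

end Definiteness

namespace Definiteness

open FirstOrder FirstOrder.Language

set_option synthInstance.maxSize 100000
set_option synthInstance.maxHeartbeats 400000

namespace SetModel

variable {V : Type u} [SetModel V] {Γ : Type u} [Coded (dfn V) Γ]

/-! ### Strong models of `HF(DLO) ∧ Com` -/

/-- `w` codes the set of the objects that belong to `w`; the set of all objects belongs to `w`,
which distinguishes `w` from the objects. -/
def IsCode (w : V) : Prop := objects V ∈ w ∧ w ⊆ adj (objects V) (objects V)

instance isCode_def : Def (dfn V) (IsCode : V → Prop) := by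
  unfold IsCode
  infer_instance

instance isCode_def_comp (f : Γ → V) [DefMap (dfn V) f] : Def (dfn V) fun x => IsCode (f x) :=
  isCode_def.comp inferInstance

theorem IsCode.not_mem_objects {w : V} (hw : IsCode w) : w ∉ objects V := mem_asymm hw.1

theorem IsCode.ext {w w' : V} (hw : IsCode w) (hw' : IsCode w')
    (h : ∀ x ∈ objects V, x ∈ w ↔ x ∈ w') : w = w' := by
  refine SetModel.ext _ _ fun x => ⟨fun hx => ?_, fun hx => ?_⟩
  · rcases mem_adj.mp (hw.2 x hx) with hx' | rfl
    · exact (h x hx').mp hx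
    · exact hw'.1
  · rcases mem_adj.mp (hw'.2 x hx) with hx' | rfl
    · exact (h x hx').mpr hx
    · exact hw.1

theorem exists_code (p : V → Prop) [Def (dfn V) p] :
    ∃ w : V, IsCode w ∧ ∀ x ∈ objects V, x ∈ w ↔ p x := by
  obtain ⟨w, hw⟩ := exists_sep (fun x : V => x = objects V ∨ p x) (adj (objects V) (objects V))
  refine ⟨w, ⟨(hw _).mpr ⟨by simp, Or.inl rfl⟩, fun x hx => ((hw x).mp hx).1⟩, fun x hx => ?_⟩
  rw [hw, mem_adj]
  constructor
  · rintro ⟨-, rfl | h⟩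
    · exact (mem_irrefl _ hx).elim
    · exact h
  · exact fun h => ⟨Or.inl hx, Or.inr h⟩

variable (V) in
/-- The domain consists of the objects and the codes of sets of objects. -/
def comDom : Set V := {x | x ∈ objects V ∨ IsCode x}

/-- The relations of the model for a given order of the atoms. -/
def comRel (lt : V → V → Prop) : ∀ {n : ℕ}, (plusOne hfLang).Relations n → Set (Fin n → V)
  | _, Sum.inl HFRel.lt => {v | lt (v 0) (v 1)}
  | _, Sum.inl HFRel.mem => {v | v 0 ∈ objects V ∧ v 1 ∈ objects V ∧ v 0 ∈ v 1 ∧ v 1 ∉ atoms V}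
  | _, Sum.inl HFRel.atom => {v | v 0 ∈ atoms V}
  | _, Sum.inr SortRel.obj => {v | v 0 ∈ objects V}
  | _, Sum.inr SortRel.isIn => {v | v 0 ∈ objects V ∧ IsCode (v 1) ∧ v 0 ∈ v 1}

section

variable {lt : V → V → Prop} (hlt : ∀ x y, lt x y → x ∈ atoms V ∧ y ∈ atoms V)

theorem mem_comDom_of_comRel (hlt : ∀ x y, lt x y → x ∈ atoms V ∧ y ∈ atoms V) {n : ℕ} (r : (plusOne hfLang).Relations n) (v : Fin n → V)
    (hv : v ∈ comRel lt r) (i : Fin n) : v i ∈ comDom V := by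
  rcases r with (_ | _ | _) | (_ | _)
  · obtain ⟨h0, h1⟩ := hlt _ _ hv
    fin_cases i
    · exact Or.inl (atoms_subset_objects _ h0)
    · exact Or.inl (atoms_subset_objects _ h1)
  · fin_cases i
    · exact Or.inl hv.1
    · exact Or.inl hv.2.1
  · fin_cases i
    exact Or.inl (atoms_subset_objects _ hv)
  · fin_cases i
    exact Or.inl hv
  · fin_cases i
    · exact Or.inl hv.1
    · exact Or.inr hv.2.1

/-- The model of `HF(DLO) ∧ Com` for a given order of the atoms. -/
def comModel : InnerModel (plusOne hfLang) V :=
  .ofEq (comDom V) ⟨empty, Or.inl empty_mem_objects⟩ (comRel lt) (mem_comDom_of_comRel hlt)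

theorem comModel_isIn {X : Classes V} (hD : (dfn V).IsClasses X)
    (hdef : Def (dfn V) fun x : V × V => lt x.1 x.2) : (comModel hlt).IsIn X := by
  refine ⟨hD.mem _ _ (Def.dfn₁ (p := fun x : V => x ∈ objects V ∨ IsCode x) inferInstance 0),
    hD.mem _ _ (Def.dfn₂ (p := fun x y : V => x = y ∧ (x ∈ objects V ∨ IsCode x))
      inferInstance 0 1), fun n r => ?_⟩
  rcases r with (_ | _ | _) | (_ | _)
  · exact hD.mem _ _ (hdef.dfn₂ 0 1)
  · exact hD.mem _ _ (Def.dfn₂ (p := fun x y : V => x ∈ objects V ∧ y ∈ objects V ∧ x ∈ y ∧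
      y ∉ atoms V) inferInstance 0 1)
  · exact hD.mem _ _ (Def.dfn₁ (p := fun x : V => x ∈ atoms V) inferInstance 0)
  · exact hD.mem _ _ (Def.dfn₁ (p := fun x : V => x ∈ objects V) inferInstance 0)
  · exact hD.mem _ _ (Def.dfn₂ (p := fun x y : V => x ∈ objects V ∧ IsCode y ∧ x ∈ y)
      inferInstance 0 1)

/-- The structure of the objects for a given order of the atoms. -/
abbrev objStructure (lt : V → V → Prop) : hfLang.Structure (Obj V) where
  funMap f := isEmptyElim f
  RelMap r v := (fun i => (v i).1) ∈ comRel lt (Sum.inl r)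

theorem holdsAt_onObjects_iff (σ : Scheme hfLang) (P : ∀ n, Set (Fin n → V)) :
    @Scheme.HoldsAt _ σ.onObjects (comDom V) (InnerModel.domStructure (comDom V) (comRel lt))
      (fun n => {v | (fun i => (v i : V)) ∈ P n}) ↔
    @Scheme.HoldsAt _ σ (Obj V) (objStructure lt) fun n => {v | (fun i => (v i).1) ∈ P n} := by
  let _ := InnerModel.domStructure (comDom V) (comRel lt)
  let _ : letters.Structure (comDom V) :=
    lettersStructure fun n => {v | (fun i => (v i : V)) ∈ P n}
  let _ := objStructure lt
  let _ : letters.Structure (Obj V) := lettersStructure fun n => {v | (fun i => (v i).1) ∈ P n}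
  let g : Obj V → comDom V := fun x => ⟨x.1, Or.inl x.2⟩
  have := realize_relativize (LHom.sumMap LHom.sumInl (LHom.id letters))
    (Sum.inl (Sum.inr SortRel.obj) : ((plusOne hfLang).sum letters).Relations 1) g
    (fun x y h => Subtype.ext (congrArg (fun z : comDom V => z.1) h))
    (fun y => ⟨fun h => ⟨⟨y.1, h⟩, rfl⟩, by
      rintro ⟨x, rfl⟩
      exact x.2⟩)
    (by
      rintro n (r | r) v
      · exact Iff.rfl
      · exact Iff.rfl) σ default
  rw [show g ∘ (default : Fin 0 → Obj V) = default from Subsingleton.elim _ _] at this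
  exact this

theorem holdsAt_HFDLO {X : Classes V} (hD : (dfn V).IsClasses X)
    (h : IsHFDLO (K := Obj V) Obj.mem (fun x y => lt x.1 y.1) Obj.atm)
    (P : ∀ n, Set (Fin n → V)) (hP : ∀ n, P n ∈ X n) :
    @Scheme.HoldsAt _ HFDLO (Obj V) (objStructure lt) fun n => {v | (fun i => (v i).1) ∈ P n} := by
  let _ := objStructure lt
  have hm : rel₂ (Obj V) hfMem = Obj.mem := by
    funext x y
    exact propext ⟨fun h => h.2.2, fun h => ⟨x.2, y.2, h⟩⟩
  have e₁ : ∀ x : Obj V, (fun i => (![x] i).1) = ![x.1] := fun x => by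
    funext i
    fin_cases i
    rfl
  have e₃ : ∀ x y z : Obj V, (fun i => (![x, y, z] i).1) = ![x.1, y.1, z.1] := fun x y z => by
    funext i
    fin_cases i <;> rfl
  rw [HFDLO_holdsAt_iff, hm]
  refine ⟨?_, ?_, h⟩
  · simp only [Set.mem_ofPred_eq, e₃]
    exact Obj.replacement (fun x y z => ![x, y, z] ∈ P 3) (def_of_dfn₃ (hD.dfn 3 _ (hP 3)))
  · simp only [Set.mem_ofPred_eq, e₁]
    have := def_of_dfn₁ (hD.dfn 1 _ (hP 1))
    exact Obj.induction fun x => ![x] ∈ P 1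

/-- Since the objects form a set, separation applied to a class gives a set of objects, and
`exists_code` adds the marker. -/
theorem holdsAt_Com {X : Classes V} (hlt : ∀ x y, lt x y → x ∈ atoms V ∧ y ∈ atoms V)
    (hD : (dfn V).IsClasses X)
    (P : ∀ n, Set (Fin n → V)) (hP : ∀ n, P n ∈ X n) :
    @Scheme.HoldsAt _ Com (comDom V) (InnerModel.domStructure (comDom V) (comRel lt))
      (fun n => {v | (fun i => (v i : V)) ∈ P n}) := by
  let _ := InnerModel.domStructure (comDom V) (comRel lt)
  let _ : letters.Structure (comDom V) :=
    lettersStructure fun n => {v | (fun i => (v i : V)) ∈ P n}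
  have code : ∀ x : comDom V, ¬ x.1 ∈ objects V → IsCode x.1 := fun x hx => x.2.resolve_left hx
  have h₁ : comDom V ⊨ Com.sorts := by
    simp only [Com.sorts, Sentence.Realize, Formula.Realize, BoundedFormula.realize_all,
      BoundedFormula.realize_imp, realize_binF, realize_unF, BoundedFormula.realize_inf,
      BoundedFormula.realize_not]
    refine ⟨⟨⟨fun x y h => ?_, fun x y h => ⟨h.1, h.2.1⟩⟩, fun x h => atoms_subset_objects _ h⟩,
      fun x y h => ⟨h.1, h.2.1.not_mem_objects⟩⟩
    obtain ⟨h0, h1⟩ := hlt _ _ h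
    exact ⟨atoms_subset_objects _ h0, atoms_subset_objects _ h1⟩
  have h₂ : comDom V ⊨ Com.setExtensionality := by
    simp only [Com.setExtensionality, Sentence.Realize, Formula.Realize,
      BoundedFormula.realize_all, BoundedFormula.realize_imp, realize_binF, realize_unF,
      BoundedFormula.realize_inf, BoundedFormula.realize_not, BoundedFormula.realize_iff,
      realize_eqF]
    intro x y hxy h
    have hx := code x hxy.1
    have hy := code y hxy.2
    refine Subtype.ext (hx.ext hy fun z hz => ?_)
    have := h ⟨z, Or.inl hz⟩
    exact ⟨fun hzx => (this.mp ⟨hz, hx, hzx⟩).2.2, fun hzy => (this.mpr ⟨hz, hy, hzy⟩).2.2⟩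
  have h₃ : comDom V ⊨ Com.comprehension := by
    simp only [Com.comprehension, Sentence.Realize, Formula.Realize,
      BoundedFormula.realize_all, BoundedFormula.realize_imp, realize_unF,
      BoundedFormula.realize_inf, BoundedFormula.realize_not, BoundedFormula.realize_iff,
      BoundedFormula.realize_ex]
    have := def_of_dfn₁ (hD.dfn 1 _ (hP 1))
    obtain ⟨w, hw, hw'⟩ := exists_code fun x => ![x] ∈ P 1
    refine ⟨⟨w, Or.inr hw⟩, hw.not_mem_objects, fun x hx => ?_⟩
    have e₁ : (fun i => ((![x] : Fin 1 → comDom V) i).1) = ![x.1] := by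
      funext i
      fin_cases i
      rfl
    have key : x.1 ∈ w ↔ (fun i => ((![x] : Fin 1 → comDom V) i).1) ∈ P 1 := by
      rw [e₁]
      exact hw' x.1 hx
    exact ⟨fun h => key.mp h.2.2, fun h => ⟨hx, hw, key.mpr h⟩⟩
  have e₁ := (LHom.realize_onSentence (comDom V)
    (LHom.sumInl : plusOne hfLang →ᴸ (plusOne hfLang).sum letters) Com.sorts).mpr h₁
  have e₂ := (LHom.realize_onSentence (comDom V)
    (LHom.sumInl : plusOne hfLang →ᴸ (plusOne hfLang).sum letters) Com.setExtensionality).mpr h₂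
  simp only [Scheme.HoldsAt, Com, Sentence.Realize, Formula.Realize,
    BoundedFormula.realize_inf]
  exact ⟨⟨e₁, e₂⟩, h₃⟩

theorem comModel_isStrongModel {X : Classes V} (hD : (dfn V).IsClasses X)
    (h : IsHFDLO (K := Obj V) Obj.mem (fun x y => lt x.1 y.1) Obj.atm) :
    (comModel hlt).IsStrongModel X HFDLOCom := by
  intro P hP
  refine (InnerModel.holdsAt_ofEq _ _ _ _ HFDLOCom P).mpr ?_
  have h₁ := (holdsAt_onObjects_iff HFDLO P).mpr (holdsAt_HFDLO hD h P hP)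
  have h₂ := holdsAt_Com hlt hD P hP
  simp only [Scheme.HoldsAt, HFDLOCom, Sentence.Realize, Formula.Realize,
    BoundedFormula.realize_inf] at h₁ h₂ ⊢
  exact ⟨h₁, h₂⟩

/-- The meaning of the sentence about gaps. -/
theorem realize_gap_iff : Sentence.Realize (comModel hlt).Carrier Com.gap ↔
    ∀ x ∈ atoms V, ∃ Y : V, IsCode Y ∧ (∃ y ∈ objects V, y ∈ Y) ∧
      (∀ y ∈ objects V, y ∈ Y → y ∈ atoms V ∧ lt y x) ∧
      ∀ z ∈ atoms V, (∀ y ∈ objects V, y ∈ Y → lt y z ∨ y = z) →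
        ∃ w ∈ atoms V, (∀ y ∈ objects V, y ∈ Y → lt y w ∨ y = w) ∧ lt w z := by
  refine (InnerModel.realize_ofEq _ _ _ _ Com.gap).trans ?_
  let _ := InnerModel.domStructure (comDom V) (comRel lt)
  have rl : ∀ x y : comDom V, rel₂ (comDom V) Com.lt x y ↔ lt x.1 y.1 := fun _ _ => Iff.rfl
  have ri : ∀ x y : comDom V, rel₂ (comDom V) Com.isIn x y ↔
      x.1 ∈ objects V ∧ IsCode y.1 ∧ x.1 ∈ y.1 := fun _ _ => Iff.rfl
  have ra : ∀ x : comDom V, rel₁ (comDom V) Com.atom x ↔ x.1 ∈ atoms V := fun _ => Iff.rfl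
  have ro : ∀ x : comDom V, rel₁ (comDom V) Com.obj x ↔ x.1 ∈ objects V := fun _ => Iff.rfl
  have inObj : ∀ {x : V}, x ∈ objects V → x ∈ comDom V := fun h => Or.inl h
  have inAtm : ∀ {x : V}, x ∈ atoms V → x ∈ comDom V := fun h => Or.inl (atoms_subset_objects _ h)
  simp only [Com.gap, Sentence.Realize, Formula.Realize,
    BoundedFormula.realize_all, BoundedFormula.realize_imp, realize_binF, realize_unF,
    BoundedFormula.realize_inf, BoundedFormula.realize_not, BoundedFormula.realize_sup,
    BoundedFormula.realize_ex, realize_eqF, rl, ri, ra, ro]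
  constructor
  · intro h x hx
    obtain ⟨Y, ⟨⟨⟨hY, y, hy, -, hyY⟩, hlt⟩, hgap⟩⟩ := h ⟨x, inAtm hx⟩ hx
    have hY : IsCode Y.1 := Y.2.resolve_left hY
    refine ⟨Y.1, hY, ⟨y.1, hy, hyY⟩, fun y hy hyY => hlt ⟨y, inObj hy⟩ ⟨hy, hY, hyY⟩,
      fun z hz hzY => ?_⟩
    obtain ⟨w, ⟨hw, hwY⟩, hwz⟩ := hgap ⟨z, inAtm hz⟩
      ⟨hz, fun y hy => (hzY y.1 hy.1 hy.2.2).imp_right Subtype.ext⟩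
    exact ⟨w.1, hw, fun y hy hyY => (hwY ⟨y, inObj hy⟩ ⟨hy, hY, hyY⟩).imp_right
      (congrArg Subtype.val), hwz⟩
  · intro h x hx
    obtain ⟨Y, hY, ⟨y, hy, hyY⟩, hlt, hgap⟩ := h x.1 hx
    refine ⟨⟨Y, Or.inr hY⟩, ⟨⟨hY.not_mem_objects, ⟨y, inObj hy⟩, hy, hY, hyY⟩,
      fun y hy => hlt y.1 hy.1 hy.2.2⟩, ?_⟩
    rintro z ⟨hz, hzY⟩
    obtain ⟨w, hw, hwY, hwz⟩ := hgap z.1 hz fun y hy hyY => (hzY ⟨y, inObj hy⟩ ⟨hy, hY, hyY⟩).imp_right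
      (congrArg Subtype.val)
    exact ⟨⟨w, inAtm hw⟩, ⟨hw, fun y hy => (hwY y.1 hy.1 hy.2.2).imp_right Subtype.ext⟩, hwz⟩

end

/-- The order of the atoms. -/
def AtomLt (x y : V) : Prop := x ∈ atoms V ∧ y ∈ atoms V ∧ LexLt x y

end SetModel

open SetModel

/-- Every model of `PC(ZF)` has two strong models of `HF(DLO) ∧ Com` that differ in the direction
of the order, and are distinguished by the sentence about gaps. -/
theorem exists_mirrored_models (M : Type u) [setLang.Structure M] (X : Classes M)
    (h : ModelsPC ZF M X) : ∃ N₀ N₁ : InnerModel (plusOne hfLang) M, N₀.IsIn X ∧ N₁.IsIn X ∧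
      N₀.IsStrongModel X HFDLOCom ∧ N₁.IsStrongModel X HFDLOCom ∧ AreMirrored N₀ N₁ ∧
      ¬ Sentence.Realize N₀.Carrier Com.gap ∧ Sentence.Realize N₁.Carrier Com.gap := by
  let _ := h.setModel
  have hD : (dfn M).IsClasses X := Definability.isClasses_ofLanguage h.1
  have h₀ : ∀ x y : M, AtomLt x y → x ∈ atoms M ∧ y ∈ atoms M := fun x y h => ⟨h.1, h.2.1⟩
  have h₁ : ∀ x y : M, AtomLt y x → x ∈ atoms M ∧ y ∈ atoms M := fun x y h => ⟨h.2.1, h.1⟩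
  have d₀ : Def (dfn M) fun x : M × M => AtomLt x.1 x.2 := by
    unfold AtomLt
    infer_instance
  have d₁ : Def (dfn M) fun x : M × M => AtomLt x.2 x.1 := by
    unfold AtomLt
    infer_instance
  refine ⟨comModel h₀, comModel h₁, comModel_isIn h₀ hD d₀, comModel_isIn h₁ hD d₁,
    comModel_isStrongModel h₀ hD Obj.isHFDLO, comModel_isStrongModel h₁ hD Obj.isHFDLO.flip,
    ⟨rfl, rfl, rfl, rfl, rfl, rfl, fun _ _ => Iff.rfl⟩, ?_, ?_⟩
  · rw [realize_gap_iff]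
    intro hgap
    obtain ⟨x, hx, hsup⟩ := exists_sup_below (V := M)
    obtain ⟨Y, hY, ⟨y, hy, hyY⟩, hlt, hgap⟩ := hgap x hx
    -- Besides atoms, a code contains the marker `objects M`, which has to be dropped before `Y` is
    -- compared with a set of atoms.
    obtain ⟨Z, hZ⟩ := exists_sep (fun y : M => y ∈ atoms M) Y
    have mem : ∀ y ∈ Z, y ∈ objects M ∧ y ∈ Y := fun y hy =>
      ⟨atoms_subset_objects y ((hZ y).mp hy).2, ((hZ y).mp hy).1⟩
    have mem' : ∀ y ∈ objects M, y ∈ Y → y ∈ Z := fun y hy hyY =>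
      (hZ y).mpr ⟨hyY, (hlt y hy hyY).1⟩
    obtain ⟨z, hz, hzZ, hmin⟩ := hsup Z (fun y hy => ((hZ y).mp hy).2) ⟨y, mem' y hy hyY⟩
      fun y hy => (hlt y (mem y hy).1 (mem y hy).2).2.2.2
    obtain ⟨w, hw, hwY, hwz⟩ := hgap z hz fun y hy hyY =>
      (hzZ y (mem' y hy hyY)).imp_left fun h => ⟨(hlt y hy hyY).1, hz, h⟩
    exact hmin w hw (fun y hy => (hwY y (mem y hy).1 (mem y hy).2).imp_left fun h => h.2.2) hwz.2.2
  · rw [realize_gap_iff]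
    intro x hx
    -- In the inverse order, a set below `x` without a supremum is a set above `x` without an
    -- infimum.
    obtain ⟨Z, hZ, ⟨y, hy⟩, hxZ, hgap⟩ := exists_no_inf hx
    obtain ⟨Y, hY, hYZ⟩ := exists_code fun y : M => y ∈ Z
    have mem : ∀ y ∈ Z, y ∈ objects M ∧ y ∈ Y := fun y hy =>
      ⟨atoms_subset_objects y (hZ y hy), (hYZ y (atoms_subset_objects y (hZ y hy))).mpr hy⟩
    refine ⟨Y, hY, ⟨y, mem y hy⟩, fun y hy hyY => ?_, fun z hz hzY => ?_⟩
    · have hyZ := (hYZ y hy).mp hyY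
      exact ⟨hZ y hyZ, hx, hZ y hyZ, hxZ y hyZ⟩
    · obtain ⟨w, hw, hwZ, hzw⟩ := hgap z hz fun y hy =>
        (hzY y (mem y hy).1 (mem y hy).2).imp (fun h => h.2.2) Eq.symm
      exact ⟨w, hw, fun y hy hyY => Or.inl ⟨hw, hZ y ((hYZ y hy).mp hyY),
        hwZ y ((hYZ y hy).mp hyY)⟩, hz, hw, hzw⟩

/-- Both models have the same domain and the same equality, and this equality serves as the
bijection. -/
theorem AreMirrored.equinumerous {M : Type u} {N₀ N₁ : InnerModel (plusOne hfLang) M}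
    {X : Classes M} (h : AreMirrored N₀ N₁) (h₀ : N₀.IsIn X) : N₀.Equinumerous N₁ X := by
  obtain ⟨hdom, heq, -⟩ := h
  refine ⟨N₀.eq, h₀.2.1, fun x hx => ⟨x, hdom ▸ hx, N₀.eq_refl x hx⟩,
    fun y hy => ⟨y, hdom ▸ hy, N₀.eq_refl y (hdom ▸ hy)⟩, ?_⟩
  intro x _ x' _ y _ y' _ hxy hxy'
  rw [← heq]
  exact ⟨fun h => N₀.eq_trans _ _ _ (N₀.eq_symm _ _ hxy) (N₀.eq_trans _ _ _ h hxy'),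
    fun h => N₀.eq_trans _ _ _ hxy (N₀.eq_trans _ _ _ h (N₀.eq_symm _ _ hxy'))⟩

theorem nonCompleteInEveryCardinalityIn_HFDLOCom_ZF :
    NonCompleteInEveryCardinalityIn.{u} HFDLOCom ZF := by
  intro M _ X h
  obtain ⟨N₀, N₁, hi₀, hi₁, hs₀, hs₁, hm, hg₀, hg₁⟩ := exists_mirrored_models M X h
  refine ⟨N₀, N₁, hi₀, hi₁, hs₀, hs₁, hm.equinumerous hi₀, fun he => hg₀ ?_⟩
  exact (elementarilyEquivalent_iff.mp he Com.gap).mpr hg₁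

end Definiteness

namespace Definiteness

open FirstOrder FirstOrder.Language

/-! ### Substitution of formulas for relation symbols -/

section

variable {L : FirstOrder.Language.{0, u}} [L.IsRelational] {L' : FirstOrder.Language.{0, 0}}
  {T : Type*} {α : Type*}

/-- The variable that a term of a relational language consists of. -/
def termVar {β : Type*} : L.Term β → β
  | .var b => b
  | .func f _ => isEmptyElim f

theorem realize_eq_termVar {K β : Type*} [L.Structure K] (v : β → K) (t : L.Term β) :
    t.realize v = v (termVar t) := by
  cases t with
  | var b => rfl
  | func f _ => exact isEmptyElim f

/-- Substitution of formulas with parameters from `T` for the relation symbols. -/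
def substRel (s : ∀ {n : ℕ}, L.Relations n → L'.Formula (T ⊕ Fin n)) :
    ∀ {m : ℕ}, L.BoundedFormula α m → L'.BoundedFormula (T ⊕ α) m
  | _, .falsum => .falsum
  | _, .equal t t' => .equal (.var (Sum.map Sum.inr id (termVar t)))
      (.var (Sum.map Sum.inr id (termVar t')))
  | m, .rel r ts => (BoundedFormula.relabel (n := m) (Sum.elim (fun t => Sum.inl (Sum.inl t))
      fun i => Sum.map Sum.inr id (termVar (ts i))) (s r) : L'.BoundedFormula (T ⊕ α) (m + 0))
  | _, .imp φ ψ => .imp (substRel s φ) (substRel s ψ)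
  | _, .all φ => .all (substRel s φ)

/-- Used in two ways: relations definable from definable classes are definable, and a scheme
instantiated with definable classes is a first-order formula with parameters. -/
theorem realize_substRel {K : Type*} [L.Structure K] [L'.Structure K]
    (s : ∀ {n : ℕ}, L.Relations n → L'.Formula (T ⊕ Fin n)) (a : T → K)
    (hs : ∀ (n : ℕ) (r : L.Relations n) (v : Fin n → K),
      (s r).Realize (Sum.elim a v) ↔ Structure.RelMap r v) {m : ℕ} (φ : L.BoundedFormula α m)
    (v : α → K) (xs : Fin m → K) :
    (substRel s φ).Realize (Sum.elim a v) xs ↔ φ.Realize v xs := by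
  have key : ∀ {m : ℕ} (xs : Fin m → K) (x : α ⊕ Fin m),
      Sum.elim (Sum.elim a v) xs (Sum.map Sum.inr id x) = Sum.elim v xs x := by
    rintro m xs (x | x) <;> rfl
  induction φ with
  | falsum => exact Iff.rfl
  | equal t t' =>
    change Sum.elim (Sum.elim a v) xs _ = Sum.elim (Sum.elim a v) xs _ ↔ t.realize _ = t'.realize _
    rw [key, key, realize_eq_termVar, realize_eq_termVar]
  | rel r ts =>
    refine BoundedFormula.realize_relabel.trans ?_
    change _ ↔ Structure.RelMap r fun i => (ts i).realize _
    rw [← hs, Formula.Realize, iff_eq_eq]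
    congr 1
    · funext x
      rcases x with x | x
      · rfl
      · simp only [realize_eq_termVar, Function.comp_apply, Sum.elim_inr]
        exact key xs _
    · exact Subsingleton.elim _ _
  | imp φ ψ ih ih' => exact imp_congr (ih xs) (ih' xs)
  | all φ ih => exact forall_congr' fun x => ih _

end

/-! ### Elementary submodels of the universe of sets -/

instance : setLang.Structure ZFSet.{0} where
  funMap f := isEmptyElim f
  RelMap := fun {n} (r : SetRel n) => match n, r with
    | _, .mem => fun v => v 0 ∈ v 1

/-- The universe of sets satisfies Zermelo-Fraenkel set theory for all relations. -/
theorem ZFSet.holdsAt_ZF (P : ∀ n, Set (Fin n → ZFSet.{0})) (σ : Scheme setLang) (hσ : σ ∈ ZF) :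
    σ.HoldsAt ZFSet.{0} P := by
  let _ := lettersStructure P
  have hm : ∀ x y : ZFSet.{0}, rel₂ ZFSet.{0} elt x y ↔ x ∈ y := fun _ _ => Iff.rfl
  rcases hσ with rfl | rfl | rfl | rfl | rfl | rfl | rfl | rfl
  · simp only [Scheme.HoldsAt, Sentence.Realize, Formula.Realize, BoundedFormula.realize_all,
      BoundedFormula.realize_imp, BoundedFormula.realize_iff, realize_binF, realize_eqF, hm]
    exact fun x y h => ZFSet.ext fun z => h z
  · simp only [Scheme.HoldsAt, Sentence.Realize, Formula.Realize, BoundedFormula.realize_all,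
      BoundedFormula.realize_imp, BoundedFormula.realize_not, BoundedFormula.realize_inf,
      BoundedFormula.realize_ex, realize_binF, realize_isEmptyF, hm]
    intro x hx
    obtain ⟨y, hy, h⟩ := ZFSet.regularity x fun h => hx fun y => h ▸ ZFSet.notMem_empty y
    exact ⟨y, hy, fun z hz hzx => ZFSet.notMem_empty z (h ▸ ZFSet.mem_inter.mpr ⟨hzx, hz⟩)⟩
  · simp only [Scheme.HoldsAt, Sentence.Realize, Formula.Realize, BoundedFormula.realize_all,
      BoundedFormula.realize_ex, realize_isPairF, IsPair, hm]
    exact fun x y => ⟨{x, y}, fun z => ZFSet.mem_pair⟩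
  · simp only [Scheme.HoldsAt, Sentence.Realize, Formula.Realize, BoundedFormula.realize_all,
      BoundedFormula.realize_ex, BoundedFormula.realize_iff, BoundedFormula.realize_inf,
      realize_binF, hm]
    exact fun x => ⟨ZFSet.sUnion x, fun z => ZFSet.mem_sUnion⟩
  · simp only [Scheme.HoldsAt, Sentence.Realize, Formula.Realize, BoundedFormula.realize_all,
      BoundedFormula.realize_ex, BoundedFormula.realize_iff, realize_subsetF, realize_binF, hm]
    exact fun x => ⟨ZFSet.powerset x, fun z => ZFSet.mem_powerset⟩
  · simp only [Scheme.HoldsAt, Sentence.Realize, Formula.Realize, BoundedFormula.realize_all,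
      BoundedFormula.realize_ex, BoundedFormula.realize_inf, BoundedFormula.realize_imp,
      realize_isEmptyF, realize_isAdjunctionF, IsAdjunction, realize_binF, hm]
    exact ⟨ZFSet.omega, ⟨∅, ZFSet.notMem_empty, ZFSet.omega_zero⟩, fun x hx =>
      ⟨insert x x, fun z => ZFSet.mem_insert_iff.trans or_comm, ZFSet.omega_succ hx⟩⟩
  · simp only [Scheme.HoldsAt, Sentence.Realize, Formula.Realize, BoundedFormula.realize_all,
      BoundedFormula.realize_ex, BoundedFormula.realize_inf, BoundedFormula.realize_iff,
      realize_binF, hm]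
    exact fun p x => ⟨ZFSet.sep (fun z => rel₂ ZFSet.{0} (letter setLang 2) p z) x,
      fun z => ZFSet.mem_sep⟩
  · refine (realize_replF _ _).mpr fun p x hx => ?_
    classical
    choose! F hF using hx
    -- `ZFSet.image` asks for a definable function, and classically every function is.
    have := Classical.allZFSetDefinable (n := 1) fun v => F (v 0)
    have : ZFSet.Definable₁ F := this
    refine ⟨ZFSet.image F x, fun y => ?_⟩
    rw [hm, ZFSet.mem_image]
    exact exists_congr fun z => and_congr_right fun hz => by rw [hF z hz y, eq_comm]

/-- The relations that are definable with parameters form a model of `PC(ZF)`, for a structure that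
is an elementary submodel of the universe of sets. -/
theorem modelsPC_of_elementaryEmbedding {T : Type u} [setLang.Structure T]
    (f : T ↪ₑ[setLang] ZFSet.{0}) : ModelsPC ZF T fun n =>
      {s | ∃ ψ : setLang.Formula (T ⊕ Fin n), ∀ v, ψ.Realize (Sum.elim id v) ↔ v ∈ s} := by
  set X : Classes T := fun n =>
    {s | ∃ ψ : setLang.Formula (T ⊕ Fin n), ∀ v, ψ.Realize (Sum.elim id v) ↔ v ∈ s}
  refine ⟨fun n s hs => ?_, fun σ hσ P hP => ?_⟩
  · obtain ⟨φ, rfl⟩ := Set.definable_iff_exists_formula_sum.mp hs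
    have : ∀ (n : ℕ) (r : (setLang.sum (classLang X)).Relations n),
        ∃ ψ : setLang.Formula (T ⊕ Fin n), ∀ v : Fin n → T,
          ψ.Realize (Sum.elim id v) ↔ Structure.RelMap r v := by
      rintro n (r | r)
      · refine ⟨Relations.formula r fun i => Term.var (Sum.inr i), fun v => ?_⟩
        rw [Formula.realize_rel]
        exact Iff.rfl
      · exact r.2
    choose s hs using this
    have : (setLang.sum (classLang X)).IsRelational := fun n =>
      inferInstanceAs (IsEmpty (Empty ⊕ Empty))
    refine ⟨Formula.relabel (Sum.elim Sum.inl (Sum.elim (fun x => Sum.inl x.1) Sum.inr))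
      (substRel (fun {n} r => s n r) φ : setLang.Formula _), fun v => ?_⟩
    rw [Formula.realize_relabel]
    refine Iff.trans (iff_of_eq ?_) (realize_substRel (fun {n} r => s n r) id (hs) φ _ default)
    rw [Formula.Realize]
    congr 1
    funext x
    rcases x with x | x | x <;> rfl
  · choose ψ hψ using hP
    let s : ∀ {n : ℕ}, (setLang.sum letters).Relations n → setLang.Formula (T ⊕ Fin n) :=
      fun {n} r => Sum.elim (fun r : setLang.Relations n =>
        Relations.formula r fun i => Term.var (Sum.inr i)) (fun _ => ψ n) r
    have h₁ : σ.HoldsAt T P ↔ (substRel s σ).Realize (Sum.elim id default : T ⊕ Empty → T)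
        default := by
      let _ := lettersStructure P
      refine (realize_substRel s id ?_ σ default default).symm
      rintro n (r | r) v
      · exact Formula.realize_rel
      · exact hψ n v
    -- The formulas that define the classes `P` over `T` define relations `Q` on the universe of
    -- sets, where the scheme holds for all relations. After substitution it is a formula with
    -- parameters from `T`, so elementarity brings it back to `T`.
    let Q : ∀ n, Set (Fin n → ZFSet.{0}) := fun n => {v | (ψ n).Realize (Sum.elim f v)}
    have h₂ : σ.HoldsAt ZFSet.{0} Q ↔
        (substRel s σ).Realize (Sum.elim f default : T ⊕ Empty → ZFSet.{0}) default := by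
      let _ := lettersStructure Q
      have key : ∀ (n : ℕ) (r : (setLang.sum letters).Relations n) (v : Fin n → ZFSet.{0}),
          (s r).Realize (Sum.elim f v) ↔ Structure.RelMap r v := by
        rintro n (r | r) v
        · exact Formula.realize_rel
        · exact Iff.rfl
      refine Iff.trans (iff_of_eq ?_) (realize_substRel s f key σ default default).symm
      rw [Scheme.HoldsAt, Sentence.Realize, Formula.Realize]
      congr 1 <;> exact Subsingleton.elim _ _
    rw [h₁, ← f.map_boundedFormula]
    have h₃ := h₂.mp (ZFSet.holdsAt_ZF Q σ hσ)
    convert h₃ using 1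
    · funext x
      rcases x with x | x
      · rfl
      · exact x.elim

/-- `ZFSet.{0}` lives one universe above `Type`, so it does not serve for every `u`. A small
elementary substructure can be shrunk to `Type` and lifted to any universe. -/
theorem exists_modelsPC_ZF :
    ∃ (T : Type u) (_ : setLang.Structure T) (X : Classes T), ModelsPC ZF T X := by
  obtain ⟨S, hS⟩ := exists_small_elementarySubstructure setLang ZFSet.{0}
  let e : S ≃ ULift.{u} (Shrink.{0} S) := (equivShrink S).trans Equiv.ulift.symm
  let _ : setLang.Structure (ULift.{u} (Shrink.{0} S)) := e.inducedStructure
  exact ⟨_, _, _, modelsPC_of_elementaryEmbedding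
    (S.subtype.comp (e.inducedStructureEquiv (L := setLang)).symm.toElementaryEmbedding)⟩

/-- Failure in every model refutes completeness only because a model exists. -/
theorem not_completeInEveryCardinalityIn_HFDLOCom_ZF :
    ¬ CompleteInEveryCardinalityIn.{u} HFDLOCom ZF := by
  intro h
  obtain ⟨T, _, X, hX⟩ := exists_modelsPC_ZF.{u}
  obtain ⟨N₀, N₁, hi₀, hi₁, hs₀, hs₁, he, hne⟩ :=
    nonCompleteInEveryCardinalityIn_HFDLOCom_ZF T X hX
  exact hne (h T X hX N₀ N₁ hi₀ hi₁ hs₀ hs₁ he)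

end Definiteness

theorem mainTheorem10 :
    Definiteness.StandaloneCompleteIn.{u} Definiteness.HFDLO Definiteness.AS ∧
    Definiteness.NonCompleteInEveryCardinalityIn.{u} Definiteness.HFDLOCom Definiteness.ZF ∧
    ¬ Definiteness.CompleteInEveryCardinalityIn.{u} Definiteness.HFDLOCom Definiteness.ZF ∧
    -- in each model of `PC(ZF)`, two strong models of `HF(DLO) ∧ Com` that are mirror images of
    -- each other are distinguished by the sentence about gaps
    (∀ (M : Type u) [Definiteness.setLang.Structure M] (X : Definiteness.Classes M),
      Definiteness.ModelsPC Definiteness.ZF M X →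
        ∃ N₀ N₁ : Definiteness.InnerModel (Definiteness.plusOne Definiteness.hfLang) M,
          N₀.IsIn X ∧ N₁.IsIn X ∧
          N₀.IsStrongModel X Definiteness.HFDLOCom ∧ N₁.IsStrongModel X Definiteness.HFDLOCom ∧
          Definiteness.AreMirrored N₀ N₁ ∧
          ¬ FirstOrder.Language.Sentence.Realize N₀.Carrier Definiteness.Com.gap ∧
          FirstOrder.Language.Sentence.Realize N₁.Carrier Definiteness.Com.gap) := by
  exact ⟨Definiteness.standaloneCompleteIn_HFDLO_AS,
    Definiteness.nonCompleteInEveryCardinalityIn_HFDLOCom_ZF,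
    Definiteness.not_completeInEveryCardinalityIn_HFDLOCom_ZF, Definiteness.exists_mirrored_models⟩
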